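/- For $\lambda,a>0$ put $\Delta_r=(1-\lambda r^2)(r^2+a^2)-2r$, $\Delta_\theta=1+a^2\lambda\cos^2\theta$, $\rho^2=r^2+a^2\cos^2\theta$, $\chi=1+a^2\lambda$. Call $(\lambda,a)$ subextremal if $\Delta_r$ has three distinct positive roots $r_-<r_+<r_c$. In that case let $M$ be the (mass $1$) Kerr-de Sitter spacetime obtained from the blocks $\mathrm I=\{r_+<r<r_c\}$, $\mathrm{II}=\{r_-<r<r_+\}$, $\mathrm{III}=\{r>r_c\}$ of $\mathbb R_t\times(r_-,\infty)_r\times\mathbb S^2_{\theta,\varphi}$, with the metric whose Boyer-Lindquist form is $$g=-\frac{\Delta_r}{\rho^2\chi^2}\,(dt-a\sin^2\theta\,d\varphi)^2+\frac{\Delta_\theta\sin^2\theta}{\rho^2\chi^2}\,(a\,dt-(r^2+a^2)\,d\varphi)^2+\frac{\rho^2}{\Delta_r}dr^2+\frac{\rho^2}{\Delta_\theta}d\theta^2$$ (extended smoothly to the axis $\sin\theta=0$), by joining $\mathrm I$ to $\mathrm{II}$ across $\{r=r_+\}$ in the ingoing coordinates, with differentials $dt+\frac{\chi(r^2+a^2)}{\Delta_r}dr$,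 $dr$, $d\theta$, $d\varphi+\frac{\chi a}{\Delta_r}dr$, and $\mathrm I$ to $\mathrm{III}$ across $\{r=r_c\}$ in the outgoing coordinates, with differentials $dt-\frac{\chi(r^2+a^2)}{\Delta_r}dr$, $dr$, $d\theta$, $d\varphi-\frac{\chi a}{\Delta_r}dr$. The time orientation is the one for which $\partial_t$ is future-pointing where it is timelike in $\mathrm I$. For $X\in\{+,c\}$ let $\partial_{t_X}=\partial_t+\frac{a}{r_X^2+a^2}\partial_\varphi$, $\varphi_X=\varphi-\frac{a}{r_X^2+a^2}t$ and $\kappa_X=\frac{|\Delta_r'(r_X)|}{2\chi(r_X^2+a^2)}$. Let $dr_*=\frac{\chi(r^2+a^2)}{\Delta_r}dr$, $u=t-r_*$, $v=t+r_*$. The Kruskal coordinates $(U_+,V_+,\theta,\varphi_+)$ on $\{r_-<r<r_c\}\subset M$ and $(U_c,V_c,\theta,\varphi_c)$ on $\{r>r_+\}\subset M$ are the continuous extensions of $U_+=-e^{-\kappa_+u}$, $V_+=e^{\kappa_+v}$ on $\mathrm I$ ($U_+=e^{-\kappa_+u}$ on $\mathrm{II}$), and of $U_c=e^{\kappa_cu}$,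 $V_c=-e^{-\kappa_cv}$ on $\mathrm I$ ($V_c=e^{-\kappa_cv}$ on $\mathrm{III}$). They embed these sets as $\{V_+>0\}$ and $\{U_c>0\}$, respectively, in the Kruskal extensions $M_+$ and $M_c$, in which $\mathcal H=\{V_+=0\}\subset M_+$ and $\mathcal H_c=\{U_c=0\}\subset M_c$ are the long horizons. Then there are $\lambda_0>0$ and $a_0>0$ such that for all $0<\lambda<\lambda_0$ and all $0<a<a_0$ the pair $(\lambda,a)$ is subextremal, and every inextendible null geodesic of $M$ that does not approach $\mathcal H$ or $\mathcal H_c$ in the past (that is, does not converge, in the past direction, to a point of $\mathcal H$ in $M_+$ or of $\mathcal H_c$ in $M_c$) meets the region of $M$ in which $\partial_{t_+}$ and $\partial_{t_c}$ are both timelike. -/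

import Mathlib

open Filter Topology

noncomputable section

/-- A subextremal Kerr-de Sitter black hole of mass `1`, with `lam = Λ / 3` and rotation parameter
`a`: the numbers `rm < rp < rc` (in print `r₋ < r₊ < r_c`) are three distinct positive roots of
`Δ_r = (1 - lam r²)(r² + a²) - 2 r`.  As `Δ_r` has no cubic term, the fourth root is
`-(rm + rp + rc) < 0`, so `lam` and `a` determine `rm, rp, rc`. -/
structure KerrDeSitter (lam a : ℝ) where
  rm : ℝ
  rp : ℝ
  rc : ℝ
  lam_pos : 0 < lam
  a_pos : 0 < a
  rm_pos : 0 < rm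
  rm_lt_rp : rm < rp
  rp_lt_rc : rp < rc
  root_rm : (1 - lam * rm ^ 2) * (rm ^ 2 + a ^ 2) - 2 * rm = 0
  root_rp : (1 - lam * rp ^ 2) * (rp ^ 2 + a ^ 2) - 2 * rp = 0
  root_rc : (1 - lam * rc ^ 2) * (rc ^ 2 + a ^ 2) - 2 * rc = 0

namespace KerrDeSitter

/-- `Δ_r = (1 - lam r²)(r² + a²) - 2 r`. -/
def deltaR (lam a r : ℝ) : ℝ := (1 - lam * r ^ 2) * (r ^ 2 + a ^ 2) - 2 * r

/-- `χ = 1 + a² lam`. -/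
def chi (lam a : ℝ) : ℝ := 1 + a ^ 2 * lam

/-- `Δ_θ = 1 + a² lam cos² θ`, as a function of `z = cos θ`. -/
def deltaTheta (lam a z : ℝ) : ℝ := 1 + a ^ 2 * lam * z ^ 2

/-- `ρ² = r² + a² cos² θ`, as a function of `r` and `z = cos θ`. -/
def rhoSq (a r z : ℝ) : ℝ := r ^ 2 + a ^ 2 * z ^ 2

/-- The quadratic form `g(v, v)` of the Kerr-de Sitter metric in Boyer-Lindquist coordinates, at a
point with coordinates `r, θ` and for `v = vt ∂_t + vr ∂_r + vθ ∂_θ + vφ ∂_φ`. -/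
def boyerLindquist (lam a r θ vt vr vθ vφ : ℝ) : ℝ :=
  (deltaTheta lam a (Real.cos θ) * a ^ 2 * Real.sin θ ^ 2 - deltaR lam a r)
      / (rhoSq a r (Real.cos θ) * chi lam a ^ 2) * vt ^ 2
  + (deltaTheta lam a (Real.cos θ) * (r ^ 2 + a ^ 2) ^ 2 - deltaR lam a r * a ^ 2 * Real.sin θ ^ 2)
      * (Real.sin θ ^ 2 / (rhoSq a r (Real.cos θ) * chi lam a ^ 2)) * vφ ^ 2
  + 2 * (a * Real.sin θ ^ 2 / (rhoSq a r (Real.cos θ) * chi lam a ^ 2))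
      * (deltaR lam a r - deltaTheta lam a (Real.cos θ) * (r ^ 2 + a ^ 2)) * (vt * vφ)
  + rhoSq a r (Real.cos θ) / deltaR lam a r * vr ^ 2
  + rhoSq a r (Real.cos θ) / deltaTheta lam a (Real.cos θ) * vθ ^ 2

variable {lam a : ℝ} (S : KerrDeSitter lam a)

/-! ### The spacetime

The spacetime is the union of the Boyer-Lindquist blocks `I` (`rp < r < rc`), `II` (`rm < r < rp`)
and `III` (`rc < r`), where `I` is joined to `II` in the ingoing coordinates across the future
horizon `r = rp`, and to `III` in the outgoing coordinates across the future horizon `r = rc`.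
All of it is covered by the coordinates `(T, r, θ, Φ)` with
`dT = dt + s χ (r² + a²) / Δ_r dr` and `dΦ = dφ + s χ a / Δ_r dr`,
where `s` is the affine function of `r` with `s(rp) = 1` and `s(rc) = -1`: near `r = rp` they differ
from the ingoing coordinates (`s = 1`), and near `r = rc` from the outgoing coordinates (`s = -1`),
by smooth functions of `r`.  The point with coordinates `(T, r, θ, Φ)` is represented by
`(T, r, x, y, z) = (T, r, sin θ cos Φ, sin θ sin Φ, cos θ)`, which includes the axis `sin θ = 0`. -/

/-- The fourth root of `Δ_r`. -/
def rn : ℝ := -(S.rm + S.rp + S.rc)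

/-- The affine function with `s(rp) = 1`, `s(rc) = -1`. -/
def slope (r : ℝ) : ℝ := (S.rp + S.rc - 2 * r) / (S.rc - S.rp)

/-- The function `(1 - s²) / Δ_r`, extended smoothly to `r = rp` and `r = rc`. -/
def radialW (r : ℝ) : ℝ := 4 / (lam * (S.rc - S.rp) ^ 2 * ((r - S.rm) * (r - S.rn)))

/-- The points `(T, r, x, y, z)` of the spacetime `M = ℝ × (rm, ∞) × 𝕊²`. -/
def spacetime : Set (Fin 5 → ℝ) :=
  {p | S.rm < p 1 ∧ p 2 ^ 2 + p 3 ^ 2 + p 4 ^ 2 = 1}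

/-- Vectors tangent to `ℝ × (rm, ∞) × 𝕊²` at `p`. -/
def IsTangent (p v : Fin 5 → ℝ) : Prop := p 2 * v 2 + p 3 * v 3 + p 4 * v 4 = 0

/-- The one-form `sin² θ dΦ = x dy - y dx`. -/
def sigma (p v : Fin 5 → ℝ) : ℝ := p 2 * v 3 - p 3 * v 2

/-- The one-form `dT - a sin² θ dΦ`. -/
def alpha (_S : KerrDeSitter lam a) (p v : Fin 5 → ℝ) : ℝ := v 0 - a * sigma p v

/-- The Kerr-de Sitter metric `g_p(v, w)` on the spacetime (see `metric_eq_boyerLindquist`); it is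
obtained from the Boyer-Lindquist form with `dθ² + sin² θ dΦ² = dx² + dy² + dz²`. -/
def metric (p v w : Fin 5 → ℝ) : ℝ :=
  rhoSq a (p 1) (p 4) / deltaTheta lam a (p 4) * (v 2 * w 2 + v 3 * w 3 + v 4 * w 4)
  + a ^ 2 * (1 - lam * p 1 ^ 2)
      * (deltaTheta lam a (p 4) * (p 1 ^ 2 + a ^ 2) + rhoSq a (p 1) (p 4) * chi lam a)
      / (rhoSq a (p 1) (p 4) * chi lam a ^ 2 * deltaTheta lam a (p 4))
      * (sigma p v * sigma p w)
  + deltaTheta lam a (p 4) / (rhoSq a (p 1) (p 4) * chi lam a ^ 2)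
      * (a ^ 2 * (1 - p 4 ^ 2) * (v 0 * w 0)
          - a * (p 1 ^ 2 + a ^ 2) * (v 0 * sigma p w + sigma p v * w 0))
  - deltaR lam a (p 1) / (rhoSq a (p 1) (p 4) * chi lam a ^ 2) * (S.alpha p v * S.alpha p w)
  + S.slope (p 1) / chi lam a * (S.alpha p v * w 1 + v 1 * S.alpha p w)
  + rhoSq a (p 1) (p 4) * S.radialW (p 1) * (v 1 * w 1)

/-- The coordinate field `∂_t` (equal to `∂_T`, since `T - t` and `Φ - φ` depend only on `r`). -/
def dt : Fin 5 → ℝ := ![1, 0, 0, 0, 0]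

/-- The coordinate field `∂_φ` (equal to `∂_Φ`), i.e. `x ∂_y - y ∂_x`. -/
def dphi (p : Fin 5 → ℝ) : Fin 5 → ℝ := ![0, 0, -p 3, p 2, 0]

/-- The Killing field `∂_t + a / (rX² + a²) ∂_φ`, which is `∂_{t_+}` for `rX = rp` and `∂_{t_c}` for
`rX = rc`. -/
def killing (_S : KerrDeSitter lam a) (rX : ℝ) (p : Fin 5 → ℝ) : Fin 5 → ℝ :=
  dt + (a / (rX ^ 2 + a ^ 2)) • dphi p

/-- The region of the spacetime in which `∂_{t_+}` and `∂_{t_c}` are both timelike. -/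
def timelikeRegion : Set (Fin 5 → ℝ) :=
  {p | p ∈ S.spacetime ∧ S.metric p (S.killing S.rp p) (S.killing S.rp p) < 0 ∧
    S.metric p (S.killing S.rc p) (S.killing S.rc p) < 0}

/-- A continuous timelike vector field on the spacetime that fixes the time orientation:
`-s ∂_r + χ (1 - s²) / Δ_r ((r² + a²) ∂_T + a ∂_Φ)`.  It satisfies `g(Z, Z) = -ρ² (1 - s²) / Δ_r < 0`
and `g(Z, ∂_t) = -1 / χ < 0`, so `∂_t` is future-pointing where it is timelike. -/
def timeField (p : Fin 5 → ℝ) : Fin 5 → ℝ :=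
  ![0, -S.slope (p 1), 0, 0, 0]
    + (chi lam a * S.radialW (p 1)) • ((p 1 ^ 2 + a ^ 2) • dt + a • dphi p)

/-! ### Null geodesics -/

/-- `γ` is a geodesic of the spacetime on the nonempty open interval `J`.  For curves in a linear
space with a metric `g` the last clause, for all vectors `w`, is the equation `g(∇_γ' γ', w) = 0` with
the covariant derivative written out by the Christoffel symbols of the first kind; on the submanifold
`M` of `ℝ⁵` it is required for the vectors `w` tangent to `M` (the covariant acceleration in `M` is
the tangential part of the one in the ambient space; equivalently, these are the Euler-Lagrange
equations of `g(γ', γ') / 2` on `M`). -/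
def IsGeodesic (γ : ℝ → Fin 5 → ℝ) (J : Set ℝ) : Prop :=
  IsOpen J ∧ J.OrdConnected ∧ J.Nonempty ∧ ContDiffOn ℝ 2 γ J ∧
  (∀ τ ∈ J, γ τ ∈ S.spacetime) ∧
  ∀ τ ∈ J, ∀ w : Fin 5 → ℝ, IsTangent (γ τ) w →
    S.metric (γ τ) (deriv (deriv γ) τ) w
      + fderiv ℝ (fun q => S.metric q (deriv γ τ) w) (γ τ) (deriv γ τ)
      - 1 / 2 * fderiv ℝ (fun q => S.metric q (deriv γ τ) (deriv γ τ)) (γ τ) w = 0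

/-- `γ` is a null geodesic on `J`, parametrized in the future direction. -/
def IsFutureNullGeodesic (γ : ℝ → Fin 5 → ℝ) (J : Set ℝ) : Prop :=
  S.IsGeodesic γ J ∧
  ∀ τ ∈ J, deriv γ τ ≠ 0 ∧ S.metric (γ τ) (deriv γ τ) (deriv γ τ) = 0 ∧
    S.metric (γ τ) (S.timeField (γ τ)) (deriv γ τ) < 0

/-- The geodesic `γ` on `J` has no extension to a geodesic of the spacetime on a larger interval. -/
def IsInextendible (γ : ℝ → Fin 5 → ℝ) (J : Set ℝ) : Prop :=
  ∀ (γ' : ℝ → Fin 5 → ℝ) (J' : Set ℝ), S.IsGeodesic γ' J' → J ⊆ J' → Set.EqOn γ' γ J → J' = J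

/-! ### Kruskal coordinates and the long horizons

The primitives below are obtained by partial fractions.  At `r = rp` and `r = rc`, where
`Real.log 0 = 0`, the functions `t`, `rstar`, `φ` themselves have no meaning, but every combination in
which the logarithmic terms at that root cancel takes the correct value there. -/

/-- The four roots of `Δ_r`. -/
def root : Fin 4 → ℝ := ![S.rn, S.rm, S.rp, S.rc]

/-- The tortoise coordinate, a primitive of `χ (r² + a²) / Δ_r`. -/
def rstar (r : ℝ) : ℝ :=
  ∑ i, chi lam a * (S.root i ^ 2 + a ^ 2) / deriv (deltaR lam a) (S.root i)
    * Real.log |r - S.root i|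

/-- `T - t`, a primitive of `s χ (r² + a²) / Δ_r`. -/
def tShift (r : ℝ) : ℝ :=
  ∑ i, chi lam a * (S.root i ^ 2 + a ^ 2) / deriv (deltaR lam a) (S.root i)
    * S.slope (S.root i) * Real.log |r - S.root i|

/-- `Φ - φ`, a primitive of `s χ a / Δ_r`. -/
def phiShift (r : ℝ) : ℝ :=
  ∑ i, chi lam a * a / deriv (deltaR lam a) (S.root i)
    * S.slope (S.root i) * Real.log |r - S.root i|

/-- The Boyer-Lindquist time `t`. -/
def tBL (p : Fin 5 → ℝ) : ℝ := p 0 - S.tShift (p 1)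

/-- `u = t - r_*`. -/
def uCoord (p : Fin 5 → ℝ) : ℝ := S.tBL p - S.rstar (p 1)

/-- `v = t + r_*`. -/
def vCoord (p : Fin 5 → ℝ) : ℝ := S.tBL p + S.rstar (p 1)

/-- The surface gravity `κ_X = |Δ_r'(rX)| / (2 χ (rX² + a²))`. -/
def kappa (_S : KerrDeSitter lam a) (rX : ℝ) : ℝ :=
  |deriv (deltaR lam a) rX| / (2 * chi lam a * (rX ^ 2 + a ^ 2))

/-- The number `φ_X - Φ`, where `φ_X = φ - a / (rX² + a²) t`. -/
def angleX (rX : ℝ) (p : Fin 5 → ℝ) : ℝ :=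
  -S.phiShift (p 1) - a / (rX ^ 2 + a ^ 2) * S.tBL p

/-- The point `(U, V, ω)` of `ℝ × ℝ × 𝕊²`, where `ω` is the point of the sphere with polar angle `θ`
and azimuth `φ_X`. -/
def kruskalPoint (rX U V : ℝ) (p : Fin 5 → ℝ) : Fin 5 → ℝ :=
  ![U, V,
    p 2 * Real.cos (S.angleX rX p) - p 3 * Real.sin (S.angleX rX p),
    p 2 * Real.sin (S.angleX rX p) + p 3 * Real.cos (S.angleX rX p),
    p 4]

/-- The Kruskal coordinates `(U_+, V_+, θ_+, φ_+)` on the part `rm < r < rc` of the spacetime: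
`V_+ = exp (κ_+ v)`, and `U_+` is `-exp (-κ_+ u)` on `I`, `exp (-κ_+ u)` on `II`, `0` at `r = rp`. -/
def kruskalPlus (p : Fin 5 → ℝ) : Fin 5 → ℝ :=
  S.kruskalPoint S.rp (-Real.sign (p 1 - S.rp) * Real.exp (-S.kappa S.rp * S.uCoord p))
    (Real.exp (S.kappa S.rp * S.vCoord p)) p

/-- The Kruskal coordinates `(U_c, V_c, θ_c, φ_c)` on the part `rp < r` of the spacetime:
`U_c = exp (κ_c u)`, and `V_c` is `-exp (-κ_c v)` on `I`, `exp (-κ_c v)` on `III`, `0` at `r = rc`. -/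
def kruskalC (p : Fin 5 → ℝ) : Fin 5 → ℝ :=
  S.kruskalPoint S.rc (Real.exp (S.kappa S.rc * S.uCoord p))
    (Real.sign (p 1 - S.rc) * Real.exp (-S.kappa S.rc * S.vCoord p)) p

/-- The long horizon `H = {V_+ = 0}` in Kruskal coordinates. -/
def longHorizonPlus : Set (Fin 5 → ℝ) := {q | q 1 = 0 ∧ q 2 ^ 2 + q 3 ^ 2 + q 4 ^ 2 = 1}

/-- The long horizon `H_c = {U_c = 0}` in Kruskal coordinates. -/
def longHorizonC : Set (Fin 5 → ℝ) := {q | q 0 = 0 ∧ q 2 ^ 2 + q 3 ^ 2 + q 4 ^ 2 = 1}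

/-- Toward the past, `γ` converges to a point of `H` in the extended spacetime. -/
def PastApproachesPlus (γ : ℝ → Fin 5 → ℝ) (J : Set ℝ) : Prop :=
  (∀ᶠ τ : J in atBot, γ τ 1 < S.rc) ∧
  ∃ q ∈ longHorizonPlus, Tendsto (fun τ : J => S.kruskalPlus (γ τ)) atBot (𝓝 q)

/-- Toward the past, `γ` converges to a point of `H_c` in the extended spacetime. -/
def PastApproachesC (γ : ℝ → Fin 5 → ℝ) (J : Set ℝ) : Prop :=
  (∀ᶠ τ : J in atBot, S.rp < γ τ 1) ∧
  ∃ q ∈ longHorizonC, Tendsto (fun τ : J => S.kruskalC (γ τ)) atBot (𝓝 q)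

/-! ### Comparison with the Boyer-Lindquist form -/

theorem deltaR_factor (r : ℝ) :
    deltaR lam a r = lam * (r - S.rp) * (S.rc - r) * ((r - S.rm) * (r - S.rn)) := by
  have h1 := S.root_rm
  have h2 := S.root_rp
  have h3 := S.root_rc
  have d1 : S.rp - S.rm ≠ 0 := sub_ne_zero.2 S.rm_lt_rp.ne'
  have d2 : S.rc - S.rp ≠ 0 := sub_ne_zero.2 S.rp_lt_rc.ne'
  have d3 : S.rc - S.rm ≠ 0 := sub_ne_zero.2 (S.rm_lt_rp.trans S.rp_lt_rc).ne'
  unfold deltaR rn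
  generalize S.rm = x at *
  generalize S.rp = y at *
  generalize S.rc = z at *
  have e1 : -lam * (y ^ 3 + y ^ 2 * x + y * x ^ 2 + x ^ 3) + (1 - lam * a ^ 2) * (x + y) - 2 = 0 := by
    apply mul_left_cancel₀ d1
    linear_combination h2 - h1
  have e2 : -lam * (z ^ 3 + z ^ 2 * x + z * x ^ 2 + x ^ 3) + (1 - lam * a ^ 2) * (x + z) - 2 = 0 := by
    apply mul_left_cancel₀ d3
    linear_combination h3 - h1
  have e3 : -lam * (y ^ 2 + z ^ 2 + x ^ 2 + y * z + x * y + x * z) + (1 - lam * a ^ 2) = 0 := by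
    apply mul_left_cancel₀ d2
    linear_combination e2 - e1
  linear_combination h1 + (r - x) * e1 + (r - x) * (r - y) * e3

theorem metric_eq_boyerLindquist_aux (r θ P t' r' θ' φ' : ℝ) (T : ℝ) (hr : S.rm < r)
    (hD : deltaR lam a r ≠ 0) :
    let p : Fin 5 → ℝ := ![T, r, Real.sin θ * Real.cos P, Real.sin θ * Real.sin P, Real.cos θ]
    let P' := φ' + S.slope r * (chi lam a * a) / deltaR lam a r * r'
    let v : Fin 5 → ℝ := ![t' + S.slope r * (chi lam a * (r ^ 2 + a ^ 2)) / deltaR lam a r * r', r',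
      Real.cos θ * θ' * Real.cos P - Real.sin θ * Real.sin P * P',
      Real.cos θ * θ' * Real.sin P + Real.sin θ * Real.cos P * P', -Real.sin θ * θ']
    S.metric p v v = boyerLindquist lam a r θ t' r' θ' φ' := by
  intro p P' v
  have hW : S.radialW r = (1 - S.slope r ^ 2) / deltaR lam a r := by
    have d2 : S.rc - S.rp ≠ 0 := sub_ne_zero.2 S.rp_lt_rc.ne'
    have := S.deltaR_factor r
    rw [this] at hD
    have hl := S.lam_pos.ne'
    simp only [mul_ne_zero_iff] at hD
    obtain ⟨⟨⟨_, h1⟩, h2⟩, h3, h4⟩ := hD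
    rw [this]
    unfold radialW slope
    field_simp
    ring
  have hs : sigma p v = Real.sin θ ^ 2 * P' := by
    simp [sigma, p, v]
    linear_combination (Real.sin θ ^ 2 * P') * Real.sin_sq_add_cos_sq P
  have hn : v 2 * v 2 + v 3 * v 3 + v 4 * v 4 = θ' ^ 2 + Real.sin θ ^ 2 * P' ^ 2 := by
    simp [v]
    linear_combination (Real.cos θ ^ 2 * θ' ^ 2 + Real.sin θ ^ 2 * P' ^ 2) * Real.sin_sq_add_cos_sq P
      + θ' ^ 2 * Real.sin_sq_add_cos_sq θ
  have hp1 : p 1 = r := rfl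
  have hp4 : p 4 = Real.cos θ := rfl
  have hv0 : v 0 = t' + S.slope r * (chi lam a * (r ^ 2 + a ^ 2)) / deltaR lam a r * r' := rfl
  have hv1 : v 1 = r' := rfl
  unfold metric boyerLindquist alpha
  rw [hn, hs, hp1, hp4, hv0, hv1, hW]
  have hl := S.lam_pos
  have hr0 : 0 < r := S.rm_pos.trans hr
  have hc : chi lam a ≠ 0 := by unfold chi; positivity
  have hT : deltaTheta lam a (Real.cos θ) ≠ 0 := by unfold deltaTheta; positivity
  have hρ : rhoSq a r (Real.cos θ) ≠ 0 := by unfold rhoSq; positivity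
  have hss : Real.sin θ ^ 2 = 1 - Real.cos θ ^ 2 := by
    linarith [Real.sin_sq_add_cos_sq θ]
  have hk : deltaTheta lam a (Real.cos θ) * (r ^ 2 + a ^ 2)
      - rhoSq a r (Real.cos θ) * chi lam a = a ^ 2 * (1 - Real.cos θ ^ 2) * (1 - lam * r ^ 2) := by
    unfold deltaTheta rhoSq chi; ring
  have hQ : r ^ 2 + a ^ 2 = rhoSq a r (Real.cos θ) + a ^ 2 * (1 - Real.cos θ ^ 2) := by
    unfold rhoSq; ring
  simp only [hss, P'] at *
  generalize deltaR lam a r = D at *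
  generalize S.slope r = s at *
  generalize Real.cos θ = c at *
  generalize deltaTheta lam a c = Dt at *
  generalize rhoSq a r c = q at *
  generalize chi lam a = X at *
  clear_value p v
  clear hW hs hn hp1 hp4 hv0 hv1 hl hss
  generalize h1 : 1 - lam * r ^ 2 = m at *
  generalize h2 : 1 - c ^ 2 = k at *
  generalize h3 : r ^ 2 + a ^ 2 = Q at *
  set Y : ℝ := φ' + s * (X * a) / D * r' with hY
  have hC : a ^ 2 * m * (Dt * Q + q * X) / (q * X ^ 2 * Dt) * (k * Y * (k * Y))
      = (k * Y ^ 2) * ((Dt ^ 2 * Q ^ 2 - q ^ 2 * X ^ 2) / (q * X ^ 2 * Dt)) := by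
    field_simp
    linear_combination -(k * Y ^ 2 * (Dt * Q + q * X)) * hk
  rw [hC, hY]
  clear hC hY hk
  subst hQ
  field_simp
  ring

set_option maxRecDepth 10000 in
set_option maxHeartbeats 4000000 in
theorem hasDerivAt_primitive (N : ℝ → ℝ) (n0 n1 n2 n3 : ℝ)
    (hN : ∀ x, N x = n0 + n1 * x + n2 * x ^ 2 + n3 * x ^ 3) (r : ℝ) (hD : deltaR lam a r ≠ 0) :
    HasDerivAt (fun r => ∑ i, N (S.root i) / deriv (deltaR lam a) (S.root i)
      * Real.log |r - S.root i|) (N r / deltaR lam a r) r := by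
  have hf : deltaR lam a = fun r => lam * (r - S.rp) * (S.rc - r) * ((r - S.rm) * (r - S.rn)) :=
    funext S.deltaR_factor
  have hd (x : ℝ) : deriv (deltaR lam a) x = lam * ((S.rc - x) * (x - S.rm) * (x - S.rn)
      - (x - S.rp) * (x - S.rm) * (x - S.rn) + (x - S.rp) * (S.rc - x) * (x - S.rn)
      + (x - S.rp) * (S.rc - x) * (x - S.rm)) := by
    rw [hf]
    refine HasDerivAt.deriv ?_
    have hx := hasDerivAt_id' x
    refine ((((hx.sub_const S.rp).const_mul lam).fun_mul (hx.const_sub S.rc)).fun_mul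
      ((hx.sub_const S.rm).fun_mul (hx.sub_const S.rn))).congr_deriv ?_
    ring
  rw [hf] at hD
  have hmp := S.rm_lt_rp
  have hpc := S.rp_lt_rc
  have hm := S.rm_pos
  have hn : S.rn < 0 := by unfold rn; linarith
  have hl := S.lam_pos.ne'
  have e1 : S.rm - S.rp ≠ 0 := by linarith
  have e2 : S.rc - S.rm ≠ 0 := by linarith
  have e3 : S.rm - S.rn ≠ 0 := by linarith
  have e4 : S.rc - S.rp ≠ 0 := by linarith
  have e5 : S.rp - S.rn ≠ 0 := by linarith
  have e6 : S.rc - S.rn ≠ 0 := by linarith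
  simp only [mul_ne_zero_iff] at hD
  obtain ⟨⟨⟨_, h1⟩, h2⟩, h3, h4⟩ := hD
  have h2' : r - S.rc ≠ 0 := by rwa [← neg_sub, neg_ne_zero]
  have hlog (c : ℝ) (hc : r - c ≠ 0) : HasDerivAt (fun r => Real.log |r - c|) (1 / (r - c)) r := by
    simp only [Real.log_abs]
    exact ((hasDerivAt_id' r).sub_const c).log hc
  have hne (i : Fin 4) : r - S.root i ≠ 0 := by
    fin_cases i
    exacts [h4, h3, h1, h2']
  refine (HasDerivAt.fun_sum fun i _ => (hlog (S.root i) (hne i)).const_mul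
    (N (S.root i) / deriv (deltaR lam a) (S.root i))).congr_deriv ?_
  simp only [Fin.sum_univ_four, root, Matrix.cons_val, hd, sub_self]
  rw [S.deltaR_factor, hN, hN, hN, hN, hN]
  clear hne hlog hd hf hN
  generalize S.rm = m at *
  generalize S.rp = p at *
  generalize S.rc = c at *
  generalize S.rn = n at *
  have e1' : p - m ≠ 0 := by linarith
  have e3' : n - m ≠ 0 := by linarith
  have e5' : n - p ≠ 0 := by linarith
  simp only [mul_zero, zero_mul, add_zero, zero_add, sub_zero, zero_sub]
  clear hm hmp hpc hn e3' e5' h2 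
  rw [show -((c - p) * (c - m) * (c - n)) = -(c - p) * (c - m) * (c - n) by ring]
  have q1 : (n - p) * (c - n) * (n - m) = (p - n) * (c - n) * (m - n) := by ring
  have q2 : (m - p) * (c - m) * (m - n) = -((p - m) * (c - m) * (m - n)) := by ring
  rw [q1, q2, show lam * (r - p) * (c - r) * ((r - m) * (r - n)) = -(lam * (r - p) * (r - c) * (r - m) * (r - n)) by ring]
  clear q1 q2 e1
  field_simp
  ring

theorem hasDerivAt_rstar (r : ℝ) (hD : deltaR lam a r ≠ 0) :
    HasDerivAt S.rstar (chi lam a * (r ^ 2 + a ^ 2) / deltaR lam a r) r :=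
  S.hasDerivAt_primitive (fun r => chi lam a * (r ^ 2 + a ^ 2))
    (chi lam a * a ^ 2) 0 (chi lam a) 0 (fun x => by ring) r hD

theorem hasDerivAt_tShift (r : ℝ) (hD : deltaR lam a r ≠ 0) :
    HasDerivAt S.tShift (S.slope r * (chi lam a * (r ^ 2 + a ^ 2)) / deltaR lam a r) r := by
  have := S.hasDerivAt_primitive (fun r => S.slope r * (chi lam a * (r ^ 2 + a ^ 2)))
    ((S.rp + S.rc) / (S.rc - S.rp) * chi lam a * a ^ 2) (-2 / (S.rc - S.rp) * chi lam a * a ^ 2)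
    ((S.rp + S.rc) / (S.rc - S.rp) * chi lam a) (-2 / (S.rc - S.rp) * chi lam a)
    (fun x => by unfold slope; ring) r hD
  convert this using 2 with x
  exact Finset.sum_congr rfl fun i _ => by ring

theorem hasDerivAt_phiShift (r : ℝ) (hD : deltaR lam a r ≠ 0) :
    HasDerivAt S.phiShift (S.slope r * (chi lam a * a) / deltaR lam a r) r := by
  have := S.hasDerivAt_primitive (fun r => S.slope r * (chi lam a * a))
    ((S.rp + S.rc) / (S.rc - S.rp) * chi lam a * a) (-2 / (S.rc - S.rp) * chi lam a * a) 0 0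
    (fun x => by unfold slope; ring) r hD
  convert this using 2 with x
  exact Finset.sum_congr rfl fun i _ => by ring

/-- The point of the spacetime with Boyer-Lindquist coordinates `(t, r, θ, φ)`, where
`Δ_r ≠ 0`. -/
def ofBoyerLindquist (t r θ φ : ℝ) : Fin 5 → ℝ :=
  ![t + S.tShift r, r, Real.sin θ * Real.cos (φ + S.phiShift r),
    Real.sin θ * Real.sin (φ + S.phiShift r), Real.cos θ]

/-- On the Boyer-Lindquist blocks, `metric` is the Kerr-de Sitter metric: for every curve
`(t, r, θ, φ)` in Boyer-Lindquist coordinates, the two give the same square of the velocity. -/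
theorem metric_eq_boyerLindquist {t r θ φ : ℝ → ℝ} {τ t' r' θ' φ' : ℝ} (ht : HasDerivAt t t' τ)
    (hr : HasDerivAt r r' τ) (hθ : HasDerivAt θ θ' τ) (hφ : HasDerivAt φ φ' τ) (hm : S.rm < r τ)
    (hD : deltaR lam a (r τ) ≠ 0) :
    ∃ v, HasDerivAt (fun τ => S.ofBoyerLindquist (t τ) (r τ) (θ τ) (φ τ)) v τ ∧
      S.metric (S.ofBoyerLindquist (t τ) (r τ) (θ τ) (φ τ)) v v
        = boyerLindquist lam a (r τ) (θ τ) t' r' θ' φ' := by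
  have hP := hφ.add ((S.hasDerivAt_phiShift _ hD).comp τ hr)
  have hT := ht.add ((S.hasDerivAt_tShift _ hD).comp τ hr)
  refine ⟨_, ?_, S.metric_eq_boyerLindquist_aux (r τ) (θ τ) (φ τ + S.phiShift (r τ)) t' r' θ' φ'
    (t τ + S.tShift (r τ)) hm hD⟩
  rw [hasDerivAt_pi]
  intro i
  fin_cases i
  · exact hT
  · exact hr
  · exact (hθ.sin.fun_mul hP.cos).congr_deriv (by simp; ring)
  · exact (hθ.sin.fun_mul hP.sin).congr_deriv (by simp; ring)
  · exact hθ.cos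

/-- The field `timeField` is timelike, and `g(timeField, ∂_t) < 0`. -/
theorem metric_timeField {p : Fin 5 → ℝ} (hp : p ∈ S.spacetime) :
    S.metric p (S.timeField p) (S.timeField p) = -(rhoSq a (p 1) (p 4) * S.radialW (p 1)) ∧
    S.metric p (S.timeField p) dt = -(1 / chi lam a) := by
  obtain ⟨hr, hs⟩ := hp
  have hl := S.lam_pos
  have hr0 : 0 < p 1 := S.rm_pos.trans hr
  have hmp := S.rm_lt_rp
  have hpc := S.rp_lt_rc
  have hm := S.rm_pos
  have hn : S.rn < 0 := by unfold rn; linarith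
  have e4 : S.rc - S.rp ≠ 0 := by linarith
  have e5 : p 1 - S.rm ≠ 0 := by linarith
  have e6 : p 1 - S.rn ≠ 0 := by linarith
  have hc : chi lam a ≠ 0 := by unfold chi; positivity
  have hT : deltaTheta lam a (p 4) ≠ 0 := by unfold deltaTheta; positivity
  have hρ : rhoSq a (p 1) (p 4) ≠ 0 := by unfold rhoSq; positivity
  have hW : deltaR lam a (p 1) * S.radialW (p 1) = 1 - S.slope (p 1) ^ 2 := by
    rw [S.deltaR_factor]
    unfold radialW slope
    field_simp
    ring
  have hxy : p 2 ^ 2 + p 3 ^ 2 = 1 - p 4 ^ 2 := by linarith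
  have hρ' : rhoSq a (p 1) (p 4) = p 1 ^ 2 + a ^ 2 - a ^ 2 * (1 - p 4 ^ 2) := by
    unfold rhoSq; ring
  have hk : deltaTheta lam a (p 4) * (p 1 ^ 2 + a ^ 2) - rhoSq a (p 1) (p 4) * chi lam a
      = a ^ 2 * (1 - p 4 ^ 2) * (1 - lam * p 1 ^ 2) := by
    unfold deltaTheta rhoSq chi; ring
  set W := S.radialW (p 1) with hWd
  set X := chi lam a with hX
  have z0 : S.timeField p 0 = X * W * (p 1 ^ 2 + a ^ 2) := by simp [timeField, dt, dphi, hWd, hX]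
  have z1 : S.timeField p 1 = -S.slope (p 1) := by simp [timeField, dt, dphi]
  have z2 : S.timeField p 2 = X * W * (a * -p 3) := by simp [timeField, dt, dphi, hWd, hX]
  have z3 : S.timeField p 3 = X * W * (a * p 2) := by simp [timeField, dt, dphi, hWd, hX]
  have z4 : S.timeField p 4 = 0 := by simp [timeField, dt, dphi]
  have zs : sigma p (S.timeField p) = X * W * a * (1 - p 4 ^ 2) := by
    rw [sigma, z2, z3, ← hxy]; ring
  have za : S.alpha p (S.timeField p) = X * W * rhoSq a (p 1) (p 4) := by
    rw [alpha, zs, z0, hρ']; ring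
  have zn : S.timeField p 2 * S.timeField p 2 + S.timeField p 3 * S.timeField p 3
      + S.timeField p 4 * S.timeField p 4 = (X * W * a) ^ 2 * (1 - p 4 ^ 2) := by
    rw [z2, z3, z4, ← hxy]; ring
  have ds : sigma p dt = 0 := by simp [sigma, dt]
  have da : S.alpha p dt = 1 := by simp [alpha, ds]; simp [dt]
  have d0 : dt 0 = 1 := by simp [dt]
  have d1 : dt 1 = 0 := by simp [dt]
  have d2 : dt 2 = 0 := by simp [dt]
  have d3 : dt 3 = 0 := by simp [dt]
  have d4 : dt 4 = 0 := by simp [dt]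
  constructor
  · unfold metric
    rw [zn, zs, za, z0, z1]
    rw [← hX, ← hWd]
    rw [mul_comm (deltaR lam a (p 1))] at hW
    generalize deltaR lam a (p 1) = D at *
    generalize S.slope (p 1) = s at *
    generalize deltaTheta lam a (p 4) = Dt at *
    generalize rhoSq a (p 1) (p 4) = q at *
    clear_value W X
    clear z0 z1 z2 z3 z4 zs za zn ds da d0 d1 d2 d3 d4 hs hxy
    generalize 1 - lam * p 1 ^ 2 = m at *
    generalize 1 - p 4 ^ 2 = k at *
    generalize p 1 ^ 2 + a ^ 2 = Q at *
    have hC : a ^ 2 * m * (Dt * Q + q * X) / (q * X ^ 2 * Dt) * (X * W * a * k * (X * W * a * k))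
        = (k * (X * W * a) ^ 2) * ((Dt ^ 2 * Q ^ 2 - q ^ 2 * X ^ 2) / (q * X ^ 2 * Dt)) := by
      field_simp
      linear_combination -(a ^ 2 * W ^ 2 * k * (Dt * Q + q * X)) * hk
    rw [hC]
    obtain rfl : Q = q + a ^ 2 * k := by linarith
    clear hC hk hρ'
    field_simp
    linear_combination (-W * q ^ 2 * Dt) * hW
  · unfold metric
    rw [zs, za, z0, z1, d0, d1, d2, d3, d4, ds, da, ← hX]
    rw [mul_comm (deltaR lam a (p 1))] at hW
    generalize deltaR lam a (p 1) = D at *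
    generalize S.slope (p 1) = s at *
    generalize deltaTheta lam a (p 4) = Dt at *
    generalize rhoSq a (p 1) (p 4) = q at *
    clear_value W X
    clear z0 z1 z2 z3 z4 zs za zn ds da d0 d1 d2 d3 d4 hs hxy
    generalize 1 - lam * p 1 ^ 2 = m at *
    generalize 1 - p 4 ^ 2 = k at *
    generalize p 1 ^ 2 + a ^ 2 = Q at *
    obtain rfl : Q = q + a ^ 2 * k := by linarith
    clear hk hρ'
    field_simp
    linear_combination (-(q * Dt)) * hW

end KerrDeSitter

end

/-!
The theorem comes from the separability of the null geodesic equation. A null geodesic has an energy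
`E`, an angular momentum `L` and a Carter constant `K ≥ 0`, and `y = ρ² r'` satisfies
`y² = R(r)` and `2 ρ² y' = R'(r)`, where `R = f² - Δ_r K` is the radial potential and
`f = χ ((r² + a²) E - a L)`. These facts are collected in `IsNullOrbit`
(`IsFutureNullGeodesic.exists_isNullOrbit`); the equation of motion in `θ` is not needed, since the
angular motion is sufficiently controlled by `K` (`IsNullOrbit.polar_eq`).

For small parameters both Killing fields are timelike for `5/2 ≤ r ≤ 4`
(`mem_timelikeRegion_of_small`), and the future horizons can be crossed only out of the block `I`
(`IsNullOrbit.beyond_of_le`). By continuity, an orbit that avoids the region in which both fields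
are timelike therefore either lies beyond one of the two horizons, or stays, in the past, in one of
the parts `r ≤ 5/2`, `4 ≤ r` of the block `I`. In all cases it converges to a long horizon.

* *Beyond a horizon* (`IsNullOrbit.pastApproaches_of_beyond`), `r` moves monotonically toward the
  horizon in the past and converges.
* *In the block `I`* (`IsNullOrbit.pastApproaches_of_block`), an estimate of `R'` at the zeros of
  `R` shows that in `r ≤ 5/2` and in `4 ≤ r` at every turning point the distance of `r` to
  the adjacent horizon is maximal (`IsNullOrbit.radialRDeriv_neg`, `IsNullOrbit.radialRDeriv_pos`;
  for `a = 0` the photon sphere is at `r = 3`). So there is at most one turning point, and `r` is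
  eventually monotone and converges.

If the limit of `r` is not the radius of a horizon, it is a double root of `R`
(`IsNullOrbit.double_root_of_tendsto`): otherwise the limit is reached in finite parameter time with
bounded velocity, and the geodesic can be extended (`IsGeodesic.not_isInextendible_of_bounded`, by
local existence for the geodesic equation). Such roots are excluded by the estimate of `R'` in
the block `I`, and by `Δ_r < 0` beyond a horizon. So `r` tends to the radius `X` of a horizon, and there are four cases.

* `f(X) ≠ 0`, and the orbit reaches `r = X` in the direction in which it would pass through the long
  horizon. Then `t ∓ r_*` has bounded derivative, so one Kruskal coordinate converges and the other
  tends to zero (`IsNullOrbit.pastApproaches_of_radialP_ne_zero`).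
* `f(X) ≠ 0`, and the orbit has come out of the block `I` through the future horizon. Then its
  velocity stays bounded, contrary to inextendibility (`IsNullOrbit.isBigO_alpha_of_crossing`).
* `f(X) = 0` and `K > 0`. Then `t` converges and the orbit tends to the bifurcation sphere
  (`IsNullOrbit.pastApproaches_of_radialP_eq_zero`).
* `f(X) = 0` and `K = 0`. Then `E = L = 0`, and the orbit is a generator of the horizon, along which
  the Kruskal coordinate is an affine parameter (`IsNullOrbit.pastApproaches_of_eventually_eq`).

In each case the azimuth `φ_X` converges as well, because the metric in co-rotating coordinates
bounds the velocity on the sphere (`IsNullOrbit.sq_rotating_velocity`).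
-/

noncomputable section

namespace KerrDeSitter

variable {lam a : ℝ} (S : KerrDeSitter lam a)

section

/-! ### First integrals at a point -/

/-- The coordinate field `∂_r`. -/
def dr : Fin 5 → ℝ := ![0, 1, 0, 0, 0]

/-- The Mino-time radial velocity `ρ² dr(v)`. -/
def radialVel (_S : KerrDeSitter lam a) (p v : Fin 5 → ℝ) : ℝ := rhoSq a (p 1) (p 4) * v 1

/-- The Carter constant of a null vector, read off from the radial part of the metric:
`-ρ²` times the `(T, r)`-part of `g(v, v)`. -/
def carter (p v : Fin 5 → ℝ) : ℝ :=
  deltaR lam a (p 1) * S.alpha p v ^ 2 / chi lam a ^ 2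
    - 2 * S.slope (p 1) * S.alpha p v * S.radialVel p v / chi lam a
    - S.radialW (p 1) * S.radialVel p v ^ 2

/-- The quantity `sin² θ (a dT - (r² + a²) dΦ)(v)`, in the form `a sin² θ α - ρ² σ`. -/
def azimuthal (p v : Fin 5 → ℝ) : ℝ :=
  a * (1 - p 4 ^ 2) * S.alpha p v - rhoSq a (p 1) (p 4) * sigma p v

/-- The Euclidean square of the component of `v` tangent to the sphere. -/
def sphereSq (v : Fin 5 → ℝ) : ℝ := v 2 ^ 2 + v 3 ^ 2 + v 4 ^ 2

/-- The function `χ ((r² + a²) E - a L)` of `r`, whose square is the part of the radial potential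
that does not involve the Carter constant. -/
def radialP (lam a E L r : ℝ) : ℝ := chi lam a * ((r ^ 2 + a ^ 2) * E - a * L)

/-- The radial potential: along a null geodesic with energy `E`, angular momentum `L` and Carter
constant `K`, one has `(ρ² r')² = radialR`. -/
def radialR (lam a E L K r : ℝ) : ℝ := radialP lam a E L r ^ 2 - deltaR lam a r * K

theorem chi_pos (S : KerrDeSitter lam a) : 0 < chi lam a := by
  have := S.lam_pos
  unfold chi; positivity

theorem deltaTheta_pos (S : KerrDeSitter lam a) (z : ℝ) : 0 < deltaTheta lam a z := by
  have := S.lam_pos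
  unfold deltaTheta; positivity

theorem rhoSq_pos {r : ℝ} (hr : 0 < r) (z : ℝ) : 0 < rhoSq a r z := by
  unfold rhoSq; positivity

theorem rn_neg : S.rn < 0 := by
  have := S.rm_pos
  have := S.rm_lt_rp
  have := S.rp_lt_rc
  unfold rn; linarith

theorem radialW_pos {r : ℝ} (hr : S.rm < r) : 0 < S.radialW r := by
  have h1 := S.rn_neg
  have h2 := S.rm_pos
  have h3 := S.lam_pos
  have h4 : 0 < S.rc - S.rp := sub_pos.2 S.rp_lt_rc
  have h5 : 0 < r - S.rm := by linarith
  have h6 : 0 < r - S.rn := by linarith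
  unfold radialW; positivity

/-- The defining property of `radialW`, which holds on the horizons as well. -/
theorem deltaR_mul_radialW {r : ℝ} (hr : S.rm < r) :
    deltaR lam a r * S.radialW r = 1 - S.slope r ^ 2 := by
  have h1 := S.rn_neg
  have h2 := S.rm_pos
  have h3 := S.lam_pos
  have h4 : S.rc - S.rp ≠ 0 := (sub_pos.2 S.rp_lt_rc).ne'
  have h5 : r - S.rm ≠ 0 := by linarith
  have h6 : r - S.rn ≠ 0 := by linarith
  rw [S.deltaR_factor]
  unfold radialW slope
  field_simp
  ring

theorem metric_dr (p v : Fin 5 → ℝ) :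
    S.metric p v dr = S.slope (p 1) / chi lam a * S.alpha p v
      + S.radialW (p 1) * S.radialVel p v := by
  simp [metric, sigma, alpha, dr, radialVel]
  ring

theorem metric_dt (p v : Fin 5 → ℝ) :
    S.metric p v dt = deltaTheta lam a (p 4) / (rhoSq a (p 1) (p 4) * chi lam a ^ 2)
        * (a ^ 2 * (1 - p 4 ^ 2) * v 0 - a * (p 1 ^ 2 + a ^ 2) * sigma p v)
      - deltaR lam a (p 1) / (rhoSq a (p 1) (p 4) * chi lam a ^ 2) * S.alpha p v
      + S.slope (p 1) / chi lam a * v 1 := by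
  simp [metric, sigma, alpha, dt]

theorem metric_dphi {p : Fin 5 → ℝ} (hp : p ∈ S.spacetime) (v : Fin 5 → ℝ) :
    S.metric p v (dphi p) = rhoSq a (p 1) (p 4) / deltaTheta lam a (p 4) * sigma p v
      + a ^ 2 * (1 - lam * p 1 ^ 2)
        * (deltaTheta lam a (p 4) * (p 1 ^ 2 + a ^ 2) + rhoSq a (p 1) (p 4) * chi lam a)
        / (rhoSq a (p 1) (p 4) * chi lam a ^ 2 * deltaTheta lam a (p 4))
        * (sigma p v * (1 - p 4 ^ 2))
      - deltaTheta lam a (p 4) / (rhoSq a (p 1) (p 4) * chi lam a ^ 2)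
        * (a * (p 1 ^ 2 + a ^ 2) * (v 0 * (1 - p 4 ^ 2)))
      + deltaR lam a (p 1) / (rhoSq a (p 1) (p 4) * chi lam a ^ 2)
        * (S.alpha p v * (a * (1 - p 4 ^ 2)))
      - S.slope (p 1) / chi lam a * (v 1 * (a * (1 - p 4 ^ 2))) := by
  have h : 1 - p 4 ^ 2 = p 2 ^ 2 + p 3 ^ 2 := by linarith [hp.2]
  rw [h]
  simp [metric, sigma, alpha, dphi]
  ring

/-- The two combinations of `g(v, ∂_t)` and `g(v, ∂_φ)` that separate the radial motion from the
angular one. -/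
theorem momentum_identities {p : Fin 5 → ℝ} (hp : p ∈ S.spacetime) (v : Fin 5 → ℝ) :
    (p 1 ^ 2 + a ^ 2) * S.metric p v dt + a * S.metric p v (dphi p)
      = -deltaR lam a (p 1) * S.alpha p v / chi lam a ^ 2
        + S.slope (p 1) * S.radialVel p v / chi lam a ∧
    a * (1 - p 4 ^ 2) * S.metric p v dt + S.metric p v (dphi p)
      = -deltaTheta lam a (p 4) * S.azimuthal p v / chi lam a ^ 2 := by
  have hc := S.chi_pos.ne'
  have hT := (S.deltaTheta_pos (p 4)).ne'
  have hρ := (rhoSq_pos (a := a) (S.rm_pos.trans hp.1) (p 4)).ne'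
  have hρ' : p 1 ^ 2 + a ^ 2 = rhoSq a (p 1) (p 4) + a ^ 2 * (1 - p 4 ^ 2) := by
    unfold rhoSq; ring
  have hk : rhoSq a (p 1) (p 4) * chi lam a + a ^ 2 * (1 - p 4 ^ 2) * (1 - lam * p 1 ^ 2)
      = deltaTheta lam a (p 4) * (p 1 ^ 2 + a ^ 2) := by
    unfold deltaTheta rhoSq chi; ring
  have hv : v 0 = S.alpha p v + a * sigma p v := by unfold alpha; ring
  rw [S.metric_dt, S.metric_dphi hp]
  unfold azimuthal radialVel
  rw [hv]
  clear hv
  generalize deltaR lam a (p 1) = D at *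
  generalize S.slope (p 1) = s at *
  generalize deltaTheta lam a (p 4) = Dt at *
  generalize rhoSq a (p 1) (p 4) = q at *
  generalize chi lam a = X at *
  generalize S.alpha p v = A at *
  generalize sigma p v = σ at *
  generalize 1 - lam * p 1 ^ 2 = m at *
  generalize 1 - p 4 ^ 2 = k at *
  generalize p 1 ^ 2 + a ^ 2 = Q at *
  have hC : a ^ 2 * m * (Dt * Q + q * X) / (q * X ^ 2 * Dt) * (σ * k)
      = σ * ((Dt ^ 2 * Q ^ 2 - q ^ 2 * X ^ 2) / (q * X ^ 2 * Dt)) := by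
    field_simp
    linear_combination σ * (Dt * Q + q * X) * hk
  rw [hC]
  subst hρ'
  clear hC hk
  constructor <;> (field_simp; ring)

/-- The metric in terms of the radial and angular variables. -/
theorem rhoSq_mul_metric_self {p : Fin 5 → ℝ} (hp : p ∈ S.spacetime) (v : Fin 5 → ℝ) :
    rhoSq a (p 1) (p 4) * S.metric p v v = -S.carter p v
      + (rhoSq a (p 1) (p 4) ^ 2 * sphereSq v
          - 2 * a * S.alpha p v * rhoSq a (p 1) (p 4) * sigma p v
          + a ^ 2 * S.alpha p v ^ 2 * (1 - p 4 ^ 2)) / deltaTheta lam a (p 4)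
      - a ^ 2 * lam * (deltaTheta lam a (p 4) + chi lam a) * S.azimuthal p v ^ 2
          / (chi lam a ^ 2 * deltaTheta lam a (p 4)) := by
  have hc := S.chi_pos.ne'
  have hT := (S.deltaTheta_pos (p 4)).ne'
  have hρ := (rhoSq_pos (a := a) (S.rm_pos.trans hp.1) (p 4)).ne'
  have hm : 1 - lam * p 1 ^ 2 = deltaTheta lam a (p 4) - lam * rhoSq a (p 1) (p 4) := by
    unfold deltaTheta rhoSq; ring
  have hk : chi lam a = deltaTheta lam a (p 4) + a ^ 2 * lam * (1 - p 4 ^ 2) := by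
    unfold deltaTheta chi; ring
  have hρ' : p 1 ^ 2 + a ^ 2 = rhoSq a (p 1) (p 4) + a ^ 2 * (1 - p 4 ^ 2) := by
    unfold rhoSq; ring
  have hv : v 0 = S.alpha p v + a * sigma p v := by unfold alpha; ring
  unfold metric carter azimuthal radialVel sphereSq
  rw [hv]
  clear hv
  simp only [← sq]
  generalize deltaR lam a (p 1) = D at *
  generalize S.slope (p 1) = s at *
  generalize deltaTheta lam a (p 4) = Dt at *
  generalize rhoSq a (p 1) (p 4) = q at *
  generalize chi lam a = X at *
  generalize S.alpha p v = A at *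
  generalize sigma p v = σ at *
  generalize v 2 ^ 2 + v 3 ^ 2 + v 4 ^ 2 = N at *
  generalize 1 - p 4 ^ 2 = k at *
  rw [hρ', hm]
  clear hm hρ'
  subst hk
  field_simp
  ring

/-- For a null vector, the Carter constant is also the angular part of the metric. -/
theorem carter_eq_of_null {p v : Fin 5 → ℝ} (hp : p ∈ S.spacetime) (h0 : S.metric p v v = 0) :
    rhoSq a (p 1) (p 4) ^ 2 * sphereSq v
          - 2 * a * S.alpha p v * rhoSq a (p 1) (p 4) * sigma p v
          + a ^ 2 * S.alpha p v ^ 2 * (1 - p 4 ^ 2)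
      = S.carter p v * deltaTheta lam a (p 4)
        + a ^ 2 * lam * (deltaTheta lam a (p 4) + chi lam a) * S.azimuthal p v ^ 2
          / chi lam a ^ 2 := by
  have hc := S.chi_pos.ne'
  have hT := (S.deltaTheta_pos (p 4)).ne'
  have h := S.rhoSq_mul_metric_self hp v
  rw [h0, mul_zero] at h
  field_simp at h ⊢
  linear_combination -h

theorem sphereSq_identity {p v : Fin 5 → ℝ} (hp : p ∈ S.spacetime) (hv : IsTangent p v) :
    (1 - p 4 ^ 2) * sphereSq v = sigma p v ^ 2 + v 4 ^ 2 := by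
  have h : p 2 ^ 2 = 1 - p 3 ^ 2 - p 4 ^ 2 := by linarith [hp.2]
  have h2 : p 2 * v 2 + p 3 * v 3 + p 4 * v 4 = 0 := hv
  have h3 : (p 2 * v 2 + p 3 * v 3) ^ 2 = p 4 ^ 2 * v 4 ^ 2 := by
    rw [show p 2 * v 2 + p 3 * v 3 = -(p 4 * v 4) by linarith]; ring
  unfold sphereSq sigma
  linear_combination -(v 2 ^ 2 + v 3 ^ 2) * h + h3

/-- The polar motion: `K sin² θ` as a sum of two squares. -/
theorem carter_mul_sinSq {p v : Fin 5 → ℝ} (hp : p ∈ S.spacetime) (hv : IsTangent p v)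
    (h0 : S.metric p v v = 0) :
    S.carter p v * (1 - p 4 ^ 2) = (rhoSq a (p 1) (p 4) * v 4) ^ 2 / deltaTheta lam a (p 4)
      + deltaTheta lam a (p 4) * S.azimuthal p v ^ 2 / chi lam a ^ 2 := by
  have hc := S.chi_pos.ne'
  have hT := (S.deltaTheta_pos (p 4)).ne'
  have h := S.carter_eq_of_null hp h0
  have h2 := S.sphereSq_identity hp hv
  have hk : a ^ 2 * lam * (1 - p 4 ^ 2) = chi lam a - deltaTheta lam a (p 4) := by
    unfold deltaTheta chi; ring
  have hb : S.azimuthal p v = a * (1 - p 4 ^ 2) * S.alpha p v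
    - rhoSq a (p 1) (p 4) * sigma p v := rfl
  generalize deltaTheta lam a (p 4) = Dt at *
  generalize rhoSq a (p 1) (p 4) = q at *
  generalize chi lam a = X at *
  generalize S.alpha p v = A at *
  generalize sigma p v = σ at *
  generalize S.carter p v = K at *
  generalize S.azimuthal p v = B at *
  generalize sphereSq v = N at *
  generalize 1 - p 4 ^ 2 = k at *
  have h3 : q ^ 2 * v 4 ^ 2 + B ^ 2 = k * (K * Dt) + (X - Dt) * (Dt + X) * B ^ 2 / X ^ 2 := by
    rw [← hk]
    linear_combination k * h - q ^ 2 * h2 + (B + (a * k * A - q * σ)) * hb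
  field_simp at h3 ⊢
  linear_combination -h3

/-- The Carter constant of a null vector is a sum of squares divided by `sin² θ`; on the axis, it is
read off from the velocity on the sphere instead. -/
theorem carter_nonneg {p v : Fin 5 → ℝ} (hp : p ∈ S.spacetime) (hv : IsTangent p v)
    (h0 : S.metric p v v = 0) : 0 ≤ S.carter p v := by
  have hc := S.chi_pos
  have hT := S.deltaTheta_pos (p 4)
  have h2 := S.sphereSq_identity hp hv
  rcases (show 0 ≤ 1 - p 4 ^ 2 by nlinarith [hp.2, sq_nonneg (p 2), sq_nonneg (p 3)]).eq_or_lt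
    with hk | hk
  · have h := S.carter_eq_of_null hp h0
    have hσ : sigma p v = 0 := by
      rw [← hk] at h2
      nlinarith [sq_nonneg (sigma p v), sq_nonneg (v 4)]
    have hb : S.azimuthal p v = 0 := by simp [azimuthal, ← hk, hσ]
    rw [hb, hσ, ← hk] at h
    have h4 : 0 ≤ S.carter p v * deltaTheta lam a (p 4) := by
      have : 0 ≤ rhoSq a (p 1) (p 4) ^ 2 * sphereSq v := by unfold sphereSq; positivity
      simp at h
      linarith
    exact nonneg_of_mul_nonneg_left h4 hT
  · refine nonneg_of_mul_nonneg_left (b := 1 - p 4 ^ 2) ?_ hk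
    rw [S.carter_mul_sinSq hp hv h0]
    positivity

/-- A causal vector is future-directed if `dT - a sin² θ dΦ` is positive on it. -/
theorem metric_timeField_apply {p : Fin 5 → ℝ} (hp : p ∈ S.spacetime) (v : Fin 5 → ℝ) :
    S.metric p (S.timeField p) v = -(S.alpha p v / chi lam a) := by
  have hc := S.chi_pos.ne'
  have hsymm : S.metric p (S.timeField p) v = S.metric p v (S.timeField p) := by
    unfold metric; ring
  have hlin : S.metric p v (S.timeField p) = -S.slope (p 1) * S.metric p v dr
      + chi lam a * S.radialW (p 1) * ((p 1 ^ 2 + a ^ 2) * S.metric p v dt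
        + a * S.metric p v (dphi p)) := by
    simp [metric, timeField, dr, dt, dphi, sigma, alpha]
    ring
  rw [hsymm, hlin, (S.momentum_identities hp v).1, S.metric_dr]
  have hW := S.deltaR_mul_radialW hp.1
  field_simp
  linear_combination (-S.alpha p v) * hW

end

section

/-! ### Derivatives of the metric -/

/-- The derivative of `deltaR` in `r`. -/
def deltaRDeriv (lam a r : ℝ) : ℝ := 2 * r - 2 - 4 * lam * r ^ 3 - 2 * lam * a ^ 2 * r

/-- The derivative of `radialR` in `r`. -/
def radialRDeriv (lam a E L K r : ℝ) : ℝ :=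
  4 * chi lam a * r * E * radialP lam a E L r - deltaRDeriv lam a r * K

theorem hasDerivAt_deltaR (lam a r : ℝ) :
    HasDerivAt (deltaR lam a) (deltaRDeriv lam a r) r := by
  have h := hasDerivAt_id' r
  have := ((((h.fun_pow 2).const_mul lam).const_sub 1).fun_mul
    ((h.fun_pow 2).add_const (a ^ 2))).fun_sub (h.const_mul 2)
  refine this.congr_deriv ?_
  unfold deltaRDeriv
  norm_num
  ring

theorem hasDerivAt_radialP (lam a E L r : ℝ) :
    HasDerivAt (radialP lam a E L) (2 * chi lam a * r * E) r := by
  have h := hasDerivAt_id' r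
  have := ((((h.fun_pow 2).add_const (a ^ 2)).mul_const E).sub_const (a * L)).const_mul (chi lam a)
  refine this.congr_deriv ?_
  norm_num
  ring

theorem hasDerivAt_radialR (lam a E L K r : ℝ) :
    HasDerivAt (radialR lam a E L K) (radialRDeriv lam a E L K r) r := by
  refine (((hasDerivAt_radialP lam a E L r).fun_pow 2).fun_sub
    ((hasDerivAt_deltaR lam a r).mul_const K)).congr_deriv ?_
  unfold radialRDeriv
  norm_num
  ring

theorem hasDerivAt_slope (r : ℝ) : HasDerivAt S.slope (-2 / (S.rc - S.rp)) r := by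
  have h := hasDerivAt_id' r
  refine (((h.const_mul 2).const_sub (S.rp + S.rc)).div_const (S.rc - S.rp)).congr_deriv ?_
  ring

theorem hasDerivAt_radialW {r : ℝ} (hr : S.rm < r) :
    HasDerivAt S.radialW (deriv S.radialW r) r := by
  have h1 := S.rn_neg
  have h2 := S.rm_pos
  have h3 := S.lam_pos
  have h4 : 0 < S.rc - S.rp := sub_pos.2 S.rp_lt_rc
  have h5 : 0 < r - S.rm := by linarith
  have h6 : 0 < r - S.rn := by linarith
  refine DifferentiableAt.hasDerivAt ?_
  unfold radialW
  fun_prop (disch := positivity)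

/-- The derivative of the identity `Δ_r W + s² = 1`. -/
theorem deriv_radialW_identity {r : ℝ} (hr : S.rm < r) :
    deltaRDeriv lam a r * S.radialW r + deltaR lam a r * deriv S.radialW r
      + 2 * S.slope r * (-2 / (S.rc - S.rp)) = 0 := by
  have h1 := ((hasDerivAt_deltaR lam a r).fun_mul (S.hasDerivAt_radialW hr)).fun_add
    ((S.hasDerivAt_slope r).fun_pow 2)
  have h2 : (fun r => deltaR lam a r * S.radialW r + S.slope r ^ 2) =ᶠ[𝓝 r] fun _ => 1 := by
    filter_upwards [lt_mem_nhds hr] with x hx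
    rw [S.deltaR_mul_radialW hx]; ring
  have h3 := (h1.congr_of_eventuallyEq h2.symm).unique (hasDerivAt_const r (1 : ℝ))
  rw [← h3]
  norm_num

theorem metric_symm (p v w : Fin 5 → ℝ) : S.metric p v w = S.metric p w v := by
  unfold metric; ring

theorem metric_add_smul_left (p u v w : Fin 5 → ℝ) (t : ℝ) :
    S.metric p (u + t • v) w = S.metric p u w + t * S.metric p v w := by
  simp [metric, sigma, alpha]; ring

theorem metric_add_smul_right (p u v w : Fin 5 → ℝ) (t : ℝ) :
    S.metric p w (u + t • v) = S.metric p w u + t * S.metric p w v := by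
  rw [S.metric_symm, metric_add_smul_left, S.metric_symm p u, S.metric_symm p v]

theorem contDiffAt_metric {n : WithTop ℕ∞} {x : (Fin 5 → ℝ) × (Fin 5 → ℝ) × (Fin 5 → ℝ)}
    (hx : S.rm < x.1 1) :
    ContDiffAt ℝ n (fun x : (Fin 5 → ℝ) × (Fin 5 → ℝ) × (Fin 5 → ℝ) => S.metric x.1 x.2.1 x.2.2)
      x := by
  have h1 := S.rn_neg
  have h2 := S.rm_pos
  have h4 : S.rc - S.rp ≠ 0 := (sub_pos.2 S.rp_lt_rc).ne'
  have h5 : x.1 1 - S.rm ≠ 0 := by linarith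
  have h6 : x.1 1 - S.rn ≠ 0 := by linarith
  have hl := S.lam_pos.ne'
  have hc := S.chi_pos.ne'
  have hT := (S.deltaTheta_pos (x.1 4)).ne'
  have hρ := (rhoSq_pos (a := a) (h2.trans hx) (x.1 4)).ne'
  have hρc : rhoSq a (x.1 1) (x.1 4) * chi lam a ^ 2 ≠ 0 := by positivity
  have hρcT : rhoSq a (x.1 1) (x.1 4) * chi lam a ^ 2 * deltaTheta lam a (x.1 4) ≠ 0 := by
    positivity
  have hW : lam * (S.rc - S.rp) ^ 2 * ((x.1 1 - S.rm) * (x.1 1 - S.rn)) ≠ 0 := by positivity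
  unfold metric alpha sigma radialW slope
  unfold deltaR
  unfold rhoSq deltaTheta at *
  fun_prop (disch := assumption)

/-- The derivative of `g_{γ}(V, Y)` along a curve. -/
theorem hasDerivAt_metric {γ V Y : ℝ → Fin 5 → ℝ} {γ' V' Y' : Fin 5 → ℝ} {τ : ℝ}
    (hγ : HasDerivAt γ γ' τ) (hV : HasDerivAt V V' τ) (hY : HasDerivAt Y Y' τ)
    (hr : S.rm < γ τ 1) :
    HasDerivAt (fun τ => S.metric (γ τ) (V τ) (Y τ))
      (fderiv ℝ (fun q => S.metric q (V τ) (Y τ)) (γ τ) γ' + S.metric (γ τ) V' (Y τ)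
        + S.metric (γ τ) (V τ) Y') τ := by
  let F := fun x : (Fin 5 → ℝ) × (Fin 5 → ℝ) × (Fin 5 → ℝ) => S.metric x.1 x.2.1 x.2.2
  have hF : HasFDerivAt F (fderiv ℝ F (γ τ, V τ, Y τ)) (γ τ, V τ, Y τ) :=
    ((S.contDiffAt_metric (n := 1) (x := (γ τ, V τ, Y τ)) hr).differentiableAt
      one_ne_zero).hasFDerivAt
  have h := hF.comp_hasDerivAt τ (hγ.prodMk (hV.prodMk hY))
  refine h.congr_deriv ?_
  have h1 : fderiv ℝ (fun q => S.metric q (V τ) (Y τ)) (γ τ) γ'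
      = fderiv ℝ F (γ τ, V τ, Y τ) (γ', 0, 0) := by
    have := HasFDerivAt.comp (f := fun q => (q, V τ, Y τ)) (γ τ) hF
      ((hasFDerivAt_id (γ τ)).prodMk (hasFDerivAt_const (V τ, Y τ) (γ τ)))
    rw [HasFDerivAt.fderiv (f := fun q => S.metric q (V τ) (Y τ)) this]
    rfl
  have h2 : S.metric (γ τ) V' (Y τ) = fderiv ℝ F (γ τ, V τ, Y τ) (0, V', 0) := by
    have e : HasDerivAt (fun t : ℝ => V τ + t • V') V' 0 := by
      simpa using ((hasDerivAt_id' (0 : ℝ)).smul_const V').const_add (V τ)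
    have := (show HasFDerivAt F _ (γ τ, V τ + (0 : ℝ) • V', Y τ) by simpa using hF).comp_hasDerivAt 0
      ((hasDerivAt_const (0 : ℝ) (γ τ)).prodMk (e.prodMk (hasDerivAt_const (0 : ℝ) (Y τ))))
    have e2 : HasDerivAt (fun t : ℝ => S.metric (γ τ) (V τ + t • V') (Y τ))
        (S.metric (γ τ) V' (Y τ)) 0 := by
      simp only [metric_add_smul_left]
      simpa using ((hasDerivAt_id' (0 : ℝ)).mul_const (S.metric (γ τ) V' (Y τ))).const_add
        (S.metric (γ τ) (V τ) (Y τ))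
    exact e2.unique this
  have h3 : S.metric (γ τ) (V τ) Y' = fderiv ℝ F (γ τ, V τ, Y τ) (0, 0, Y') := by
    have e : HasDerivAt (fun t : ℝ => Y τ + t • Y') Y' 0 := by
      simpa using ((hasDerivAt_id' (0 : ℝ)).smul_const Y').const_add (Y τ)
    have := (show HasFDerivAt F _ (γ τ, V τ, Y τ + (0 : ℝ) • Y') by simpa using hF).comp_hasDerivAt 0
      ((hasDerivAt_const (0 : ℝ) (γ τ)).prodMk ((hasDerivAt_const (0 : ℝ) (V τ)).prodMk e))
    have e2 : HasDerivAt (fun t : ℝ => S.metric (γ τ) (V τ) (Y τ + t • Y'))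
        (S.metric (γ τ) (V τ) Y') 0 := by
      simp only [metric_add_smul_right]
      simpa using ((hasDerivAt_id' (0 : ℝ)).mul_const (S.metric (γ τ) (V τ) Y')).const_add
        (S.metric (γ τ) (V τ) (Y τ))
    exact e2.unique this
  rw [h1, h2, h3, ← map_add, ← map_add]
  simp

/-- Directional derivatives of the metric, computed along lines. -/
theorem fderiv_metric_eq {p v w d : Fin 5 → ℝ} {c : ℝ} (hr : S.rm < p 1)
    (h : HasDerivAt (fun t : ℝ => S.metric (p + t • d) v w) c 0) :
    fderiv ℝ (fun q => S.metric q v w) p d = c := by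
  have e : HasDerivAt (fun t : ℝ => p + t • d) d 0 := by
    simpa using ((hasDerivAt_id' (0 : ℝ)).smul_const d).const_add p
  have h2 := S.hasDerivAt_metric e (hasDerivAt_const (0 : ℝ) v) (hasDerivAt_const (0 : ℝ) w)
    (by simpa using hr)
  have h0 (x y) : S.metric x 0 y = 0 := by simp [metric, sigma, alpha]
  have h0' (x y) : S.metric x y 0 = 0 := by rw [S.metric_symm, h0]
  simp only [h0, h0', zero_smul, add_zero] at h2
  exact h2.unique h

/-- Invariance of the metric under translations in time. -/
theorem fderiv_metric_dt {p : Fin 5 → ℝ} (hr : S.rm < p 1) (v w : Fin 5 → ℝ) :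
    fderiv ℝ (fun q => S.metric q v w) p dt = 0 := by
  refine S.fderiv_metric_eq hr ?_
  have : (fun t : ℝ => S.metric (p + t • dt) v w) = fun _ => S.metric p v w := by
    funext t
    simp [metric, sigma, alpha, dt]
  rw [this]
  exact hasDerivAt_const _ _

/-- Invariance of the metric under rotations about the axis. -/
theorem fderiv_metric_dphi {p : Fin 5 → ℝ} (hr : S.rm < p 1) (v : Fin 5 → ℝ) :
    1 / 2 * fderiv ℝ (fun q => S.metric q v v) p (dphi p) + S.metric p v (dphi v) = 0 := by
  have h : HasDerivAt (fun t : ℝ => S.metric (p + t • dphi p) v v)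
      (-2 * S.metric p v (dphi v)) 0 := by
    have hσ : HasDerivAt (fun t : ℝ => sigma (p + t • dphi p) v) (-(p 3 * v 3) - p 2 * v 2) 0 := by
      have := (((hasDerivAt_id' (0 : ℝ)).mul_const (-(p 3 * v 3) - p 2 * v 2)).const_add (sigma p v))
      refine (this.congr_deriv (by ring)).congr_of_eventuallyEq (Eventually.of_forall fun t => ?_)
      simp [sigma, dphi]
      ring
    have h1 (t : ℝ) : (p + t • dphi p) 1 = p 1 := by simp [dphi]
    have h4 (t : ℝ) : (p + t • dphi p) 4 = p 4 := by simp [dphi]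
    unfold metric alpha
    simp only [h1, h4]
    have hA := (hσ.const_mul a).const_sub (v 0)
    have := ((((((hσ.fun_mul hσ).const_mul (a ^ 2 * (1 - lam * p 1 ^ 2)
      * (deltaTheta lam a (p 4) * (p 1 ^ 2 + a ^ 2) + rhoSq a (p 1) (p 4) * chi lam a)
      / (rhoSq a (p 1) (p 4) * chi lam a ^ 2 * deltaTheta lam a (p 4)))).const_add
        (rhoSq a (p 1) (p 4) / deltaTheta lam a (p 4) * (v 2 * v 2 + v 3 * v 3 + v 4 * v 4))).fun_add
        (((((hσ.const_mul (v 0)).fun_add (hσ.mul_const (v 0))).const_mul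
          (a * (p 1 ^ 2 + a ^ 2))).const_sub (a ^ 2 * (1 - p 4 ^ 2) * (v 0 * v 0))).const_mul
          (deltaTheta lam a (p 4) / (rhoSq a (p 1) (p 4) * chi lam a ^ 2)))).fun_sub
        ((hA.fun_mul hA).const_mul (deltaR lam a (p 1) / (rhoSq a (p 1) (p 4) * chi lam a ^ 2)))).fun_add
        (((hA.mul_const (v 1)).fun_add (hA.const_mul (v 1))).const_mul
          (S.slope (p 1) / chi lam a))).add_const
        (rhoSq a (p 1) (p 4) * S.radialW (p 1) * (v 1 * v 1))
    refine this.congr_deriv ?_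
    simp [sigma, dphi]
    ring
  rw [S.fderiv_metric_eq hr h]
  ring

/-- The `r`-derivative of the metric at a null vector. The angular velocity enters only through the
energy `-g(v, ∂_t)`. -/
theorem fderiv_metric_dr {p v : Fin 5 → ℝ} (hp : p ∈ S.spacetime) (h0 : S.metric p v v = 0) :
    rhoSq a (p 1) (p 4) * fderiv ℝ (fun q => S.metric q v v) p dr
      = -deltaRDeriv lam a (p 1) * S.alpha p v ^ 2 / chi lam a ^ 2
        + 2 * (-2 / (S.rc - S.rp)) * S.alpha p v * S.radialVel p v / chi lam a
        + deriv S.radialW (p 1) * S.radialVel p v ^ 2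
        - 4 * p 1 * S.alpha p v * S.metric p v dt := by
  have hr := hp.1
  have e : HasDerivAt (fun t : ℝ => p + t • dr) dr 0 := by
    simpa using ((hasDerivAt_id' (0 : ℝ)).smul_const dr).const_add p
  have hg := S.hasDerivAt_metric e (hasDerivAt_const (0 : ℝ) v) (hasDerivAt_const (0 : ℝ) v)
    (by simpa using hr)
  have h00 (x y) : S.metric x 0 y = 0 := by simp [metric, sigma, alpha]
  have h00' (x y) : S.metric x y 0 = 0 := by rw [S.metric_symm, h00]
  simp only [h00, h00', zero_smul, add_zero] at hg
  have hR : HasDerivAt (fun t : ℝ => p 1 + t) 1 0 := (hasDerivAt_id' (0 : ℝ)).const_add _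
  have hp0 : p 1 + 0 = p 1 := add_zero _
  have hq : HasDerivAt (fun t : ℝ => rhoSq a (p 1 + t) (p 4)) (2 * p 1) 0 := by
    refine ((hR.fun_pow 2).add_const _).congr_deriv ?_
    simp
  have hD : HasDerivAt (fun t : ℝ => deltaR lam a (p 1 + t)) (deltaRDeriv lam a (p 1)) 0 := by
    have := HasDerivAt.comp (0 : ℝ) (by simpa using hasDerivAt_deltaR lam a (p 1)) hR
    exact this.congr_deriv (mul_one _)
  have hs : HasDerivAt (fun t : ℝ => S.slope (p 1 + t)) (-2 / (S.rc - S.rp)) 0 := by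
    have := HasDerivAt.comp (0 : ℝ) (S.hasDerivAt_slope (p 1 + 0)) hR
    exact this.congr_deriv (mul_one _)
  have hW : HasDerivAt (fun t : ℝ => S.radialW (p 1 + t)) (deriv S.radialW (p 1)) 0 := by
    have := HasDerivAt.comp (0 : ℝ) (S.hasDerivAt_radialW (hr.trans_eq hp0.symm)) hR
    exact this.congr_deriv (by rw [mul_one, hp0])
  set A := S.alpha p v with hA
  set σ := sigma p v with hσ
  set T := deltaTheta lam a (p 4) with hT
  set X := chi lam a with hX
  have hcarter := ((hD.mul_const (A ^ 2)).div_const (X ^ 2)).fun_sub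
    ((((hs.const_mul 2).mul_const A).fun_mul (hq.mul_const (v 1))).div_const X) |>.fun_sub
    (hW.fun_mul ((hq.mul_const (v 1)).fun_pow 2))
  have hB := (hq.mul_const σ).const_sub (a * (1 - p 4 ^ 2) * A)
  have hrhs := (hcarter.neg.fun_add (((((hq.fun_pow 2).mul_const (sphereSq v)).fun_sub
      ((hq.const_mul (2 * a * A)).mul_const σ)).add_const
      (a ^ 2 * A ^ 2 * (1 - p 4 ^ 2))).div_const T)).fun_sub
    (((hB.fun_pow 2).const_mul (a ^ 2 * lam * (T + X))).div_const (X ^ 2 * T))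
  have hlhs := (hq.fun_mul hg)
  have hEq : (fun t : ℝ => rhoSq a (p 1 + t) (p 4) * S.metric (p + t • dr) v v) =ᶠ[𝓝 0] _ :=
    (show ∀ᶠ t : ℝ in 𝓝 0, _ from by
      have : ∀ᶠ t : ℝ in 𝓝 0, S.rm < p 1 + t := by
        have := hR.continuousAt.eventually (lt_mem_nhds (show S.rm < p 1 + 0 by simpa using hr))
        simpa using this
      filter_upwards [this] with t ht
      have hmem : p + t • dr ∈ S.spacetime := by
        refine ⟨by simpa [dr] using ht, by simpa [dr] using hp.2⟩
      have := S.rhoSq_mul_metric_self hmem v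
      simpa [carter, radialVel, azimuthal, dr, sigma, alpha] using this)
  have hu := hlhs.unique ((hrhs.congr_of_eventuallyEq (by
    refine hEq.trans (Eventually.of_forall fun t => ?_)
    simp [hA, hσ, hT, hX, sigma, alpha])))
  have hm := S.momentum_identities hp v
  have hnull := S.carter_eq_of_null hp h0
  have hTX : X = T + a ^ 2 * lam * (1 - p 4 ^ 2) := by
    simp only [hX, hT]; unfold deltaTheta chi; ring
  have hq0 : p 1 ^ 2 + a ^ 2 = rhoSq a (p 1) (p 4) + a ^ 2 * (1 - p 4 ^ 2) := by
    unfold rhoSq; ring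
  have hX0 : X ≠ 0 := S.chi_pos.ne'
  have hT0 : T ≠ 0 := (S.deltaTheta_pos (p 4)).ne'
  have hρ := (rhoSq_pos (a := a) (S.rm_pos.trans hr) (p 4)).ne'
  have hK : S.carter p v = deltaR lam a (p 1) * A ^ 2 / X ^ 2
      - 2 * S.slope (p 1) * A * (rhoSq a (p 1) (p 4) * v 1) / X
      - S.radialW (p 1) * (rhoSq a (p 1) (p 4) * v 1) ^ 2 := rfl
  have hBd : S.azimuthal p v = a * (1 - p 4 ^ 2) * A - rhoSq a (p 1) (p 4) * σ := rfl
  have hy : S.radialVel p v = rhoSq a (p 1) (p 4) * v 1 := rfl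
  simp only [← hA, ← hσ, ← hT, ← hX] at hm hnull
  rw [hy] at hm ⊢
  simp only [zero_smul, add_zero, h0, mul_zero, zero_add] at hu
  rw [hu]
  have hpT : rhoSq a (p 1) (p 4) * S.metric p v dt = -deltaR lam a (p 1) * A / X ^ 2
      + S.slope (p 1) * (rhoSq a (p 1) (p 4) * v 1) / X + a * T * S.azimuthal p v / X ^ 2 := by
    rw [hq0] at hm
    linear_combination hm.1 - a * hm.2
  -- the terms that come from the derivative of `ρ²` combine to `g(v, ∂_t)`
  have hkey : S.slope (p 1) * A * v 1 / X + S.radialW (p 1) * (rhoSq a (p 1) (p 4) * v 1) * v 1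
      + (rhoSq a (p 1) (p 4) * sphereSq v - a * A * σ) / T
      + a ^ 2 * lam * (T + X) * S.azimuthal p v * σ / (X ^ 2 * T) = -A * S.metric p v dt := by
    apply mul_left_cancel₀ hρ
    have e1 : a * T * S.azimuthal p v * A / X ^ 2 = a * S.azimuthal p v * A / T
        - a ^ 2 * lam * (T + X) * S.azimuthal p v * (a * (1 - p 4 ^ 2) * A) / (X ^ 2 * T) := by
      field_simp
      linear_combination (-(a * S.azimuthal p v * A) * (T + X)) * hTX
    have e2 : rhoSq a (p 1) (p 4) * ((rhoSq a (p 1) (p 4) * sphereSq v - a * A * σ) / T)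
        = S.carter p v + a ^ 2 * lam * (T + X) * S.azimuthal p v ^ 2 / (X ^ 2 * T)
          - a * A * S.azimuthal p v / T := by
      have : rhoSq a (p 1) (p 4) * (rhoSq a (p 1) (p 4) * sphereSq v - a * A * σ)
          = S.carter p v * T + a ^ 2 * lam * (T + X) * S.azimuthal p v ^ 2 / X ^ 2
            - a * A * S.azimuthal p v := by
        linear_combination hnull + a * A * hBd
      rw [← mul_div_assoc, this]
      field_simp
    have e3 : rhoSq a (p 1) (p 4) * (a ^ 2 * lam * (T + X) * S.azimuthal p v * σ / (X ^ 2 * T))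
        = a ^ 2 * lam * (T + X) * S.azimuthal p v * (a * (1 - p 4 ^ 2) * A) / (X ^ 2 * T)
          - a ^ 2 * lam * (T + X) * S.azimuthal p v ^ 2 / (X ^ 2 * T) := by
      linear_combination a ^ 2 * lam * (T + X) * S.azimuthal p v / (X ^ 2 * T) * hBd
    linear_combination e2 + e3 + e1 + hK + A * hpT
  rw [hBd] at hkey
  norm_num
  linear_combination 4 * p 1 * hkey

end

section

/-! ### The radial motion of null geodesics -/

/-- `γ` is a future-directed null curve on the open interval `J` with energy `E`, angular momentum
`L` and Carter constant `K`, and with the radial equation of motion of a geodesic, once for the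
radial velocity and once for the momentum `g(γ', ∂_r)`, which carries more information where
`Δ_r = 0`. -/
structure IsNullOrbit (γ : ℝ → Fin 5 → ℝ) (J : Set ℝ) (E L K : ℝ) : Prop where
  isOpen : IsOpen J
  ordConnected : J.OrdConnected
  nonempty : J.Nonempty
  mem : ∀ τ ∈ J, γ τ ∈ S.spacetime
  hasDerivAt : ∀ τ ∈ J, HasDerivAt γ (deriv γ τ) τ
  tangent : ∀ τ ∈ J, IsTangent (γ τ) (deriv γ τ)
  null : ∀ τ ∈ J, S.metric (γ τ) (deriv γ τ) (deriv γ τ) = 0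
  alpha_pos : ∀ τ ∈ J, 0 < S.alpha (γ τ) (deriv γ τ)
  radialP_eq : ∀ τ ∈ J, radialP lam a E L (γ τ 1)
    = deltaR lam a (γ τ 1) * S.alpha (γ τ) (deriv γ τ) / chi lam a
      - S.slope (γ τ 1) * S.radialVel (γ τ) (deriv γ τ)
  azimuthal_eq : ∀ τ ∈ J, deltaTheta lam a (γ τ 4) * S.azimuthal (γ τ) (deriv γ τ)
    = chi lam a ^ 2 * (a * (1 - γ τ 4 ^ 2) * E - L)
  carter_eq : ∀ τ ∈ J, S.carter (γ τ) (deriv γ τ) = K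
  hasDerivAt_radialVel : ∀ τ ∈ J, HasDerivAt (fun τ => S.radialVel (γ τ) (deriv γ τ))
    (radialRDeriv lam a E L K (γ τ 1) / (2 * rhoSq a (γ τ 1) (γ τ 4))) τ
  hasDerivAt_metric_dr : ∀ τ ∈ J, HasDerivAt (fun τ => S.metric (γ τ) (deriv γ τ) dr)
    ((-deltaRDeriv lam a (γ τ 1) * S.alpha (γ τ) (deriv γ τ) ^ 2 / chi lam a ^ 2
      + 2 * (-2 / (S.rc - S.rp)) * S.alpha (γ τ) (deriv γ τ) * S.radialVel (γ τ) (deriv γ τ)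
        / chi lam a
      + deriv S.radialW (γ τ 1) * S.radialVel (γ τ) (deriv γ τ) ^ 2
      + 4 * γ τ 1 * S.alpha (γ τ) (deriv γ τ) * E) / (2 * rhoSq a (γ τ 1) (γ τ 4))) τ

/-- A function with zero derivative on an open interval is constant there. -/
theorem exists_eq_const_of_hasDerivAt_zero {f : ℝ → ℝ} {J : Set ℝ} (hJ : IsOpen J)
    (hJc : J.OrdConnected) (hf : ∀ τ ∈ J, HasDerivAt f 0 τ) : ∃ c, ∀ τ ∈ J, f τ = c := by
  refine hJ.exists_is_const_of_deriv_eq_zero hJc.isPreconnected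
    (fun τ hτ => (hf τ hτ).differentiableAt.differentiableWithinAt) fun τ hτ => (hf τ hτ).deriv

variable {S}

theorem IsGeodesic.hasDerivAt {γ : ℝ → Fin 5 → ℝ} {J : Set ℝ} (h : S.IsGeodesic γ J) {τ : ℝ}
    (hτ : τ ∈ J) : HasDerivAt γ (deriv γ τ) τ ∧ HasDerivAt (deriv γ) (deriv (deriv γ) τ) τ := by
  have hc : ContDiffAt ℝ 2 γ τ := h.2.2.2.1.contDiffAt (h.1.mem_nhds hτ)
  refine ⟨(hc.differentiableAt two_ne_zero).hasDerivAt, ?_⟩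
  have h1 : ContDiffAt ℝ 1 (deriv γ) τ := by
    have : ContDiffAt ℝ 1 (fderiv ℝ γ) τ := hc.fderiv_right (by norm_num)
    exact this.clm_apply contDiffAt_const
  exact (h1.differentiableAt one_ne_zero).hasDerivAt

theorem IsGeodesic.isTangent {γ : ℝ → Fin 5 → ℝ} {J : Set ℝ} (h : S.IsGeodesic γ J) {τ : ℝ}
    (hτ : τ ∈ J) : IsTangent (γ τ) (deriv γ τ) := by
  have hd := hasDerivAt_pi.1 (h.hasDerivAt hτ).1
  have h1 := (((hd 2).fun_pow 2).fun_add ((hd 3).fun_pow 2)).fun_add ((hd 4).fun_pow 2)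
  have h2 : (fun τ => γ τ 2 ^ 2 + γ τ 3 ^ 2 + γ τ 4 ^ 2) =ᶠ[𝓝 τ] fun _ => 1 := by
    filter_upwards [h.1.mem_nhds hτ] with x hx using (h.2.2.2.2.1 x hx).2
  have h3 := (h1.congr_of_eventuallyEq h2.symm).unique (hasDerivAt_const τ (1 : ℝ))
  unfold IsTangent
  norm_num at h3
  linarith

theorem isTangent_dr (p : Fin 5 → ℝ) : IsTangent p dr := by simp [IsTangent, dr]
theorem isTangent_dt (p : Fin 5 → ℝ) : IsTangent p dt := by simp [IsTangent, dt]
theorem isTangent_dphi (p : Fin 5 → ℝ) : IsTangent p (dphi p) := by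
  simp [IsTangent, dphi]; ring

/-- The energy `-g(γ', ∂_t)` is conserved. -/
theorem IsGeodesic.hasDerivAt_metric_dt {γ : ℝ → Fin 5 → ℝ} {J : Set ℝ} (h : S.IsGeodesic γ J)
    {τ : ℝ} (hτ : τ ∈ J) : HasDerivAt (fun τ => S.metric (γ τ) (deriv γ τ) dt) 0 τ := by
  have hr := (h.2.2.2.2.1 τ hτ).1
  refine (S.hasDerivAt_metric (h.hasDerivAt hτ).1 (h.hasDerivAt hτ).2 (hasDerivAt_const τ dt)
    hr).congr_deriv ?_
  have := h.2.2.2.2.2 τ hτ dt (isTangent_dt _)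
  rw [S.fderiv_metric_dt hr] at this
  have h0 : S.metric (γ τ) (deriv γ τ) 0 = 0 := by simp [metric, sigma, alpha]
  linarith

/-- The angular momentum `g(γ', ∂_φ)` is conserved. -/
theorem IsGeodesic.hasDerivAt_metric_dphi {γ : ℝ → Fin 5 → ℝ} {J : Set ℝ} (h : S.IsGeodesic γ J)
    {τ : ℝ} (hτ : τ ∈ J) :
    HasDerivAt (fun τ => S.metric (γ τ) (deriv γ τ) (dphi (γ τ))) 0 τ := by
  have hr := (h.2.2.2.2.1 τ hτ).1
  have hd := hasDerivAt_pi.1 (h.hasDerivAt hτ).1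
  have hφ : HasDerivAt (fun τ => dphi (γ τ)) (dphi (deriv γ τ)) τ := by
    rw [hasDerivAt_pi]
    intro i
    fin_cases i
    · exact hasDerivAt_const _ _
    · exact hasDerivAt_const _ _
    · exact (hd 3).neg
    · exact hd 2
    · exact hasDerivAt_const _ _
  refine (S.hasDerivAt_metric (h.hasDerivAt hτ).1 (h.hasDerivAt hτ).2 hφ hr).congr_deriv ?_
  have := h.2.2.2.2.2 τ hτ (dphi (γ τ)) (isTangent_dphi _)
  have h2 := S.fderiv_metric_dphi hr (deriv γ τ)
  linarith

/-- The momentum `g(γ', ∂_r)` changes at a rate that depends on `r`, `θ` and the radial variables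
only. -/
theorem IsGeodesic.hasDerivAt_metric_dr {γ : ℝ → Fin 5 → ℝ} {J : Set ℝ} (h : S.IsGeodesic γ J)
    {τ : ℝ} (hτ : τ ∈ J) (h0 : S.metric (γ τ) (deriv γ τ) (deriv γ τ) = 0) :
    HasDerivAt (fun τ => S.metric (γ τ) (deriv γ τ) dr)
      ((-deltaRDeriv lam a (γ τ 1) * S.alpha (γ τ) (deriv γ τ) ^ 2 / chi lam a ^ 2
      + 2 * (-2 / (S.rc - S.rp)) * S.alpha (γ τ) (deriv γ τ) * S.radialVel (γ τ) (deriv γ τ)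
        / chi lam a
      + deriv S.radialW (γ τ 1) * S.radialVel (γ τ) (deriv γ τ) ^ 2
      - 4 * γ τ 1 * S.alpha (γ τ) (deriv γ τ) * S.metric (γ τ) (deriv γ τ) dt)
        / (2 * rhoSq a (γ τ 1) (γ τ 4))) τ := by
  have hp := h.2.2.2.2.1 τ hτ
  have hρ := (rhoSq_pos (a := a) (S.rm_pos.trans hp.1) (γ τ 4)).ne'
  refine (S.hasDerivAt_metric (h.hasDerivAt hτ).1 (h.hasDerivAt hτ).2 (hasDerivAt_const τ dr)
    hp.1).congr_deriv ?_
  have h1 := h.2.2.2.2.2 τ hτ dr (isTangent_dr _)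
  have hz : S.metric (γ τ) (deriv γ τ) 0 = 0 := by simp [metric, sigma, alpha]
  rw [← S.fderiv_metric_dr hp h0, hz]
  field_simp
  linarith

/-- The radial velocity and the Carter constant are functions of `r`, `E`, `L` and the momentum
`g(γ', ∂_r)`. This gives the conservation of the Carter constant and the radial equation of motion
without the equation of motion in `θ`. -/
theorem IsFutureNullGeodesic.exists_isNullOrbit {γ : ℝ → Fin 5 → ℝ} {J : Set ℝ}
    (h : S.IsFutureNullGeodesic γ J) : ∃ E L K, S.IsNullOrbit γ J E L K := by
  obtain ⟨hg, hn⟩ := h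
  have hJ := hg.1
  have hJc := hg.2.1
  have hmem := hg.2.2.2.2.1
  have hX := S.chi_pos
  obtain ⟨E', hE⟩ := exists_eq_const_of_hasDerivAt_zero hJ hJc
    fun τ hτ => hg.hasDerivAt_metric_dt hτ
  obtain ⟨L, hL⟩ := exists_eq_const_of_hasDerivAt_zero hJ hJc
    fun τ hτ => hg.hasDerivAt_metric_dphi hτ
  obtain ⟨E, rfl⟩ : ∃ E, E' = -E := ⟨-E', by ring⟩
  have hP : ∀ τ ∈ J, radialP lam a E L (γ τ 1)
      = deltaR lam a (γ τ 1) * S.alpha (γ τ) (deriv γ τ) / chi lam a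
        - S.slope (γ τ 1) * S.radialVel (γ τ) (deriv γ τ) := by
    intro τ hτ
    have := (S.momentum_identities (hmem τ hτ) (deriv γ τ)).1
    rw [hE τ hτ, hL τ hτ] at this
    unfold radialP
    field_simp at this ⊢
    linear_combination -this
  have hB : ∀ τ ∈ J, deltaTheta lam a (γ τ 4) * S.azimuthal (γ τ) (deriv γ τ)
      = chi lam a ^ 2 * (a * (1 - γ τ 4 ^ 2) * E - L) := by
    intro τ hτ
    have := (S.momentum_identities (hmem τ hτ) (deriv γ τ)).2
    rw [hE τ hτ, hL τ hτ] at this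
    field_simp at this
    linear_combination this
  have hpr : ∀ τ ∈ J, HasDerivAt (fun τ => S.metric (γ τ) (deriv γ τ) dr)
    ((-deltaRDeriv lam a (γ τ 1) * S.alpha (γ τ) (deriv γ τ) ^ 2 / chi lam a ^ 2
      + 2 * (-2 / (S.rc - S.rp)) * S.alpha (γ τ) (deriv γ τ) * S.radialVel (γ τ) (deriv γ τ)
        / chi lam a
      + deriv S.radialW (γ τ 1) * S.radialVel (γ τ) (deriv γ τ) ^ 2
      + 4 * γ τ 1 * S.alpha (γ τ) (deriv γ τ) * E) / (2 * rhoSq a (γ τ 1) (γ τ 4))) τ := by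
    intro τ hτ
    refine (hg.hasDerivAt_metric_dr hτ (hn τ hτ).2.1).congr_deriv ?_
    rw [hE τ hτ]
    ring
  have hrd : ∀ τ ∈ J, HasDerivAt (fun τ => γ τ 1)
      (S.radialVel (γ τ) (deriv γ τ) / rhoSq a (γ τ 1) (γ τ 4)) τ := by
    intro τ hτ
    have hρ := (rhoSq_pos (a := a) (S.rm_pos.trans (hmem τ hτ).1) (γ τ 4)).ne'
    refine (hasDerivAt_pi.1 (hg.hasDerivAt hτ).1 1).congr_deriv ?_
    unfold radialVel
    field_simp
  -- the radial velocity and the Carter constant in terms of the momenta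
  have hy : ∀ τ ∈ J, S.radialVel (γ τ) (deriv γ τ)
      = deltaR lam a (γ τ 1) * S.metric (γ τ) (deriv γ τ) dr
        - S.slope (γ τ 1) * radialP lam a E L (γ τ 1) := by
    intro τ hτ
    rw [hP τ hτ, S.metric_dr]
    linear_combination (-S.radialVel (γ τ) (deriv γ τ)) * S.deltaR_mul_radialW (hmem τ hτ).1
  have hK : ∀ τ ∈ J, S.carter (γ τ) (deriv γ τ)
      = S.radialW (γ τ 1) * radialP lam a E L (γ τ 1) ^ 2
        - deltaR lam a (γ τ 1) * S.metric (γ τ) (deriv γ τ) dr ^ 2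
        + 2 * S.slope (γ τ 1) * radialP lam a E L (γ τ 1) * S.metric (γ τ) (deriv γ τ) dr := by
    intro τ hτ
    rw [hP τ hτ, S.metric_dr]
    unfold carter
    have hW := S.deltaR_mul_radialW (hmem τ hτ).1
    generalize deltaR lam a (γ τ 1) = D at *
    generalize S.slope (γ τ 1) = s at *
    generalize S.radialW (γ τ 1) = W at *
    generalize S.alpha (γ τ) (deriv γ τ) = A at *
    generalize S.radialVel (γ τ) (deriv γ τ) = y at *
    generalize chi lam a = X at *
    clear hP hpr hrd hy hB hn
    obtain ⟨B, rfl⟩ : ∃ B, A = B * X := ⟨A / X, by field_simp⟩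
    field_simp
    linear_combination (-(D * B ^ 2 - 2 * s * B * y - W * y ^ 2)) * hW
  have hKd : ∀ τ ∈ J, HasDerivAt (fun τ => S.carter (γ τ) (deriv γ τ)) 0 τ := by
    intro τ hτ
    have hr := (hmem τ hτ).1
    have hρ := (rhoSq_pos (a := a) (S.rm_pos.trans hr) (γ τ 4)).ne'
    have dP := (hasDerivAt_radialP lam a E L (γ τ 1)).comp τ (hrd τ hτ)
    have dD := (hasDerivAt_deltaR lam a (γ τ 1)).comp τ (hrd τ hτ)
    have dW := (S.hasDerivAt_radialW hr).comp τ (hrd τ hτ)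
    have ds := (S.hasDerivAt_slope (γ τ 1)).comp τ (hrd τ hτ)
    have := ((dW.fun_mul (dP.fun_pow 2)).fun_sub (dD.fun_mul ((hpr τ hτ).fun_pow 2))).fun_add
      (((ds.const_mul 2).fun_mul dP).fun_mul (hpr τ hτ))
    refine (this.congr_of_eventuallyEq (by
      filter_upwards [hJ.mem_nhds hτ] with x hx using hK x hx)).congr_deriv ?_
    simp only [Function.comp_apply]
    rw [hP τ hτ, S.metric_dr]
    have hW := S.deltaR_mul_radialW hr
    have hW' := S.deriv_radialW_identity hr
    generalize deltaR lam a (γ τ 1) = D at *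
    generalize deltaRDeriv lam a (γ τ 1) = D' at *
    generalize S.slope (γ τ 1) = s at *
    generalize (-2 / (S.rc - S.rp)) = s' at *
    generalize deriv S.radialW (γ τ 1) = W' at *
    generalize S.radialW (γ τ 1) = W at *
    generalize S.alpha (γ τ) (deriv γ τ) = A at *
    generalize S.radialVel (γ τ) (deriv γ τ) = y at *
    generalize rhoSq a (γ τ 1) (γ τ 4) = q at *
    generalize γ τ 1 = r at *
    clear this dP dD dW ds hP hpr hrd hy hB hn hK
    norm_num
    generalize chi lam a = X at *
    obtain ⟨B, rfl⟩ : ∃ B, A = B * X := ⟨A / X, by field_simp⟩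
    rw [show D * (B * X) / X = D * B by field_simp, show s / X * (B * X) = s * B by field_simp,
      show -(D' * (B * X) ^ 2) / X ^ 2 = -D' * B ^ 2 by field_simp,
      show 2 * s' * (B * X) * y / X = 2 * s' * B * y by field_simp]
    obtain ⟨P, hP⟩ : ∃ P, P = D * B - s * y := ⟨_, rfl⟩
    obtain ⟨Q, hQ⟩ : ∃ Q, Q = s * B + W * y := ⟨_, rfl⟩
    rw [← hP, ← hQ]
    have h1 : s * P - D * Q = -y := by rw [hP, hQ]; linear_combination (-y) * hW
    have h2 : W * P + s * Q = B := by rw [hP, hQ]; linear_combination B * hW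
    have h3 : P ^ 2 - y ^ 2 = D * (D * B ^ 2 - 2 * s * B * y - W * y ^ 2) := by
      rw [hP]; linear_combination y ^ 2 * hW
    have h4 : Q ^ 2 - B ^ 2 = -W * (D * B ^ 2 - 2 * s * B * y - W * y ^ 2) := by
      rw [hQ]; linear_combination B ^ 2 * hW
    have h5 : P * Q - B * y = s * (D * B ^ 2 - 2 * s * B * y - W * y ^ 2) := by
      rw [hP, hQ]; linear_combination (B * y) * hW
    field_simp
    linear_combination y * (W' * h3 - D' * h4 + 2 * s' * h5) + 4 * y * X * r * E * h2
      + (-D' * B ^ 2 + 2 * s' * B * y + W' * y ^ 2 + 4 * r * X * B * E) * h1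
      + y * (D * B ^ 2 - 2 * s * B * y - W * y ^ 2) * hW'
  obtain ⟨K, hKc⟩ := exists_eq_const_of_hasDerivAt_zero hJ hJc hKd
  refine ⟨E, L, K, hJ, hJc, hg.2.2.1, hmem, fun τ hτ => (hg.hasDerivAt hτ).1,
    fun τ hτ => hg.isTangent hτ, fun τ hτ => (hn τ hτ).2.1, fun τ hτ => ?_, hP, hB, hKc,
    fun τ hτ => ?_, hpr⟩
  · have := (hn τ hτ).2.2
    rw [S.metric_timeField_apply (hmem τ hτ), neg_lt_zero] at this
    exact (div_pos_iff_of_pos_right hX).1 this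
  · have hr := (hmem τ hτ).1
    have hρ := (rhoSq_pos (a := a) (S.rm_pos.trans hr) (γ τ 4)).ne'
    have dP := (hasDerivAt_radialP lam a E L (γ τ 1)).comp τ (hrd τ hτ)
    have dD := (hasDerivAt_deltaR lam a (γ τ 1)).comp τ (hrd τ hτ)
    have ds := (S.hasDerivAt_slope (γ τ 1)).comp τ (hrd τ hτ)
    have := (dD.fun_mul (hpr τ hτ)).fun_sub (ds.fun_mul dP)
    refine (this.congr_of_eventuallyEq (by
      filter_upwards [hJ.mem_nhds hτ] with x hx using hy x hx)).congr_deriv ?_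
    simp only [Function.comp_apply]
    unfold radialRDeriv
    rw [← hKc τ hτ, hP τ hτ, S.metric_dr]
    unfold carter
    have hW := S.deltaR_mul_radialW hr
    have hW' := S.deriv_radialW_identity hr
    generalize deltaR lam a (γ τ 1) = D at *
    generalize deltaRDeriv lam a (γ τ 1) = D' at *
    generalize S.slope (γ τ 1) = s at *
    generalize (-2 / (S.rc - S.rp)) = s' at *
    generalize deriv S.radialW (γ τ 1) = W' at *
    generalize S.radialW (γ τ 1) = W at *
    generalize S.alpha (γ τ) (deriv γ τ) = A at *
    generalize S.radialVel (γ τ) (deriv γ τ) = y at *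
    generalize rhoSq a (γ τ 1) (γ τ 4) = q at *
    generalize γ τ 1 = r at *
    clear this dP dD ds hP hpr hrd hy hB hn hK hKd hKc
    generalize chi lam a = X at *
    obtain ⟨B, rfl⟩ : ∃ B, A = B * X := ⟨A / X, by field_simp⟩
    field_simp
    linear_combination y ^ 2 * hW'

end

section

/-! ### The geodesic equation as an ordinary differential equation -/

/-- The Euclidean inner product of the last three components. -/
def sphereDot (p w : Fin 5 → ℝ) : ℝ := p 2 * w 2 + p 3 * w 3 + p 4 * w 4

/-- The vector normal to `ℝ × ℝ × 𝕊²` at `p`. -/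
def sphereNormal (p : Fin 5 → ℝ) : Fin 5 → ℝ := ![0, 0, p 2, p 3, p 4]

/-- The orthogonal projection along `sphereNormal p`, multiplied by `|sphereNormal p|²`; this scaling
makes it polynomial in `p` and makes it annihilate the normal off the unit sphere as well. -/
def tangentPart (p w : Fin 5 → ℝ) : Fin 5 → ℝ :=
  sphereDot p p • w - sphereDot p w • sphereNormal p

theorem tangentPart_apply (p w : Fin 5 → ℝ) (i : Fin 5) :
    tangentPart p w i = sphereDot p p * w i - sphereDot p w * sphereNormal p i := by
  simp [tangentPart]

/-- The left-hand side of the geodesic equation at position `p`, velocity `v`, acceleration `x`,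
tested against `w`. -/
def geodesicResidual (p v x w : Fin 5 → ℝ) : ℝ :=
  S.metric p x w + fderiv ℝ (fun q => S.metric q v w) p v
    - 1 / 2 * fderiv ℝ (fun q => S.metric q v v) p w

/-- The matrix of the linear system for the acceleration: the metric tested against tangent vectors,
completed by the normal component, for which the metric gives no condition. -/
def accelMatrix (p : Fin 5 → ℝ) : Matrix (Fin 5) (Fin 5) ℝ := fun i j =>
  S.metric p (Pi.single j 1) (tangentPart p (Pi.single i 1))
    + sphereDot p (Pi.single j 1) * sphereDot p (Pi.single i 1)

/-- The right-hand side of the linear system for the acceleration. -/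
def accelRhs (p v : Fin 5 → ℝ) : Fin 5 → ℝ := fun i =>
  -geodesicResidual S p v 0 (tangentPart p (Pi.single i 1))
    - sphereSq v * sphereDot p (Pi.single i 1)

/-- The acceleration of a geodesic at position `p` with velocity `v`. -/
def accel (p v : Fin 5 → ℝ) : Fin 5 → ℝ := (S.accelMatrix p)⁻¹.mulVec (S.accelRhs p v)

theorem accelMatrix_mulVec (p x : Fin 5 → ℝ) (i : Fin 5) :
    (S.accelMatrix p).mulVec x i = S.metric p x (tangentPart p (Pi.single i 1))
      + sphereDot p x * sphereDot p (Pi.single i 1) := by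
  have h1 (w : Fin 5 → ℝ) : S.metric p x w = ∑ j, S.metric p (Pi.single j 1) w * x j := by
    simp [metric, sigma, alpha, Fin.sum_univ_five, Pi.single_apply]
    ring
  have h2 : sphereDot p x = ∑ j, sphereDot p (Pi.single j 1) * x j := by
    simp [sphereDot, Fin.sum_univ_five, Pi.single_apply]
  rw [h1, h2, Finset.sum_mul, ← Finset.sum_add_distrib]
  unfold Matrix.mulVec dotProduct accelMatrix
  exact Finset.sum_congr rfl fun j _ => by ring

theorem geodesicResidual_add_smul {p : Fin 5 → ℝ} (hr : S.rm < p 1) (v x u w : Fin 5 → ℝ)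
    (t : ℝ) : S.geodesicResidual p v x (u + t • w)
      = S.geodesicResidual p v x u + t * S.geodesicResidual p v x w := by
  have hd (w : Fin 5 → ℝ) : DifferentiableAt ℝ (fun q => S.metric q v w) p := by
    have := (S.contDiffAt_metric (n := 1) (x := (p, v, w)) hr)
    have h2 : ContDiffAt ℝ 1 (fun q : Fin 5 → ℝ => (q, v, w)) p := by fun_prop
    exact (this.comp p h2).differentiableAt one_ne_zero
  unfold geodesicResidual
  simp only [metric_add_smul_right]
  rw [fderiv_fun_add (hd u) ((hd w).const_mul t), fderiv_const_mul (hd w)]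
  simp
  ring

theorem geodesicResidual_sum {p : Fin 5 → ℝ} (hr : S.rm < p 1) (v x w : Fin 5 → ℝ) :
    S.geodesicResidual p v x (tangentPart p w)
      = ∑ i, w i * S.geodesicResidual p v x (tangentPart p (Pi.single i 1)) := by
  have h0 : S.geodesicResidual p v x 0 = 0 := by
    have := S.geodesicResidual_add_smul hr v x 0 0 1
    simp at this
    exact this
  let f : (Fin 5 → ℝ) →ₗ[ℝ] ℝ :=
    { toFun := S.geodesicResidual p v x
      map_add' := fun u w => by simpa using S.geodesicResidual_add_smul hr v x u w 1
      map_smul' := fun t w => by simpa [h0] using S.geodesicResidual_add_smul hr v x 0 w t }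
  have hT : tangentPart p w = ∑ i, w i • tangentPart p (Pi.single i 1) := by
    funext j
    simp only [Finset.sum_apply, Pi.smul_apply, smul_eq_mul, tangentPart_apply]
    fin_cases j <;>
      simp [sphereDot, sphereNormal, Fin.sum_univ_five, Pi.single_apply] <;> ring
  change f (tangentPart p w) = ∑ i, w i * f (tangentPart p (Pi.single i 1))
  rw [hT, map_sum]
  simp

theorem geodesicResidual_zero (p v x w : Fin 5 → ℝ) :
    S.geodesicResidual p v x w = S.metric p x w + S.geodesicResidual p v 0 w := by
  have : S.metric p 0 w = 0 := by simp [metric, sigma, alpha]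
  unfold geodesicResidual
  rw [this]
  ring

/-- The normal is annihilated at points off the unit sphere as well. -/
theorem tangentPart_sphereNormal (p : Fin 5 → ℝ) : tangentPart p (sphereNormal p) = 0 := by
  simp [tangentPart, sphereDot, sphereNormal]

theorem tangentPart_of_isTangent {p w : Fin 5 → ℝ} (hp : sphereDot p p = 1)
    (hw : IsTangent p w) : tangentPart p w = w := by
  have : sphereDot p w = 0 := hw
  simp [tangentPart, hp, this]

theorem isTangent_tangentPart (p w : Fin 5 → ℝ) : IsTangent p (tangentPart p w) := by
  simp [IsTangent, tangentPart, sphereNormal, sphereDot]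
  ring

theorem sphereDot_self_of_mem {p : Fin 5 → ℝ} (hp : p ∈ S.spacetime) : sphereDot p p = 1 := by
  rw [← hp.2, sphereDot]; ring

/-- The solutions `x` of the linear system are the accelerations that satisfy the geodesic equation
and keep the curve on the sphere. -/
theorem accelMatrix_mulVec_eq_iff {p : Fin 5 → ℝ} (hr : S.rm < p 1) (hn : sphereDot p p ≠ 0)
    (v x : Fin 5 → ℝ) : (S.accelMatrix p).mulVec x = S.accelRhs p v ↔
      (∀ w, S.geodesicResidual p v x (tangentPart p w) = 0) ∧ sphereDot p x = -sphereSq v := by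
  have key (i : Fin 5) : (S.accelMatrix p).mulVec x i = S.accelRhs p v i ↔
      S.geodesicResidual p v x (tangentPart p (Pi.single i 1))
        = -(sphereDot p x + sphereSq v) * sphereDot p (Pi.single i 1) := by
    rw [S.accelMatrix_mulVec, S.geodesicResidual_zero p v x]
    unfold accelRhs
    constructor <;> intro h <;> linear_combination h
  constructor
  · intro h
    have h1 (w : Fin 5 → ℝ) : S.geodesicResidual p v x (tangentPart p w)
        = -(sphereDot p x + sphereSq v) * sphereDot p w := by
      have h2 : sphereDot p w = ∑ i, w i * sphereDot p (Pi.single i 1) := by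
        simp [sphereDot, Fin.sum_univ_five, Pi.single_apply]
        ring
      rw [S.geodesicResidual_sum hr, h2, Finset.mul_sum]
      refine Finset.sum_congr rfl fun i _ => ?_
      rw [(key i).1 (congrFun h i)]
      ring
    have h3 : sphereDot p x + sphereSq v = 0 := by
      have h4 := h1 (sphereNormal p)
      rw [tangentPart_sphereNormal, S.geodesicResidual_zero] at h4
      have h5 : S.geodesicResidual p v 0 0 = 0 := by
        have := S.geodesicResidual_add_smul hr v 0 0 0 1
        simp at this
        exact this
      have h6 : S.metric p x 0 = 0 := by simp [metric, sigma, alpha]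
      have h7 : sphereDot p (sphereNormal p) = sphereDot p p := by
        simp [sphereDot, sphereNormal]
      rw [h5, h6, h7] at h4
      have h8 : (sphereDot p x + sphereSq v) * sphereDot p p = 0 := by linarith
      simpa [hn] using h8
    refine ⟨fun w => ?_, by linarith⟩
    rw [h1 w, h3]; simp
  · rintro ⟨h1, h2⟩
    funext i
    rw [key, h1, h2]; simp

/-- The metric is nondegenerate on tangent vectors. -/
theorem eq_zero_of_metric_eq_zero {p x : Fin 5 → ℝ} (hp : p ∈ S.spacetime) (hx : IsTangent p x)
    (h : ∀ w, IsTangent p w → S.metric p x w = 0) : x = 0 := by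
  have hX := S.chi_pos.ne'
  have hT := (S.deltaTheta_pos (p 4)).ne'
  have hρ := (rhoSq_pos (a := a) (S.rm_pos.trans hp.1) (p 4)).ne'
  have h1 := h dr (isTangent_dr p)
  have h2 := h dt (isTangent_dt p)
  have h3 := h (dphi p) (isTangent_dphi p)
  -- the fields `∂_r`, `∂_t`, `∂_φ` do not span the tangent space: `x` itself serves as test vector
  have h4 := h x hx
  obtain ⟨m1, m2⟩ := S.momentum_identities hp x
  rw [S.metric_dr] at h1
  rw [h2, h3] at m1 m2
  have hW := S.deltaR_mul_radialW hp.1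
  have hA : S.alpha p x = 0 := by
    have e0 : deltaR lam a (p 1) * S.alpha p x - S.slope (p 1) * S.radialVel p x * chi lam a
        = 0 := by
      have : deltaR lam a (p 1) * S.alpha p x - S.slope (p 1) * S.radialVel p x * chi lam a
          = -chi lam a ^ 2 * (-deltaR lam a (p 1) * S.alpha p x / chi lam a ^ 2
            + S.slope (p 1) * S.radialVel p x / chi lam a) := by
        field_simp; ring
      rw [this, ← m1]; ring
    have e1 : S.slope (p 1) * S.alpha p x + S.radialW (p 1) * S.radialVel p x * chi lam a
        = 0 := by
      have : S.slope (p 1) * S.alpha p x + S.radialW (p 1) * S.radialVel p x * chi lam a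
          = chi lam a * (S.slope (p 1) / chi lam a * S.alpha p x
            + S.radialW (p 1) * S.radialVel p x) := by
        field_simp
      rw [this, h1]; ring
    linear_combination S.radialW (p 1) * e0 + S.slope (p 1) * e1 - S.alpha p x * hW
  have hy : S.radialVel p x = 0 := by
    rw [hA] at m1 h1
    have e1 : S.slope (p 1) * S.radialVel p x = 0 := by
      have : S.slope (p 1) * S.radialVel p x = chi lam a * (-deltaR lam a (p 1) * 0 / chi lam a ^ 2
            + S.slope (p 1) * S.radialVel p x / chi lam a) := by
        field_simp; ring
      rw [this, ← m1]; ring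
    linear_combination deltaR lam a (p 1) * h1 + S.slope (p 1) * e1 - S.radialVel p x * hW
  have hb : S.azimuthal p x = 0 := by
    have : deltaTheta lam a (p 4) * S.azimuthal p x = 0 := by
      have : deltaTheta lam a (p 4) * S.azimuthal p x
          = -chi lam a ^ 2 * (-deltaTheta lam a (p 4) * S.azimuthal p x / chi lam a ^ 2) := by
        field_simp
      rw [this, ← m2]; ring
    simpa [hT] using this
  have hσ : sigma p x = 0 := by
    unfold azimuthal at hb
    rw [hA] at hb
    simpa [hρ] using hb
  have hx1 : x 1 = 0 := by
    unfold radialVel at hy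
    simpa [hρ] using hy
  have hx0 : x 0 = 0 := by
    unfold alpha at hA
    rw [hσ] at hA
    linarith
  have hN : sphereSq x = 0 := by
    have := S.rhoSq_mul_metric_self hp x
    rw [h4, hA, hb, hσ] at this
    unfold carter at this
    rw [hA, hy] at this
    simpa [hT, hρ] using this.symm
  unfold sphereSq at hN
  have e2 : x 2 = 0 := by nlinarith [sq_nonneg (x 2), sq_nonneg (x 3), sq_nonneg (x 4)]
  have e3 : x 3 = 0 := by nlinarith [sq_nonneg (x 2), sq_nonneg (x 3), sq_nonneg (x 4)]
  have e4 : x 4 = 0 := by nlinarith [sq_nonneg (x 2), sq_nonneg (x 3), sq_nonneg (x 4)]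
  funext i
  fin_cases i
  exacts [hx0, hx1, e2, e3, e4]

theorem det_accelMatrix_ne_zero {p : Fin 5 → ℝ} (hp : p ∈ S.spacetime) :
    (S.accelMatrix p).det ≠ 0 := by
  intro h0
  obtain ⟨x, hx, hM⟩ := Matrix.exists_mulVec_eq_zero_iff.2 h0
  refine hx ?_
  have hn := S.sphereDot_self_of_mem hp
  have h1 (w : Fin 5 → ℝ) : S.metric p x (tangentPart p w) + sphereDot p x * sphereDot p w = 0 := by
    have e : S.metric p x (tangentPart p w) + sphereDot p x * sphereDot p w
        = ∑ i, w i * (S.accelMatrix p).mulVec x i := by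
      simp only [S.accelMatrix_mulVec]
      simp [metric, sigma, alpha, Fin.sum_univ_five, Pi.single_apply, tangentPart, sphereDot,
        sphereNormal]
      ring
    rw [e, hM]
    simp
  have h2 : sphereDot p x = 0 := by
    have := h1 (sphereNormal p)
    rw [tangentPart_sphereNormal, show S.metric p x 0 = 0 by simp [metric, sigma, alpha],
      show sphereDot p (sphereNormal p) = sphereDot p p by simp [sphereDot, sphereNormal], hn]
      at this
    linarith
  refine S.eq_zero_of_metric_eq_zero hp h2 fun w hw => ?_
  have := h1 w
  rw [tangentPart_of_isTangent hn hw, h2] at this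
  linarith

theorem contDiffAt_det {E : Type*} [NormedAddCommGroup E] [NormedSpace ℝ E] {n : WithTop ℕ∞}
    {M : E → Matrix (Fin 5) (Fin 5) ℝ} {x : E} (h : ∀ i j, ContDiffAt ℝ n (fun y => M y i j) x) :
    ContDiffAt ℝ n (fun y => (M y).det) x := by
  simp only [Matrix.det_apply]
  refine ContDiffAt.sum fun σ _ => ContDiffAt.const_smul _ ?_
  exact contDiffAt_prod fun i _ => h _ _

theorem contDiffAt_inv_mulVec {E : Type*} [NormedAddCommGroup E] [NormedSpace ℝ E]
    {n : WithTop ℕ∞} {M : E → Matrix (Fin 5) (Fin 5) ℝ} {b : E → Fin 5 → ℝ} {x : E}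
    (h : ∀ i j, ContDiffAt ℝ n (fun y => M y i j) x) (hb : ∀ i, ContDiffAt ℝ n (fun y => b y i) x)
    (h0 : (M x).det ≠ 0) : ContDiffAt ℝ n (fun y => (M y)⁻¹.mulVec (b y)) x := by
  rw [contDiffAt_pi]
  intro i
  simp only [Matrix.mulVec, dotProduct, Matrix.inv_def, Matrix.smul_apply, smul_eq_mul,
    Ring.inverse_eq_inv', Matrix.adjugate_apply]
  refine ContDiffAt.sum fun j _ => ContDiffAt.mul (ContDiffAt.mul ((contDiffAt_det h).inv h0) ?_)
    (hb j)
  refine contDiffAt_det fun k l => ?_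
  by_cases hk : k = j
  · subst hk
    simpa using contDiffAt_const
  · simpa [hk] using h k l

theorem contDiffAt_accelMatrix {n : WithTop ℕ∞} {p : Fin 5 → ℝ} (hr : S.rm < p 1) (i j : Fin 5) :
    ContDiffAt ℝ n (fun p => S.accelMatrix p i j) p := by
  unfold accelMatrix
  have h1 : ContDiffAt ℝ n (fun p : Fin 5 → ℝ => (p, (Pi.single j 1 : Fin 5 → ℝ),
      tangentPart p (Pi.single i 1))) p := by
    refine contDiffAt_id.prodMk (contDiffAt_const.prodMk ?_)
    rw [contDiffAt_pi]
    intro k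
    fin_cases k <;> simp [tangentPart, sphereDot, sphereNormal] <;> fun_prop
  have h2 := ContDiffAt.comp p (S.contDiffAt_metric (n := n) hr) h1
  refine h2.add ?_
  unfold sphereDot
  fun_prop

theorem contDiffAt_accelRhs {p v : Fin 5 → ℝ} (hr : S.rm < p 1) (i : Fin 5) :
    ContDiffAt ℝ 1 (fun x : (Fin 5 → ℝ) × (Fin 5 → ℝ) => S.accelRhs x.1 x.2 i) (p, v) := by
  have hT : ContDiffAt ℝ 2 (fun x : (Fin 5 → ℝ) × (Fin 5 → ℝ) =>
      tangentPart x.1 (Pi.single i 1)) (p, v) := by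
    rw [contDiffAt_pi]
    intro k
    fin_cases k <;> simp [tangentPart, sphereDot, sphereNormal] <;> fun_prop
  have hfst : ContDiffAt ℝ 1 (fun x : (Fin 5 → ℝ) × (Fin 5 → ℝ) => x.1) (p, v) := contDiffAt_fst
  have hsnd : ContDiffAt ℝ 1 (fun x : (Fin 5 → ℝ) × (Fin 5 → ℝ) => x.2) (p, v) := contDiffAt_snd
  have h1 : ContDiffAt ℝ 1 (fun x : (Fin 5 → ℝ) × (Fin 5 → ℝ) =>
      fderiv ℝ (fun q => S.metric q x.2 (tangentPart x.1 (Pi.single i 1))) x.1) (p, v) := by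
    refine ContDiffAt.fderiv (n := 2)
      (f := fun (x : (Fin 5 → ℝ) × (Fin 5 → ℝ)) q =>
        S.metric q x.2 (tangentPart x.1 (Pi.single i 1))) ?_ hfst (by norm_num)
    have h2 : ContDiffAt ℝ 2 (fun y : ((Fin 5 → ℝ) × (Fin 5 → ℝ)) × (Fin 5 → ℝ) =>
        (y.2, y.1.2, tangentPart y.1.1 (Pi.single i 1))) ((p, v), p) := by
      refine contDiffAt_snd.prodMk (contDiffAt_fst.snd.prodMk ?_)
      exact ContDiffAt.comp ((p, v), p) hT contDiffAt_fst
    exact ContDiffAt.comp ((p, v), p)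
      (S.contDiffAt_metric (n := 2) (x := (p, v, tangentPart p (Pi.single i 1))) hr) h2
  have h3 : ContDiffAt ℝ 1 (fun x : (Fin 5 → ℝ) × (Fin 5 → ℝ) =>
      fderiv ℝ (fun q => S.metric q x.2 x.2) x.1) (p, v) := by
    refine ContDiffAt.fderiv (n := 2)
      (f := fun (x : (Fin 5 → ℝ) × (Fin 5 → ℝ)) q => S.metric q x.2 x.2) ?_ hfst (by norm_num)
    have h2 : ContDiffAt ℝ 2 (fun y : ((Fin 5 → ℝ) × (Fin 5 → ℝ)) × (Fin 5 → ℝ) =>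
        (y.2, y.1.2, y.1.2)) ((p, v), p) := by
      fun_prop
    exact ContDiffAt.comp ((p, v), p) (S.contDiffAt_metric (n := 2) (x := (p, v, v)) hr) h2
  have hz (p w : Fin 5 → ℝ) : S.metric p 0 w = 0 := by simp [metric, sigma, alpha]
  unfold accelRhs geodesicResidual
  simp only [hz, zero_add]
  have h4 := h1.clm_apply hsnd
  have h5 := h3.clm_apply (hT.of_le (by norm_num))
  refine ContDiffAt.sub (ContDiffAt.neg (h4.sub (contDiffAt_const.mul h5))) ?_
  unfold sphereDot sphereSq
  fun_prop

/-- The geodesic vector field on phase space is continuously differentiable. -/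
theorem contDiffAt_accel {p v : Fin 5 → ℝ} (hp : p ∈ S.spacetime) :
    ContDiffAt ℝ 1 (fun x : (Fin 5 → ℝ) × (Fin 5 → ℝ) => S.accel x.1 x.2) (p, v) := by
  unfold accel
  refine contDiffAt_inv_mulVec (M := fun x : (Fin 5 → ℝ) × (Fin 5 → ℝ) => S.accelMatrix x.1)
    (fun i j => ?_) (fun i => S.contDiffAt_accelRhs hp.1 i) (S.det_accelMatrix_ne_zero hp)
  exact ContDiffAt.comp (p, v) (S.contDiffAt_accelMatrix hp.1 i j) contDiffAt_fst

theorem accelMatrix_mulVec_accel {p : Fin 5 → ℝ} (h : (S.accelMatrix p).det ≠ 0)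
    (v : Fin 5 → ℝ) : (S.accelMatrix p).mulVec (S.accel p v) = S.accelRhs p v := by
  unfold accel
  rw [Matrix.mulVec_mulVec, Matrix.mul_nonsing_inv _ (isUnit_iff_ne_zero.2 h), Matrix.one_mulVec]

variable {S} in
/-- A geodesic satisfies the second order equation `γ'' = accel γ γ'`. -/
theorem IsGeodesic.deriv_deriv_eq {γ : ℝ → Fin 5 → ℝ} {J : Set ℝ} (h : S.IsGeodesic γ J) {τ : ℝ}
    (hτ : τ ∈ J) : deriv (deriv γ) τ = S.accel (γ τ) (deriv γ τ) := by
  have hp := h.2.2.2.2.1 τ hτ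
  have hn := S.sphereDot_self_of_mem hp
  have hdet := S.det_accelMatrix_ne_zero hp
  have hd := hasDerivAt_pi.1 (h.hasDerivAt hτ).1
  have hdd := hasDerivAt_pi.1 (h.hasDerivAt hτ).2
  have hacc : sphereDot (γ τ) (deriv (deriv γ) τ) = -sphereSq (deriv γ τ) := by
    have h1 := (((hd 2).fun_mul (hdd 2)).fun_add ((hd 3).fun_mul (hdd 3))).fun_add
      ((hd 4).fun_mul (hdd 4))
    have h2 : (fun τ => γ τ 2 * deriv γ τ 2 + γ τ 3 * deriv γ τ 3 + γ τ 4 * deriv γ τ 4)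
        =ᶠ[𝓝 τ] fun _ => 0 := by
      filter_upwards [h.1.mem_nhds hτ] with x hx using h.isTangent hx
    have h3 := (h1.congr_of_eventuallyEq h2.symm).unique (hasDerivAt_const τ (0 : ℝ))
    unfold sphereDot sphereSq
    linarith
  have hM : (S.accelMatrix (γ τ)).mulVec (deriv (deriv γ) τ) = S.accelRhs (γ τ) (deriv γ τ) :=
    (S.accelMatrix_mulVec_eq_iff hp.1 (by rw [hn]; exact one_ne_zero) _ _).2
      ⟨fun w => h.2.2.2.2.2 τ hτ _ (isTangent_tangentPart _ _), hacc⟩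
  have := congrArg ((S.accelMatrix (γ τ))⁻¹.mulVec) hM
  rwa [Matrix.mulVec_mulVec, Matrix.nonsing_inv_mul _ (isUnit_iff_ne_zero.2 hdet),
    Matrix.one_mulVec] at this

end

section

/-! ### Extending geodesics to the past -/

/-- Local existence: through every tangent vector there is a solution of the geodesic equation that
stays on the spacetime. -/
theorem exists_local_geodesic {p v : Fin 5 → ℝ} (hp : p ∈ S.spacetime) (hv : IsTangent p v)
    (T : ℝ) : ∃ δ : ℝ → (Fin 5 → ℝ) × (Fin 5 → ℝ), δ T = (p, v) ∧ ∃ ε > 0,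
      ∀ t ∈ Set.Ioo (T - ε) (T + ε), HasDerivAt δ ((δ t).2, S.accel (δ t).1 (δ t).2) t ∧
        (δ t).1 ∈ S.spacetime := by
  have hX : ContDiffAt ℝ 1 (fun x : (Fin 5 → ℝ) × (Fin 5 → ℝ) => (x.2, S.accel x.1 x.2)) (p, v) :=
    contDiffAt_snd.prodMk (S.contDiffAt_accel hp)
  obtain ⟨δ, h0, ε, hε, hδ⟩ :=
    hX.exists_forall_mem_closedBall_exists_eq_forall_mem_Ioo_hasDerivAt₀ T
  have hc : ContinuousAt δ T := (hδ T ⟨by linarith, by linarith⟩).continuousAt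
  have hdet : ContinuousAt (fun q => (S.accelMatrix q).det) p :=
    (contDiffAt_det (n := 0) fun i j => S.contDiffAt_accelMatrix hp.1 i j).continuousAt
  have hn := S.sphereDot_self_of_mem hp
  have hsd : Continuous fun q : Fin 5 → ℝ => sphereDot q q := by unfold sphereDot; fun_prop
  have hU : ∀ᶠ q in 𝓝 p, S.rm < q 1 ∧ (S.accelMatrix q).det ≠ 0 ∧ sphereDot q q ≠ 0 := by
    refine ((continuous_apply 1).continuousAt.eventually (lt_mem_nhds hp.1)).and
      ((hdet.eventually_ne (S.det_accelMatrix_ne_zero hp)).and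
        (hsd.continuousAt.eventually_ne (by rw [hn]; exact one_ne_zero)))
  have hU2 : ∀ᶠ t in 𝓝 T, S.rm < (δ t).1 1 ∧ (S.accelMatrix (δ t).1).det ≠ 0
      ∧ sphereDot (δ t).1 (δ t).1 ≠ 0 := by
    have : Tendsto (fun t => (δ t).1) (𝓝 T) (𝓝 p) := by
      have := (continuous_fst.continuousAt (x := δ T)).tendsto.comp hc.tendsto
      rwa [h0] at this
    exact this.eventually hU
  obtain ⟨η, hη, hball⟩ := Metric.eventually_nhds_iff.1 hU2
  refine ⟨δ, h0, min ε η, lt_min hε hη, ?_⟩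
  have hsub : ∀ t ∈ Set.Ioo (T - min ε η) (T + min ε η),
      HasDerivAt δ ((δ t).2, S.accel (δ t).1 (δ t).2) t ∧ (S.rm < (δ t).1 1 ∧
        (S.accelMatrix (δ t).1).det ≠ 0 ∧ sphereDot (δ t).1 (δ t).1 ≠ 0) := by
    intro t ht
    have h1 := min_le_left ε η
    have h2 := min_le_right ε η
    refine ⟨hδ t ⟨by linarith [ht.1], by linarith [ht.2]⟩, hball ?_⟩
    rw [Real.dist_eq, abs_lt]
    constructor <;> linarith [ht.1, ht.2]
  have hT : T ∈ Set.Ioo (T - min ε η) (T + min ε η) := by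
    have : 0 < min ε η := lt_min hε hη
    constructor <;> linarith
  -- the normal component of the velocity vanishes identically
  have hd1 (t) (ht : t ∈ Set.Ioo (T - min ε η) (T + min ε η)) (i) :
      HasDerivAt (fun t => (δ t).1 i) ((δ t).2 i) t :=
    hasDerivAt_pi.1 (hasFDerivAt_fst.comp_hasDerivAt t (hsub t ht).1) i
  have hd2 (t) (ht : t ∈ Set.Ioo (T - min ε η) (T + min ε η)) (i) :
      HasDerivAt (fun t => (δ t).2 i) (S.accel (δ t).1 (δ t).2 i) t :=
    hasDerivAt_pi.1 (hasFDerivAt_snd.comp_hasDerivAt t (hsub t ht).1) i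
  obtain ⟨c, hc1⟩ := exists_eq_const_of_hasDerivAt_zero isOpen_Ioo Set.ordConnected_Ioo
    (f := fun t => sphereDot (δ t).1 (δ t).2) (fun t ht => by
      obtain ⟨-, h1, h2, h3⟩ := hsub t ht
      have hM := ((S.accelMatrix_mulVec_eq_iff h1 h3 _ _).1
        (S.accelMatrix_mulVec_accel h2 (δ t).2)).2
      refine ((((hd1 t ht 2).fun_mul (hd2 t ht 2)).fun_add ((hd1 t ht 3).fun_mul
        (hd2 t ht 3))).fun_add ((hd1 t ht 4).fun_mul (hd2 t ht 4))).congr_deriv ?_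
      unfold sphereDot sphereSq at hM
      linarith)
  have hc0 : c = 0 := by
    rw [← hc1 T hT, h0]; exact hv
  subst hc0
  obtain ⟨c, hc2⟩ := exists_eq_const_of_hasDerivAt_zero isOpen_Ioo Set.ordConnected_Ioo
    (f := fun t => sphereDot (δ t).1 (δ t).1) (fun t ht => by
      refine ((((hd1 t ht 2).fun_mul (hd1 t ht 2)).fun_add ((hd1 t ht 3).fun_mul
        (hd1 t ht 3))).fun_add ((hd1 t ht 4).fun_mul (hd1 t ht 4))).congr_deriv ?_
      have := hc1 t ht
      unfold sphereDot at this
      linarith)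
  have hc1' : c = 1 := by
    rw [← hc2 T hT, h0]; exact hn
  subst hc1'
  intro t ht
  refine ⟨(hsub t ht).1, (hsub t ht).2.1, ?_⟩
  rw [← hc2 t ht, sphereDot]; ring

/-- A curve in phase space that solves the geodesic equation projects to a geodesic. -/
theorem isGeodesic_of_phase {c : ℝ → (Fin 5 → ℝ) × (Fin 5 → ℝ)} {J : Set ℝ} (hJ : IsOpen J)
    (hJc : J.OrdConnected) (hne : J.Nonempty)
    (hc : ∀ t ∈ J, HasDerivAt c ((c t).2, S.accel (c t).1 (c t).2) t)
    (hm : ∀ t ∈ J, (c t).1 ∈ S.spacetime) : S.IsGeodesic (fun t => (c t).1) J := by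
  have hd1 (t) (ht : t ∈ J) : HasDerivAt (fun t => (c t).1) (c t).2 t :=
    (hasFDerivAt_fst (𝕜 := ℝ) (p := c t)).comp_hasDerivAt t (hc t ht)
  have hd2 (t) (ht : t ∈ J) : HasDerivAt (fun t => (c t).2) (S.accel (c t).1 (c t).2) t :=
    (hasFDerivAt_snd (𝕜 := ℝ) (p := c t)).comp_hasDerivAt t (hc t ht)
  have hderiv : ∀ t ∈ J, deriv (fun t => (c t).1) =ᶠ[𝓝 t] fun t => (c t).2 := by
    intro t ht
    filter_upwards [hJ.mem_nhds ht] with s hs using (hd1 s hs).deriv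
  have hdd (t) (ht : t ∈ J) : deriv (deriv fun t => (c t).1) t = S.accel (c t).1 (c t).2 := by
    rw [(hderiv t ht).deriv_eq, (hd2 t ht).deriv]
  refine ⟨hJ, hJc, hne, ?_, hm, ?_⟩
  · have h1 : ContDiffOn ℝ 1 (fun t => (c t).2) J := by
      rw [show (1 : WithTop ℕ∞) = 0 + 1 by norm_num, contDiffOn_succ_iff_deriv_of_isOpen hJ]
      refine ⟨fun t ht => (hd2 t ht).differentiableAt.differentiableWithinAt, by simp, ?_⟩
      rw [contDiffOn_zero]
      refine ContinuousOn.congr (f := fun t => S.accel (c t).1 (c t).2) (fun t ht => ?_)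
        fun t ht => (hd2 t ht).deriv
      have : ContinuousAt (fun x : (Fin 5 → ℝ) × (Fin 5 → ℝ) => S.accel x.1 x.2) (c t) :=
        (S.contDiffAt_accel (v := (c t).2) (hm t ht)).continuousAt
      exact (ContinuousAt.comp (f := c) this (hc t ht).continuousAt).continuousWithinAt
    rw [show (2 : WithTop ℕ∞) = 1 + 1 by norm_num, contDiffOn_succ_iff_deriv_of_isOpen hJ]
    refine ⟨fun t ht => (hd1 t ht).differentiableAt.differentiableWithinAt, by simp, ?_⟩
    exact h1.congr fun t ht => (hderiv t ht).eq_of_nhds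
  · intro t ht w hw
    have hn := S.sphereDot_self_of_mem (hm t ht)
    have := ((S.accelMatrix_mulVec_eq_iff (hm t ht).1 (by rw [hn]; exact one_ne_zero) _ _).1
      (S.accelMatrix_mulVec_accel (S.det_accelMatrix_ne_zero (hm t ht)) (c t).2)).1 w
    rw [tangentPart_of_isTangent hn hw] at this
    rw [hdd t ht, (hd1 t ht).deriv]
    exact this

variable {S} in
/-- A geodesic whose position and velocity converge at the lower end of its interval, with limit in
the spacetime, is extendible. -/
theorem IsGeodesic.not_isInextendible_of_tendsto {γ : ℝ → Fin 5 → ℝ} {J : Set ℝ}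
    (h : S.IsGeodesic γ J) {T b : ℝ} (hJT : J ⊆ Set.Ioi T) (hb : T < b) (hJb : Set.Ioo T b ⊆ J)
    {p v : Fin 5 → ℝ} (hγ : Tendsto γ (𝓝[>] T) (𝓝 p))
    (hγ' : Tendsto (deriv γ) (𝓝[>] T) (𝓝 v)) (hr : S.rm < p 1) : ¬ S.IsInextendible γ J := by
  intro hin
  have hev : ∀ᶠ t in 𝓝[>] T, t ∈ J := by
    filter_upwards [Ioo_mem_nhdsGT hb] with t ht using hJb ht
  have hcoord (i : Fin 5) : Tendsto (fun t => γ t i) (𝓝[>] T) (𝓝 (p i)) :=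
    (tendsto_pi_nhds.1 hγ) i
  have hcoord' (i : Fin 5) : Tendsto (fun t => deriv γ t i) (𝓝[>] T) (𝓝 (v i)) :=
    (tendsto_pi_nhds.1 hγ') i
  have hp : p ∈ S.spacetime := by
    refine ⟨hr, ?_⟩
    refine tendsto_nhds_unique ((((hcoord 2).pow 2).add ((hcoord 3).pow 2)).add
      ((hcoord 4).pow 2)) ?_
    exact tendsto_const_nhds.congr' (by
      filter_upwards [hev] with t ht using (h.2.2.2.2.1 t ht).2.symm)
  have hv : IsTangent p v := by
    refine tendsto_nhds_unique ((((hcoord 2).mul (hcoord' 2)).add ((hcoord 3).mul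
      (hcoord' 3))).add ((hcoord 4).mul (hcoord' 4))) ?_
    exact tendsto_const_nhds.congr' (by
      filter_upwards [hev] with t ht using (h.isTangent ht).symm)
  obtain ⟨δ, h0, ε, hε, hδ⟩ := S.exists_local_geodesic hp hv T
  let c : ℝ → (Fin 5 → ℝ) × (Fin 5 → ℝ) := fun t => if t ≤ T then δ t else (γ t, deriv γ t)
  have hcT : c T = (p, v) := by simp [c, h0]
  have hcJ : ∀ t ∈ J, c t = (γ t, deriv γ t) := fun t ht => if_neg (not_le.2 (hJT ht))
  have hJd : ∀ t ∈ J, HasDerivAt c ((c t).2, S.accel (c t).1 (c t).2) t := by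
    intro t ht
    have h1 := (h.hasDerivAt ht).1.prodMk (h.hasDerivAt ht).2
    rw [hcJ t ht]
    refine (h1.congr_deriv (by rw [h.deriv_deriv_eq ht])).congr_of_eventuallyEq ?_
    filter_upwards [h.1.mem_nhds ht] with s hs using hcJ s hs
  have hcont : ContinuousAt (fun x : (Fin 5 → ℝ) × (Fin 5 → ℝ) => (x.2, S.accel x.1 x.2)) (p, v) :=
    continuousAt_snd.prodMk (S.contDiffAt_accel hp).continuousAt
  have hcright : Tendsto c (𝓝[>] T) (𝓝 (p, v)) := by
    refine (hγ.prodMk_nhds hγ').congr' ?_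
    filter_upwards [hev] with t ht using (hcJ t ht).symm
  have hTd : HasDerivAt c ((c T).2, S.accel (c T).1 (c T).2) T := by
    have hl : HasDerivWithinAt c ((c T).2, S.accel (c T).1 (c T).2) (Set.Iic T) T := by
      have := (hδ T ⟨by linarith, by linarith⟩).1.hasDerivWithinAt (s := Set.Iic T)
      rw [h0] at this
      rw [hcT]
      refine this.congr (fun t ht => if_pos ht) (if_pos le_rfl)
    have hrt : HasDerivWithinAt c ((c T).2, S.accel (c T).1 (c T).2) (Set.Ici T) T := by
      refine hasDerivWithinAt_Ici_of_tendsto_deriv (s := Set.Ioo T b)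
        (fun t ht => (hJd t (hJb ht)).differentiableAt.differentiableWithinAt) ?_
        (Ioo_mem_nhdsGT hb) ?_
      · unfold ContinuousWithinAt
        rw [hcT]
        exact hcright.mono_left (nhdsWithin_mono _ Set.Ioo_subset_Ioi_self)
      · rw [hcT]
        refine (hcont.tendsto.comp hcright).congr' ?_
        filter_upwards [hev] with t ht using ((hJd t ht).deriv).symm
    have := hl.union hrt
    rwa [Set.Iic_union_Ici, hasDerivWithinAt_univ] at this
  have hJ' : S.IsGeodesic (fun t => (c t).1) (Set.Ioo (T - ε) b ∪ J) := by
    have hcase : ∀ t ∈ Set.Ioo (T - ε) b ∪ J, (t ∈ Set.Ioo (T - ε) T ∨ t = T) ∨ t ∈ J := by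
      rintro t (ht | ht)
      · rcases lt_trichotomy t T with h1 | h1 | h1
        · exact Or.inl (Or.inl ⟨ht.1, h1⟩)
        · exact Or.inl (Or.inr h1)
        · exact Or.inr (hJb ⟨h1, ht.2⟩)
      · exact Or.inr ht
    refine S.isGeodesic_of_phase (isOpen_Ioo.union h.1) ?_ (h.2.2.1.mono Set.subset_union_right)
      (fun t ht => ?_) fun t ht => ?_
    · refine (isPreconnected_Ioo.union' ?_ h.2.1.isPreconnected).ordConnected
      have hm : (T + b) / 2 ∈ Set.Ioo T b := ⟨by linarith, by linarith⟩
      exact ⟨(T + b) / 2, ⟨by linarith [hm.1], hm.2⟩, hJb hm⟩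
    · rcases hcase t ht with (h1 | rfl) | h1
      · have hct : c t = δ t := if_pos h1.2.le
        rw [hct]
        refine (hδ t ⟨h1.1, by linarith [h1.2]⟩).1.congr_of_eventuallyEq ?_
        filter_upwards [Iio_mem_nhds h1.2] with s hs using if_pos (le_of_lt hs)
      · exact hTd
      · exact hJd t h1
    · rcases hcase t ht with (h1 | rfl) | h1
      · have hct : c t = δ t := if_pos h1.2.le
        rw [hct]
        exact (hδ t ⟨h1.1, by linarith [h1.2]⟩).2
      · rw [hcT]; exact hp
      · rw [hcJ t h1]; exact h.2.2.2.2.1 t h1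
  have := hin _ _ hJ' Set.subset_union_right fun t ht => by simp [hcJ t ht]
  have hTJ : T ∈ J := by
    rw [← this]
    exact Or.inl ⟨by linarith, hb⟩
  exact lt_irrefl T (hJT hTJ)

end

section

/-! ### Functions near the lower end of an interval -/

/-- The filter of neighbourhoods, within `J`, of the lower end (finite or not) of `J`. -/
def pastEnd (J : Set ℝ) : Filter ℝ := map (Subtype.val : J → ℝ) atBot

theorem eventually_pastEnd {J : Set ℝ} (hJ : J.Nonempty) {P : ℝ → Prop} :
    (∀ᶠ τ in pastEnd J, P τ) ↔ ∃ τ₁ ∈ J, ∀ τ ∈ J, τ ≤ τ₁ → P τ := by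
  have := hJ.to_subtype
  unfold pastEnd
  rw [eventually_map, eventually_atBot]
  constructor
  · rintro ⟨τ₁, h⟩
    exact ⟨τ₁, τ₁.2, fun τ hτ hle => h ⟨τ, hτ⟩ hle⟩
  · rintro ⟨τ₁, h1, h⟩
    exact ⟨⟨τ₁, h1⟩, fun τ hle => h τ τ.2 hle⟩

theorem pastEnd_neBot {J : Set ℝ} (hJ : J.Nonempty) : (pastEnd J).NeBot := by
  have := hJ.to_subtype
  unfold pastEnd
  infer_instance

theorem eventually_mem_pastEnd (J : Set ℝ) : ∀ᶠ τ in pastEnd J, τ ∈ J := by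
  unfold pastEnd
  rw [eventually_map]
  exact Eventually.of_forall fun τ => τ.2

theorem eventually_le_pastEnd {J : Set ℝ} {τ₀ : ℝ} (h : τ₀ ∈ J) :
    ∀ᶠ τ in pastEnd J, τ ≤ τ₀ :=
  (eventually_pastEnd ⟨τ₀, h⟩).2 ⟨τ₀, h, fun _ _ h => h⟩

/-- The lower end of an open interval that is bounded below. -/
theorem pastEnd_of_bddBelow {J : Set ℝ} (ho : IsOpen J) (hc : J.OrdConnected) (hne : J.Nonempty)
    (hb : BddBelow J) : ∃ T, pastEnd J = 𝓝[>] T ∧ J ⊆ Set.Ioi T ∧ ∃ b > T, Set.Ioo T b ⊆ J := by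
  obtain ⟨b, hbJ⟩ := hne
  have h1 : J ⊆ Set.Ioi (sInf J) := by
    intro τ hτ
    obtain ⟨ε, hε, hball⟩ := Metric.isOpen_iff.1 ho τ hτ
    have : τ - ε / 2 ∈ J := hball (by
      rw [Metric.mem_ball, Real.dist_eq, abs_lt]
      constructor <;> linarith)
    have := csInf_le hb this
    simp only [Set.mem_Ioi]
    linarith
  have h2 : ∀ b' > sInf J, ∃ b > sInf J, Set.Ioo (sInf J) b ⊆ J := by
    intro _ _
    refine ⟨b, h1 hbJ, fun t ht => ?_⟩
    obtain ⟨s, hs, hst⟩ := exists_lt_of_csInf_lt ⟨b, hbJ⟩ ht.1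
    exact hc.out hs hbJ ⟨hst.le, ht.2.le⟩
  refine ⟨sInf J, map_coe_atBot_of_Ioo_subset h1 h2, h1, h2 (sInf J + 1) (by simp)⟩

/-- A function bounded below whose derivative is bounded below by a positive constant exists for a
finite time only. -/
theorem bddBelow_of_drift {J : Set ℝ} (hc : J.OrdConnected) (hne : J.Nonempty) {f f' : ℝ → ℝ}
    {c B : ℝ} (hcpos : 0 < c) (hf : ∀ᶠ τ in pastEnd J, HasDerivAt f (f' τ) τ)
    (hf' : ∀ᶠ τ in pastEnd J, c ≤ f' τ) (hB : ∀ᶠ τ in pastEnd J, B ≤ f τ) : BddBelow J := by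
  obtain ⟨τ₁, h1, h⟩ := (eventually_pastEnd hne).1 (hf.and (hf'.and hB))
  refine ⟨τ₁ - (f τ₁ - B) / c, fun τ hτ => ?_⟩
  have hB1 := (h τ₁ h1 le_rfl).2.2
  rcases le_total τ₁ τ with hle | hle
  · have : 0 ≤ (f τ₁ - B) / c := div_nonneg (by linarith) hcpos.le
    linarith
  · have hsub : Set.Icc τ τ₁ ⊆ J := hc.out hτ h1
    have := (convex_Icc τ τ₁).mul_sub_le_image_sub_of_le_deriv (f := f) (C := c)
      (fun s hs => (h s (hsub hs) hs.2).1.continuousAt.continuousWithinAt)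
      (fun s hs => (h s (hsub (interior_subset hs))
        (interior_subset hs).2).1.differentiableAt.differentiableWithinAt)
      (fun s hs => by
        have := h s (hsub (interior_subset hs)) (interior_subset hs).2
        rw [this.1.deriv]; exact this.2.1) τ (Set.left_mem_Icc.2 hle) τ₁
      (Set.right_mem_Icc.2 hle) hle
    have hBτ := (h τ hτ hle).2.2
    have : τ₁ - τ ≤ (f τ₁ - B) / c := by
      rw [le_div_iff₀ hcpos]
      linarith
    linarith

/-- A function with bounded derivative converges at a finite end. -/
theorem exists_tendsto_of_bounded_deriv {E : Type*} [NormedAddCommGroup E] [NormedSpace ℝ E]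
    [CompleteSpace E] {J : Set ℝ} (ho : IsOpen J) (hc : J.OrdConnected) (hne : J.Nonempty)
    (hb : BddBelow J) {f f' : ℝ → E} {M : ℝ}
    (hf : ∀ᶠ τ in pastEnd J, HasDerivAt f (f' τ) τ) (hM : ∀ᶠ τ in pastEnd J, ‖f' τ‖ ≤ M) :
    ∃ l, Tendsto f (pastEnd J) (𝓝 l) := by
  obtain ⟨τ₁, h1, h⟩ := (eventually_pastEnd hne).1 (hf.and hM)
  obtain ⟨T, hT, -, -⟩ := pastEnd_of_bddBelow ho hc hne hb
  have hL : LipschitzOnWith M.toNNReal f (J ∩ Set.Iic τ₁) := by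
    refine Convex.lipschitzOnWith_of_nnnorm_hasDerivWithin_le (f' := f')
      ((hc.inter Set.ordConnected_Iic).convex)
      (fun s hs => (h s hs.1 hs.2).1.hasDerivWithinAt) fun s hs => ?_
    rw [← NNReal.coe_le_coe, coe_nnnorm]
    exact (h s hs.1 hs.2).2.trans (Real.le_coe_toNNReal M)
  have := pastEnd_neBot hne
  have hcau : Cauchy (pastEnd J) := cauchy_nhds.mono (hT.le.trans nhdsWithin_le_nhds)
  have hle : pastEnd J ≤ 𝓟 (J ∩ Set.Iic τ₁) :=
    le_principal_iff.2 ((eventually_mem_pastEnd J).and (eventually_le_pastEnd h1))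
  exact cauchy_map_iff_exists_tendsto.1 (hcau.map_of_le hL.uniformContinuousOn hle)

/-- A monotone bounded function converges at the lower end, to a lower bound. -/
theorem exists_tendsto_of_deriv_nonneg {J : Set ℝ} (hc : J.OrdConnected) {τ₁ : ℝ} (h1 : τ₁ ∈ J)
    {f f' : ℝ → ℝ} {B : ℝ} (hf : ∀ τ ∈ J, τ ≤ τ₁ → HasDerivAt f (f' τ) τ)
    (hf' : ∀ τ ∈ J, τ ≤ τ₁ → 0 ≤ f' τ) (hB : ∀ τ ∈ J, τ ≤ τ₁ → B ≤ f τ) :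
    ∃ l, Tendsto f (pastEnd J) (𝓝 l) ∧ B ≤ l ∧ ∀ τ ∈ J, τ ≤ τ₁ → l ≤ f τ := by
  have hmono : MonotoneOn f (J ∩ Set.Iic τ₁) := by
    refine monotoneOn_of_deriv_nonneg (hc.inter Set.ordConnected_Iic).convex
      (fun s hs => (hf s hs.1 hs.2).continuousAt.continuousWithinAt)
      (fun s hs => (hf s (interior_subset hs).1
        (interior_subset hs).2).differentiableAt.differentiableWithinAt) fun s hs => ?_
    rw [(hf s (interior_subset hs).1 (interior_subset hs).2).deriv]
    exact hf' s (interior_subset hs).1 (interior_subset hs).2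
  let g : J → ℝ := fun τ => f (min τ ⟨τ₁, h1⟩ : J)
  have hmem (τ : J) : ((min τ ⟨τ₁, h1⟩ : J) : ℝ) ∈ J ∩ Set.Iic τ₁ :=
    ⟨(min τ ⟨τ₁, h1⟩ : J).2, show (min τ ⟨τ₁, h1⟩ : J) ≤ ⟨τ₁, h1⟩ from min_le_right _ _⟩
  have hg : Monotone g := fun s t hst => hmono (hmem s) (hmem t) (min_le_min_right _ hst)
  have hgb : BddBelow (Set.range g) := by
    refine ⟨B, ?_⟩
    rintro _ ⟨τ, rfl⟩
    exact hB _ (hmem τ).1 (hmem τ).2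
  have : Nonempty J := ⟨⟨τ₁, h1⟩⟩
  refine ⟨⨅ τ, g τ, ?_, le_ciInf fun τ => hB _ (hmem τ).1 (hmem τ).2, fun τ hτ hle => ?_⟩
  · unfold pastEnd
    rw [tendsto_map'_iff]
    refine (tendsto_atBot_ciInf hg hgb).congr' ?_
    filter_upwards [eventually_le_atBot (⟨τ₁, h1⟩ : J)] with τ hτ
    simp [g, min_eq_left hτ]
  · refine (ciInf_le hgb ⟨τ, hτ⟩).trans_eq ?_
    simp only [g]
    rw [min_eq_left]
    exact hle

/-- If `f` is nonpositive at some time and decreases strictly whenever it vanishes, then it is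
negative at all later times. -/
theorem neg_of_deriv_neg_at_zeros {f f' : ℝ → ℝ} {s t : ℝ} (hst : s < t)
    (hf : ∀ τ ∈ Set.Icc s t, HasDerivAt f (f' τ) τ) (h0 : ∀ τ ∈ Set.Icc s t, f τ = 0 → f' τ < 0)
    (hs : f s ≤ 0) : f t < 0 := by
  have hle : ∀ ⦃x⦄, x ∈ Set.Icc s t → f x ≤ 0 :=
    image_le_of_deriv_right_lt_deriv_boundary (B := fun _ => 0) (B' := fun _ => 0)
      (fun x hx => (hf x hx).continuousAt.continuousWithinAt)
      (fun x hx => (hf x ⟨hx.1, hx.2.le⟩).hasDerivWithinAt) hs (fun x => hasDerivAt_const x 0)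
      fun x hx h => h0 x ⟨hx.1, hx.2.le⟩ h
  have ht : t ∈ Set.Icc s t := ⟨hst.le, le_rfl⟩
  refine lt_of_le_of_ne (hle ht) fun h => ?_
  have hneg := h0 t ht h
  have hev : ∀ᶠ x in 𝓝[<] t, 0 < f x := by
    have hsl := (hasDerivAt_iff_tendsto_slope.1 (hf t ht)).mono_left
      (nhdsWithin_mono t (fun x (hx : x < t) => (ne_of_lt hx : x ≠ t)))
    filter_upwards [hsl.eventually (gt_mem_nhds hneg), self_mem_nhdsWithin] with x hx hxt
    have hxt' : x < t := hxt
    rw [slope_def_field, h] at hx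
    have hd : x - t < 0 := by linarith
    by_contra hcon
    push Not at hcon
    exact absurd hx (not_lt.2 (div_nonneg_of_nonpos (by linarith) hd.le))
  obtain ⟨x, hx, hxm⟩ := (hev.and (Ioo_mem_nhdsLT hst)).exists
  exact absurd (hle ⟨hxm.1.le, hxm.2.le⟩) (not_le.2 hx)

variable {S} in
/-- A geodesic with bounded velocity that stays away from `r = rm` does not end at a finite
parameter value. -/
theorem IsGeodesic.not_isInextendible_of_bounded {γ : ℝ → Fin 5 → ℝ} {J : Set ℝ}
    (h : S.IsGeodesic γ J) (hb : BddBelow J) {M lo : ℝ} (hlo : S.rm < lo)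
    (hM : ∀ᶠ τ in pastEnd J, ‖deriv γ τ‖ ≤ M) (hr : ∀ᶠ τ in pastEnd J, lo ≤ γ τ 1) :
    ¬ S.IsInextendible γ J := by
  have hne := h.2.2.1
  have hJ := eventually_mem_pastEnd J
  have := pastEnd_neBot hne
  obtain ⟨p, hp⟩ := exists_tendsto_of_bounded_deriv h.1 h.2.1 hne hb
    (hJ.mono fun τ hτ => (h.hasDerivAt hτ).1) hM
  have hp1 : lo ≤ p 1 := ge_of_tendsto ((tendsto_pi_nhds.1 hp) 1) hr
  let C : Set ((Fin 5 → ℝ) × (Fin 5 → ℝ)) :=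
    (Metric.closedBall p 1 ∩ {q | lo ≤ q 1 ∧ q 2 ^ 2 + q 3 ^ 2 + q 4 ^ 2 = 1})
      ×ˢ Metric.closedBall 0 M
  have hC : IsCompact C := by
    refine IsCompact.prod ((isCompact_closedBall p 1).inter_right ?_) (isCompact_closedBall 0 M)
    refine IsClosed.inter ?_ ?_
    · exact isClosed_le continuous_const (continuous_apply 1)
    · exact isClosed_eq (by fun_prop) continuous_const
  have hcont : ContinuousOn (fun x : (Fin 5 → ℝ) × (Fin 5 → ℝ) => S.accel x.1 x.2) C :=
    fun x hx => (S.contDiffAt_accel (p := x.1) (v := x.2)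
      ⟨hlo.trans_le hx.1.2.1, hx.1.2.2⟩).continuousAt.continuousWithinAt
  obtain ⟨M', hM'⟩ := hC.exists_bound_of_continuousOn hcont
  obtain ⟨v, hv⟩ := exists_tendsto_of_bounded_deriv (f := deriv γ) (M := M') h.1 h.2.1 hne hb
    (hJ.mono fun τ hτ => (h.hasDerivAt hτ).2) (by
      filter_upwards [hJ, hM, hr, hp.eventually (Metric.closedBall_mem_nhds p one_pos)]
        with τ h1 h2 h3 h4
      rw [h.deriv_deriv_eq h1]
      exact hM' (γ τ, deriv γ τ) ⟨⟨h4, h3, (h.2.2.2.2.1 τ h1).2⟩, by simpa using h2⟩)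
  obtain ⟨T, hT, hJT, b, hTb, hbJ⟩ := pastEnd_of_bddBelow h.1 h.2.1 hne hb
  rw [hT] at hp hv
  exact h.not_isInextendible_of_tendsto hJT hTb hbJ hp hv (hlo.trans_le hp1)

end

section

/-! ### The two horizons -/

/-- `X` is the radius of the event horizon (`ε = 1`) or of the cosmological horizon (`ε = -1`).
Then `0 < ε (r - X)` on the side of the block `I`, the other horizon is at `rp + rc - X`, and the
coordinate slope is `ε` at `X`. -/
def IsHorizon (X ε : ℝ) : Prop := (X = S.rp ∧ ε = 1) ∨ (X = S.rc ∧ ε = -1)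

/-- The quotient of `Δ_r` by `ε (r - X)`. -/
def deltaQuot (X ε r : ℝ) : ℝ := lam * (ε * (S.rp + S.rc - X - r)) * ((r - S.rm) * (r - S.rn))

variable {S} {X ε : ℝ}

namespace IsHorizon

theorem sq_eq_one (h : S.IsHorizon X ε) : ε * ε = 1 := by
  rcases h with ⟨-, rfl⟩ | ⟨-, rfl⟩ <;> norm_num

theorem abs_eq_one (h : S.IsHorizon X ε) : |ε| = 1 := by
  rcases h with ⟨-, rfl⟩ | ⟨-, rfl⟩ <;> norm_num

theorem one_sub_slope (h : S.IsHorizon X ε) (r : ℝ) :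
    1 - ε * S.slope r = 2 / (S.rc - S.rp) * (ε * (r - X)) := by
  have h4 : S.rc - S.rp ≠ 0 := (sub_pos.2 S.rp_lt_rc).ne'
  rcases h with ⟨rfl, rfl⟩ | ⟨rfl, rfl⟩ <;> (unfold slope; field_simp; ring)

theorem slope_eq (h : S.IsHorizon X ε) : S.slope X = ε := by
  have h1 := h.one_sub_slope X
  have h2 := h.sq_eq_one
  linear_combination -ε * h1 - S.slope X * h2

theorem deltaR_eq (h : S.IsHorizon X ε) (r : ℝ) :
    deltaR lam a r = ε * (r - X) * S.deltaQuot X ε r := by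
  rw [S.deltaR_factor]
  unfold deltaQuot
  rcases h with ⟨rfl, rfl⟩ | ⟨rfl, rfl⟩ <;> ring

theorem deltaR_self (h : S.IsHorizon X ε) : deltaR lam a X = 0 := by
  rw [h.deltaR_eq]; ring

theorem deltaQuot_pos (_h : S.IsHorizon X ε) {r : ℝ} (hr : S.rm < r)
    (hY : ε * (r - (S.rp + S.rc - X)) < 0) : 0 < S.deltaQuot X ε r := by
  have h1 := S.rn_neg
  have h2 := S.rm_pos
  have h3 := S.lam_pos
  have h5 : 0 < r - S.rm := by linarith
  have h6 : 0 < r - S.rn := by linarith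
  have h7 : 0 < ε * (S.rp + S.rc - X - r) := by linarith
  unfold deltaQuot; positivity

theorem rm_lt (h : S.IsHorizon X ε) : S.rm < X := by
  have h1 := S.rm_lt_rp
  have h2 := S.rp_lt_rc
  rcases h with ⟨rfl, rfl⟩ | ⟨rfl, rfl⟩ <;> linarith

theorem pos (h : S.IsHorizon X ε) : 0 < X := S.rm_pos.trans h.rm_lt

theorem self_lt_other (h : S.IsHorizon X ε) : ε * (X - (S.rp + S.rc - X)) < 0 := by
  have h2 := S.rp_lt_rc
  rcases h with ⟨rfl, rfl⟩ | ⟨rfl, rfl⟩ <;> linarith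

theorem deltaQuot_self_pos (h : S.IsHorizon X ε) : 0 < S.deltaQuot X ε X :=
  h.deltaQuot_pos h.rm_lt h.self_lt_other

theorem continuous_deltaQuot : Continuous (S.deltaQuot X ε) := by
  unfold deltaQuot; fun_prop

theorem deltaRDeriv_self (h : S.IsHorizon X ε) :
    deltaRDeriv lam a X = ε * S.deltaQuot X ε X := by
  have h1 : HasDerivAt (fun r => ε * (r - X) * S.deltaQuot X ε r) (ε * S.deltaQuot X ε X) X := by
    have hd : DifferentiableAt ℝ (S.deltaQuot X ε) X := by unfold deltaQuot; fun_prop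
    refine ((((hasDerivAt_id' X).sub_const X).const_mul ε).fun_mul hd.hasDerivAt).congr_deriv ?_
    ring
  rw [show (fun r => ε * (r - X) * S.deltaQuot X ε r) = deltaR lam a from
    funext fun r => (h.deltaR_eq r).symm] at h1
  exact (hasDerivAt_deltaR lam a X).unique h1

theorem kappa_eq (h : S.IsHorizon X ε) :
    S.kappa X = S.deltaQuot X ε X / (2 * chi lam a * (X ^ 2 + a ^ 2)) := by
  unfold kappa
  rw [(hasDerivAt_deltaR lam a X).deriv, h.deltaRDeriv_self, abs_mul, h.abs_eq_one, one_mul,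
    abs_of_pos h.deltaQuot_self_pos]

theorem kappa_pos (h : S.IsHorizon X ε) : 0 < S.kappa X := by
  have h1 := S.chi_pos
  have h2 := h.deltaQuot_self_pos
  have h3 := h.pos
  rw [h.kappa_eq]; positivity

/-- The region between the horizons, seen from either of them. -/
theorem mem_block_iff (h : S.IsHorizon X ε) (r : ℝ) :
    (0 < ε * (r - X) ∧ ε * (r - (S.rp + S.rc - X)) < 0) ↔ (S.rp < r ∧ r < S.rc) := by
  rcases h with ⟨rfl, rfl⟩ | ⟨rfl, rfl⟩ <;> constructor <;> rintro ⟨h1, h2⟩ <;> constructor <;>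
    linarith

end IsHorizon

theorem deltaR_pos {r : ℝ} (h1 : S.rp < r) (h2 : r < S.rc) : 0 < deltaR lam a r := by
  have h3 := S.rn_neg
  have h4 := S.rm_pos
  have h5 := S.lam_pos
  have h6 := S.rm_lt_rp
  rw [S.deltaR_factor]
  have e1 : 0 < r - S.rp := by linarith
  have e2 : 0 < S.rc - r := by linarith
  have e3 : 0 < r - S.rm := by linarith
  have e4 : 0 < r - S.rn := by linarith
  positivity

theorem abs_slope_lt_one {r : ℝ} (h1 : S.rp < r) (h2 : r < S.rc) : |S.slope r| < 1 := by
  have h : 0 < S.rc - S.rp := sub_pos.2 S.rp_lt_rc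
  unfold slope
  rw [abs_lt, lt_div_iff₀ h, div_lt_one h]
  constructor <;> linarith

/-! ### Pointwise properties of null orbits -/

namespace IsNullOrbit

variable {γ : ℝ → Fin 5 → ℝ} {J : Set ℝ} {E L K : ℝ} {τ : ℝ}

theorem r_pos (h : S.IsNullOrbit γ J E L K) (hτ : τ ∈ J) : 0 < γ τ 1 :=
  S.rm_pos.trans (h.mem τ hτ).1

theorem rhoSq_pos (h : S.IsNullOrbit γ J E L K) (hτ : τ ∈ J) : 0 < rhoSq a (γ τ 1) (γ τ 4) :=
  KerrDeSitter.rhoSq_pos (h.r_pos hτ) _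

theorem hasDerivAt_r (h : S.IsNullOrbit γ J E L K) (hτ : τ ∈ J) : HasDerivAt (fun τ => γ τ 1)
    (S.radialVel (γ τ) (deriv γ τ) / rhoSq a (γ τ 1) (γ τ 4)) τ := by
  have hρ := (h.rhoSq_pos hτ).ne'
  refine (hasDerivAt_pi.1 (h.hasDerivAt τ hτ) 1).congr_deriv ?_
  unfold radialVel
  field_simp

/-- The radial equation. -/
theorem sq_radialVel (h : S.IsNullOrbit γ J E L K) (hτ : τ ∈ J) :
    S.radialVel (γ τ) (deriv γ τ) ^ 2 = radialR lam a E L K (γ τ 1) := by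
  have hX := S.chi_pos.ne'
  have hW := S.deltaR_mul_radialW (h.mem τ hτ).1
  unfold radialR
  rw [h.radialP_eq τ hτ, ← h.carter_eq τ hτ]
  unfold carter
  field_simp
  linear_combination (-S.radialVel (γ τ) (deriv γ τ) ^ 2 * chi lam a ^ 2) * hW

theorem carter_nonneg (h : S.IsNullOrbit γ J E L K) : 0 ≤ K := by
  obtain ⟨τ, hτ⟩ := h.nonempty
  rw [← h.carter_eq τ hτ]
  exact S.carter_nonneg (h.mem τ hτ) (h.tangent τ hτ) (h.null τ hτ)

/-- The polar equation, in terms of the constants of motion. -/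
theorem polar_eq (h : S.IsNullOrbit γ J E L K) (hτ : τ ∈ J) :
    K * (1 - γ τ 4 ^ 2) * deltaTheta lam a (γ τ 4) = (rhoSq a (γ τ 1) (γ τ 4) * deriv γ τ 4) ^ 2
      + chi lam a ^ 2 * (a * (1 - γ τ 4 ^ 2) * E - L) ^ 2 := by
  have hX := S.chi_pos.ne'
  have hT := (S.deltaTheta_pos (γ τ 4)).ne'
  have h1 := S.carter_mul_sinSq (h.mem τ hτ) (h.tangent τ hτ) (h.null τ hτ)
  have h2 := h.azimuthal_eq τ hτ
  rw [h.carter_eq τ hτ] at h1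
  have h3 : S.azimuthal (γ τ) (deriv γ τ)
      = chi lam a ^ 2 * (a * (1 - γ τ 4 ^ 2) * E - L) / deltaTheta lam a (γ τ 4) := by
    rw [eq_div_iff hT, ← h2]; ring
  rw [h1, h3]
  field_simp

/-- The Carter constant dominates the azimuthal term. -/
theorem sq_le_carter (h : S.IsNullOrbit γ J E L K) (hτ : τ ∈ J) :
    chi lam a ^ 2 * (a * (1 - γ τ 4 ^ 2) * E - L) ^ 2 ≤ K * deltaTheta lam a (γ τ 4) := by
  have h1 := h.polar_eq hτ
  have h2 := h.carter_nonneg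
  have h3 := S.deltaTheta_pos (γ τ 4)
  have h4 : 0 ≤ K * deltaTheta lam a (γ τ 4) * γ τ 4 ^ 2 := by positivity
  nlinarith [sq_nonneg (rhoSq a (γ τ 1) (γ τ 4) * deriv γ τ 4)]

theorem sq_cos_le_one (h : S.IsNullOrbit γ J E L K) (hτ : τ ∈ J) : γ τ 4 ^ 2 ≤ 1 := by
  nlinarith [(h.mem τ hτ).2, sq_nonneg (γ τ 2), sq_nonneg (γ τ 3)]

/-- Only trivial constants of motion let `K` and the radial function vanish together. -/
theorem eq_zero_of_carter_eq_zero (h : S.IsNullOrbit γ J E L K) (hK : K = 0) {r : ℝ} (hr : 0 < r)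
    (hP : radialP lam a E L r = 0) : E = 0 ∧ L = 0 := by
  obtain ⟨τ, hτ⟩ := h.nonempty
  have hX := S.chi_pos
  have h1 := h.sq_le_carter hτ
  rw [hK, zero_mul] at h1
  have h2 : a * (1 - γ τ 4 ^ 2) * E - L = 0 := by
    have : (a * (1 - γ τ 4 ^ 2) * E - L) ^ 2 ≤ 0 := by
      by_contra hcon
      push Not at hcon
      have : 0 < chi lam a ^ 2 * (a * (1 - γ τ 4 ^ 2) * E - L) ^ 2 := by positivity
      linarith
    nlinarith
  have h3 : (r ^ 2 + a ^ 2 * γ τ 4 ^ 2) * E = 0 := by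
    unfold radialP at hP
    have : (r ^ 2 + a ^ 2) * E - a * L = 0 := by simpa [hX.ne'] using hP
    linear_combination this - a * h2
  have h4 : r ^ 2 + a ^ 2 * γ τ 4 ^ 2 ≠ 0 := by positivity
  have h5 : E = 0 := by simpa [h4] using h3
  refine ⟨h5, ?_⟩
  rw [h5] at h2
  linarith

theorem radialVel_eq_zero_of_trivial (h : S.IsNullOrbit γ J 0 0 0) (hτ : τ ∈ J) :
    S.radialVel (γ τ) (deriv γ τ) = 0 := by
  have := h.sq_radialVel hτ
  simpa [radialR, radialP] using this

/-- In the block `I`, the radial function is positive for a future-directed orbit. -/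
theorem radialP_pos (h : S.IsNullOrbit γ J E L K) (hτ : τ ∈ J) (h1 : S.rp < γ τ 1)
    (h2 : γ τ 1 < S.rc) : 0 < radialP lam a E L (γ τ 1) := by
  have hX := S.chi_pos
  have hD := deltaR_pos h1 h2
  have hs := abs_slope_lt_one h1 h2
  have hα := h.alpha_pos τ hτ
  have hP := h.radialP_eq τ hτ
  have hsq := h.sq_radialVel hτ
  have hK := h.carter_nonneg
  by_contra hcon
  push Not at hcon
  have hy : |S.radialVel (γ τ) (deriv γ τ)| ≤ -radialP lam a E L (γ τ 1) := by
    rw [← abs_of_nonpos hcon]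
    apply sq_le_sq.1
    rw [hsq]
    unfold radialR
    nlinarith [mul_nonneg hD.le hK]
  have hpos : 0 < deltaR lam a (γ τ 1) * S.alpha (γ τ) (deriv γ τ) / chi lam a := by positivity
  have hle : -(S.slope (γ τ 1) * S.radialVel (γ τ) (deriv γ τ))
      ≥ -(|S.slope (γ τ 1)| * |S.radialVel (γ τ) (deriv γ τ)|) := by
    rw [← abs_mul]
    exact neg_le_neg (le_abs_self _)
  nlinarith [abs_nonneg (S.radialVel (γ τ) (deriv γ τ)), abs_nonneg (S.slope (γ τ 1))]

/-- Beyond a horizon, a future-directed orbit moves away from it. -/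
theorem radialVel_neg_of_beyond (h : S.IsNullOrbit γ J E L K) (hX : S.IsHorizon X ε) (hτ : τ ∈ J)
    (h1 : ε * (γ τ 1 - X) < 0) : ε * S.radialVel (γ τ) (deriv γ τ) < 0 := by
  have hr := (h.mem τ hτ).1
  have hχ := S.chi_pos
  have hY : ε * (γ τ 1 - (S.rp + S.rc - X)) < 0 := by
    have := hX.self_lt_other
    linarith
  have hD : deltaR lam a (γ τ 1) < 0 := by
    rw [hX.deltaR_eq]
    exact mul_neg_of_neg_of_pos h1 (hX.deltaQuot_pos hr hY)
  have hs : 1 < ε * S.slope (γ τ 1) := by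
    have h2 := hX.one_sub_slope (γ τ 1)
    have h3 : 0 < 2 / (S.rc - S.rp) := div_pos two_pos (sub_pos.2 S.rp_lt_rc)
    nlinarith
  have hα := h.alpha_pos τ hτ
  have hP := h.radialP_eq τ hτ
  have hsq := h.sq_radialVel hτ
  have hK := h.carter_nonneg
  have hεε := hX.sq_eq_one
  have hneg : deltaR lam a (γ τ 1) * S.alpha (γ τ) (deriv γ τ) / chi lam a < 0 :=
    div_neg_of_neg_of_pos (mul_neg_of_neg_of_pos hD hα) hχ
  by_contra hcon
  push Not at hcon
  have e1 : S.slope (γ τ 1) * S.radialVel (γ τ) (deriv γ τ)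
      = (ε * S.slope (γ τ 1)) * (ε * S.radialVel (γ τ) (deriv γ τ)) := by
    linear_combination (-(S.slope (γ τ 1) * S.radialVel (γ τ) (deriv γ τ))) * hεε
  have e2 : (ε * S.radialVel (γ τ) (deriv γ τ)) ^ 2 = radialR lam a E L K (γ τ 1) := by
    rw [← hsq]
    linear_combination (S.radialVel (γ τ) (deriv γ τ)) ^ 2 * hεε
  have e3 : radialP lam a E L (γ τ 1) < -(ε * S.radialVel (γ τ) (deriv γ τ)) := by
    rw [hP, e1]
    nlinarith
  unfold radialR at e2
  nlinarith

/-- At a horizon, a future-directed orbit does not move into the block `I`. -/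
theorem radialVel_of_horizon (h : S.IsNullOrbit γ J E L K) (hX : S.IsHorizon X ε) (hτ : τ ∈ J)
    (h1 : γ τ 1 = X) : radialP lam a E L X = -(ε * S.radialVel (γ τ) (deriv γ τ)) ∧
      ε * S.radialVel (γ τ) (deriv γ τ) ≤ 0 := by
  have hχ := S.chi_pos
  have hα := h.alpha_pos τ hτ
  have hP := h.radialP_eq τ hτ
  have hK := h.carter_nonneg
  have hW := S.radialW_pos hX.rm_lt
  rw [← h.carter_eq τ hτ] at hK
  unfold carter at hK
  rw [h1, hX.deltaR_self, hX.slope_eq] at hP hK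
  refine ⟨by rw [hP]; ring, ?_⟩
  by_contra hcon
  push Not at hcon
  have : 0 < 2 * ε * S.alpha (γ τ) (deriv γ τ) * S.radialVel (γ τ) (deriv γ τ) / chi lam a := by
    rw [show 2 * ε * S.alpha (γ τ) (deriv γ τ) * S.radialVel (γ τ) (deriv γ τ)
      = 2 * S.alpha (γ τ) (deriv γ τ) * (ε * S.radialVel (γ τ) (deriv γ τ)) by ring]
    positivity
  have h5 : 0 ≤ S.radialW X * S.radialVel (γ τ) (deriv γ τ) ^ 2 := by positivity
  rw [zero_mul, zero_div] at hK
  linarith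

/-- The part of the spacetime beyond a horizon is never left toward the future. -/
theorem beyond_of_le (h : S.IsNullOrbit γ J E L K) (hX : S.IsHorizon X ε) {s t : ℝ} (hs : s ∈ J)
    (ht : t ∈ J) (hst : s ≤ t) (h1 : ε * (γ s 1 - X) ≤ 0) : ε * (γ t 1 - X) ≤ 0 := by
  rcases hst.eq_or_lt with rfl | hst
  · exact h1
  have hsub : Set.Icc s t ⊆ J := h.ordConnected.out hs ht
  have hεε := hX.sq_eq_one
  have hd : ∀ τ ∈ Set.Icc s t, HasDerivAt (fun τ => ε * (γ τ 1 - X))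
      (ε * S.radialVel (γ τ) (deriv γ τ) / rhoSq a (γ τ 1) (γ τ 4)) τ := fun τ hτ => by
    refine (((h.hasDerivAt_r (hsub hτ)).sub_const X).const_mul ε).congr_deriv ?_
    ring
  have hzero (τ) (h0 : ε * (γ τ 1 - X) = 0) : γ τ 1 = X := by
    linear_combination ε * h0 - (γ τ 1 - X) * hεε
  by_cases hP : radialP lam a E L X = 0
  · -- the radial function vanishes at the horizon: compare with an exponential
    obtain ⟨R, hR⟩ : ∃ R, ∀ τ ∈ Set.Icc s t, γ τ 1 ≤ R := by
      have hc : ContinuousOn (fun τ => γ τ 1) (Set.Icc s t) := fun τ hτ =>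
        (h.hasDerivAt_r (hsub hτ)).continuousAt.continuousWithinAt
      obtain ⟨R, hR⟩ := isCompact_Icc.exists_bound_of_continuousOn hc
      exact ⟨R, fun τ hτ => (le_abs_self _).trans (hR τ hτ)⟩
    have hχ := S.chi_pos
    have hrm := S.rm_pos
    have hXp := hX.pos
    set M := chi lam a * |E| * (R + X) / S.rm ^ 2 with hM
    set d := -(ε * (X - (S.rp + S.rc - X))) with hd'
    have hd0 : 0 < d := by have := hX.self_lt_other; linarith
    have key : ∀ η > 0, η * Real.exp ((M + 1) * (t - s)) < d → ε * (γ t 1 - X)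
        ≤ η * Real.exp ((M + 1) * (t - s)) := by
      intro η hη hηd
      have hB : ∀ x, HasDerivAt (fun τ => η * Real.exp ((M + 1) * (τ - s)))
          (η * (Real.exp ((M + 1) * (x - s)) * (M + 1))) x := by
        intro x
        have := ((((hasDerivAt_id' x).sub_const s).const_mul (M + 1)).exp).const_mul η
        simpa using this
      refine image_le_of_deriv_right_lt_deriv_boundary
        (fun x hx => (hd x hx).continuousAt.continuousWithinAt)
        (fun x hx => (hd x ⟨hx.1, hx.2.le⟩).hasDerivWithinAt) ?_ hB ?_ (Set.right_mem_Icc.2 hst.le)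
      · simp only [sub_self, mul_zero, Real.exp_zero, mul_one]
        linarith
      · intro x hx heq
        have hxI : x ∈ Set.Icc s t := ⟨hx.1, hx.2.le⟩
        have hxJ := hsub hxI
        set B := η * Real.exp ((M + 1) * (x - s)) with hBd
        have hMn : 0 ≤ M := by
          have : 0 < R := (h.r_pos hxJ).trans_le (hR x hxI)
          positivity
        have hBpos : 0 < B := by positivity
        have hBle : B ≤ η * Real.exp ((M + 1) * (t - s)) := by
          refine mul_le_mul_of_nonneg_left (Real.exp_le_exp.2 ?_) hη.le
          exact mul_le_mul_of_nonneg_left (by linarith [hx.2]) (by linarith)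
        have hblock := (hX.mem_block_iff (γ x 1)).1 ⟨by rw [heq]; exact hBpos, by linarith⟩
        have hD := deltaR_pos hblock.1 hblock.2
        have hsq := h.sq_radialVel hxJ
        have hK := h.carter_nonneg
        have hPx : radialP lam a E L (γ x 1) = chi lam a * E * (γ x 1 + X) * (γ x 1 - X) := by
          have : radialP lam a E L (γ x 1) = radialP lam a E L (γ x 1) - radialP lam a E L X := by
            rw [hP, sub_zero]
          rw [this]
          unfold radialP
          ring
        have habs : |γ x 1 - X| = B := by
          rw [← heq, ← one_mul |γ x 1 - X|, ← hX.abs_eq_one, ← abs_mul, heq, abs_of_pos hBpos]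
        have hy : |S.radialVel (γ x) (deriv γ x)| ≤ chi lam a * |E| * (R + X) * B := by
          have h1 : |S.radialVel (γ x) (deriv γ x)| ≤ |radialP lam a E L (γ x 1)| := by
            apply sq_le_sq.1
            rw [hsq]
            unfold radialR
            nlinarith [mul_nonneg hD.le hK]
          refine h1.trans ?_
          have hrp := h.r_pos hxJ
          rw [hPx, abs_mul, abs_mul, abs_mul, abs_of_pos hχ, habs,
            abs_of_pos (show 0 < γ x 1 + X by linarith)]
          have := hR x hxI
          gcongr
        have hρ : S.rm ^ 2 ≤ rhoSq a (γ x 1) (γ x 4) := by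
          have := (h.mem x hxJ).1
          unfold rhoSq
          nlinarith [sq_nonneg (a * γ x 4)]
        have hfin : ε * S.radialVel (γ x) (deriv γ x) / rhoSq a (γ x 1) (γ x 4) ≤ M * B := by
          have h2 : ε * S.radialVel (γ x) (deriv γ x) ≤ |S.radialVel (γ x) (deriv γ x)| := by
            refine (le_abs_self _).trans_eq ?_
            rw [abs_mul, hX.abs_eq_one, one_mul]
          calc ε * S.radialVel (γ x) (deriv γ x) / rhoSq a (γ x 1) (γ x 4)
              ≤ |S.radialVel (γ x) (deriv γ x)| / rhoSq a (γ x 1) (γ x 4) := by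
                have := h.rhoSq_pos hxJ
                gcongr
            _ ≤ |S.radialVel (γ x) (deriv γ x)| / S.rm ^ 2 := by gcongr
            _ ≤ chi lam a * |E| * (R + X) * B / S.rm ^ 2 := by gcongr
            _ = M * B := by rw [hM]; ring
        rw [show η * (Real.exp ((M + 1) * (x - s)) * (M + 1)) = (M + 1) * B by rw [hBd]; ring]
        linarith
    refine le_of_forall_pos_lt_add fun δ hδ => ?_
    have hexp : 0 < Real.exp ((M + 1) * (t - s)) := Real.exp_pos _
    have hm : 0 < min δ d := lt_min hδ hd0
    have := key (min δ d / 2 / Real.exp ((M + 1) * (t - s))) (by positivity) (by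
      rw [div_mul_cancel₀ _ hexp.ne']
      linarith [min_le_right δ d])
    rw [div_mul_cancel₀ _ hexp.ne'] at this
    linarith [min_le_left δ d]
  · refine (neg_of_deriv_neg_at_zeros hst hd (fun τ hτ h0 => ?_) h1).le
    have hτJ := hsub hτ
    obtain ⟨e1, e2⟩ := h.radialVel_of_horizon hX hτJ (hzero τ h0)
    refine div_neg_of_neg_of_pos (lt_of_le_of_ne e2 fun h3 => hP ?_) (h.rhoSq_pos hτJ)
    rw [e1, h3, neg_zero]

end IsNullOrbit

end

section

variable {S}

/-! ### Boundedness toward the past -/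

open Asymptotics in
theorem isBigO_one_of_abs_le {l : Filter ℝ} {f : ℝ → ℝ} {M : ℝ} (h : ∀ᶠ τ in l, |f τ| ≤ M) :
    f =O[l] fun _ => (1 : ℝ) :=
  IsBigO.of_bound M (h.mono fun τ hτ => by simpa using hτ)

open Asymptotics in
theorem isBigO_one_mul {l : Filter ℝ} {f g : ℝ → ℝ} (hf : f =O[l] fun _ => (1 : ℝ))
    (hg : g =O[l] fun _ => (1 : ℝ)) : (fun τ => f τ * g τ) =O[l] fun _ => (1 : ℝ) := by
  simpa using hf.mul hg

open Asymptotics in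
theorem isBigO_one_of_sq_le {l : Filter ℝ} {f g : ℝ → ℝ} (hg : g =O[l] fun _ => (1 : ℝ))
    (h : ∀ᶠ τ in l, f τ ^ 2 ≤ g τ) : f =O[l] fun _ => (1 : ℝ) := by
  obtain ⟨M, hM⟩ := hg.bound
  refine isBigO_one_of_abs_le (M := 1 + M) ?_
  filter_upwards [h, hM] with τ h1 h2
  have h3 : g τ ≤ M := (le_abs_self _).trans (by simpa using h2)
  nlinarith [sq_abs (f τ), sq_nonneg (|f τ| - 1), abs_nonneg (f τ)]

open Asymptotics in
theorem exists_abs_le_of_isBigO_one {l : Filter ℝ} {f : ℝ → ℝ} (h : f =O[l] fun _ => (1 : ℝ)) :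
    ∃ M, ∀ᶠ τ in l, |f τ| ≤ M := by
  obtain ⟨M, hM⟩ := h.bound
  exact ⟨M, hM.mono fun τ hτ => by simpa using hτ⟩

namespace IsNullOrbit

open Asymptotics

variable {γ : ℝ → Fin 5 → ℝ} {J : Set ℝ} {E L K : ℝ} {rlim : ℝ}

theorem isBigO_inv_rhoSq (h : S.IsNullOrbit γ J E L K) :
    (fun τ => 1 / rhoSq a (γ τ 1) (γ τ 4)) =O[pastEnd J] fun _ => (1 : ℝ) := by
  refine isBigO_one_of_abs_le (M := 1 / S.rm ^ 2) ?_
  filter_upwards [eventually_mem_pastEnd J] with τ hτ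
  have hrm := S.rm_pos
  have h1 := h.rhoSq_pos hτ
  have h2 := (h.mem τ hτ).1
  rw [abs_of_pos (by positivity)]
  have h3 : S.rm ^ 2 ≤ rhoSq a (γ τ 1) (γ τ 4) := by
    unfold rhoSq
    nlinarith [sq_nonneg (a * γ τ 4)]
  gcongr

theorem isBigO_cos (h : S.IsNullOrbit γ J E L K) :
    (fun τ => γ τ 4) =O[pastEnd J] fun _ => (1 : ℝ) := by
  refine isBigO_one_of_sq_le (isBigO_refl _ _) ?_
  filter_upwards [eventually_mem_pastEnd J] with τ hτ using h.sq_cos_le_one hτ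

theorem isBigO_sinSq (h : S.IsNullOrbit γ J E L K) :
    (fun τ => 1 - γ τ 4 ^ 2) =O[pastEnd J] fun _ => (1 : ℝ) := by
  have := isBigO_one_mul h.isBigO_cos h.isBigO_cos
  refine ((isBigO_refl (fun _ => (1 : ℝ)) (pastEnd J)).sub this).congr_left fun τ => ?_
  ring

theorem isBigO_deltaTheta (h : S.IsNullOrbit γ J E L K) :
    (fun τ => deltaTheta lam a (γ τ 4)) =O[pastEnd J] fun _ => (1 : ℝ) := by
  have := (isBigO_one_mul h.isBigO_cos h.isBigO_cos).const_mul_left (a ^ 2 * lam)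
  refine ((isBigO_refl (fun _ => (1 : ℝ)) (pastEnd J)).add this).congr_left fun τ => ?_
  unfold deltaTheta
  ring

theorem isBigO_azimuthal (h : S.IsNullOrbit γ J E L K) :
    (fun τ => S.azimuthal (γ τ) (deriv γ τ)) =O[pastEnd J] fun _ => (1 : ℝ) := by
  have h1 : (fun τ => 1 / deltaTheta lam a (γ τ 4)) =O[pastEnd J] fun _ => (1 : ℝ) := by
    refine isBigO_one_of_abs_le (M := 1) (Eventually.of_forall fun τ => ?_)
    have hT := S.deltaTheta_pos (γ τ 4)
    have hl := S.lam_pos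
    rw [abs_of_pos (by positivity), div_le_one hT]
    unfold deltaTheta
    have : 0 ≤ a ^ 2 * lam * γ τ 4 ^ 2 := by positivity
    linarith
  have h2 := ((h.isBigO_sinSq.const_mul_left (a * E)).sub
    (isBigO_const_const L one_ne_zero (pastEnd J))).const_mul_left (chi lam a ^ 2)
  refine (isBigO_one_mul h2 h1).congr' ?_ EventuallyEq.rfl
  filter_upwards [eventually_mem_pastEnd J] with τ hτ
  have hT := (S.deltaTheta_pos (γ τ 4)).ne'
  have := h.azimuthal_eq τ hτ
  field_simp
  linarith

theorem isBigO_of_continuous (hr : Tendsto (fun τ => γ τ 1) (pastEnd J) (𝓝 rlim)) {f : ℝ → ℝ}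
    (hf : ContinuousAt f rlim) : (fun τ => f (γ τ 1)) =O[pastEnd J] fun _ => (1 : ℝ) :=
  (hf.tendsto.comp hr).isBigO_one ℝ

theorem isBigO_radialVel (h : S.IsNullOrbit γ J E L K)
    (hr : Tendsto (fun τ => γ τ 1) (pastEnd J) (𝓝 rlim)) :
    (fun τ => S.radialVel (γ τ) (deriv γ τ)) =O[pastEnd J] fun _ => (1 : ℝ) := by
  refine isBigO_one_of_sq_le
    (isBigO_of_continuous hr (hasDerivAt_radialR lam a E L K rlim).continuousAt) ?_
  filter_upwards [eventually_mem_pastEnd J] with τ hτ using (h.sq_radialVel hτ).le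

/-- Along an orbit on which `r` converges and `dT - a sin² θ dΦ` stays bounded, all components of the
velocity stay bounded. -/
theorem isBigO_velocity (h : S.IsNullOrbit γ J E L K)
    (hr : Tendsto (fun τ => γ τ 1) (pastEnd J) (𝓝 rlim))
    (hα : (fun τ => S.alpha (γ τ) (deriv γ τ)) =O[pastEnd J] fun _ => (1 : ℝ)) (i : Fin 5) :
    (fun τ => deriv γ τ i) =O[pastEnd J] fun _ => (1 : ℝ) := by
  have hJ := eventually_mem_pastEnd J
  have hρ := h.isBigO_inv_rhoSq
  have hb := h.isBigO_azimuthal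
  have h1 : (fun τ => deriv γ τ 1) =O[pastEnd J] fun _ => (1 : ℝ) := by
    refine (isBigO_one_mul (h.isBigO_radialVel hr) hρ).congr' ?_ EventuallyEq.rfl
    filter_upwards [hJ] with τ hτ
    have := (h.rhoSq_pos hτ).ne'
    unfold radialVel
    field_simp
  have hρσ : (fun τ => rhoSq a (γ τ 1) (γ τ 4) * sigma (γ τ) (deriv γ τ)) =O[pastEnd J]
      fun _ => (1 : ℝ) := by
    refine ((isBigO_one_mul (h.isBigO_sinSq.const_mul_left a) hα).sub hb).congr_left fun τ => ?_
    unfold azimuthal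
    ring
  have hσ : (fun τ => sigma (γ τ) (deriv γ τ)) =O[pastEnd J] fun _ => (1 : ℝ) := by
    refine (isBigO_one_mul hρσ hρ).congr' ?_ EventuallyEq.rfl
    filter_upwards [hJ] with τ hτ
    have := (h.rhoSq_pos hτ).ne'
    field_simp
  have h0 : (fun τ => deriv γ τ 0) =O[pastEnd J] fun _ => (1 : ℝ) := by
    refine (hα.add (hσ.const_mul_left a)).congr_left fun τ => ?_
    unfold alpha
    ring
  -- the angular part of the metric bounds the velocity on the sphere
  have hN : (fun τ => sphereSq (deriv γ τ)) =O[pastEnd J] fun _ => (1 : ℝ) := by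
    have hK := h.isBigO_deltaTheta.const_mul_left K
    have hbb := (isBigO_one_mul (h.isBigO_deltaTheta.add
      (isBigO_const_const (chi lam a) one_ne_zero (pastEnd J)))
      (isBigO_one_mul hb hb)).const_mul_left (a ^ 2 * lam / chi lam a ^ 2)
    have hασ := (isBigO_one_mul hα hρσ).const_mul_left (2 * a)
    have hαα := (isBigO_one_mul (isBigO_one_mul hα hα) h.isBigO_sinSq).const_mul_left (a ^ 2)
    refine (isBigO_one_mul (((hK.add hbb).add hασ).sub hαα) (isBigO_one_mul hρ hρ)).congr' ?_
      EventuallyEq.rfl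
    filter_upwards [hJ] with τ hτ
    have hρ0 := (h.rhoSq_pos hτ).ne'
    have hX := S.chi_pos.ne'
    have := S.carter_eq_of_null (h.mem τ hτ) (h.null τ hτ)
    rw [h.carter_eq τ hτ] at this
    field_simp at this ⊢
    linear_combination -this
  have hcomp (i : Fin 5) (hi : ∀ v : Fin 5 → ℝ, v i ^ 2 ≤ sphereSq v) :
      (fun τ => deriv γ τ i) =O[pastEnd J] fun _ => (1 : ℝ) :=
    isBigO_one_of_sq_le hN (Eventually.of_forall fun τ => hi _)
  fin_cases i
  · exact h0
  · exact h1
  all_goals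
    refine hcomp _ fun v => ?_
    simp only [sphereSq, Fin.reduceFinMk]
    nlinarith [sq_nonneg (v 2), sq_nonneg (v 3), sq_nonneg (v 4)]

/-- An inextendible orbit on which `r` converges and `dT - a sin² θ dΦ` stays bounded is complete
toward the past. -/
theorem not_bddBelow (h : S.IsNullOrbit γ J E L K) (hg : S.IsGeodesic γ J)
    (hin : S.IsInextendible γ J) (hlim : S.rm < rlim)
    (hr : Tendsto (fun τ => γ τ 1) (pastEnd J) (𝓝 rlim))
    (hα : (fun τ => S.alpha (γ τ) (deriv γ τ)) =O[pastEnd J] fun _ => (1 : ℝ)) :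
    ¬ BddBelow J := by
  intro hb
  choose M hM using fun i => exists_abs_le_of_isBigO_one (h.isBigO_velocity hr hα i)
  refine hg.not_isInextendible_of_bounded hb (M := ∑ i, |M i|) (lo := (S.rm + rlim) / 2)
    (by linarith) ?_ ?_ hin
  · filter_upwards [eventually_all.2 hM] with τ hτ
    rw [pi_norm_le_iff_of_nonneg (by positivity)]
    intro i
    exact ((hτ i).trans (le_abs_self _)).trans
      (Finset.single_le_sum (f := fun i => |M i|) (fun _ _ => abs_nonneg _) (Finset.mem_univ i))
  · exact (hr.eventually (lt_mem_nhds (show (S.rm + rlim) / 2 < rlim by linarith))).mono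
      fun τ hτ => hτ.le

/-- If the radius of an inextendible orbit converges toward the past to a value other than that of a
horizon, then this value is a double root of the radial potential. -/
theorem double_root_of_tendsto (h : S.IsNullOrbit γ J E L K) (hg : S.IsGeodesic γ J)
    (hin : S.IsInextendible γ J) (hlim : S.rm < rlim)
    (hr : Tendsto (fun τ => γ τ 1) (pastEnd J) (𝓝 rlim)) (hD : deltaR lam a rlim ≠ 0)
    (hsgn : (∀ᶠ τ in pastEnd J, 0 < S.radialVel (γ τ) (deriv γ τ)) ∨
      ∀ᶠ τ in pastEnd J, S.radialVel (γ τ) (deriv γ τ) < 0) :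
    radialR lam a E L K rlim = 0 ∧ radialRDeriv lam a E L K rlim = 0 := by
  have hne := h.nonempty
  have hJ := eventually_mem_pastEnd J
  have := pastEnd_neBot hne
  have hcD := (hasDerivAt_deltaR lam a rlim).continuousAt
  have hX := S.chi_pos
  have hα : (fun τ => S.alpha (γ τ) (deriv γ τ)) =O[pastEnd J] fun _ => (1 : ℝ) := by
    have h1 := isBigO_of_continuous hr (hcD.inv₀ hD)
    have h2 := isBigO_of_continuous hr (hasDerivAt_radialP lam a E L rlim).continuousAt
    have h3 := isBigO_of_continuous hr (S.hasDerivAt_slope rlim).continuousAt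
    refine ((isBigO_one_mul h1 (h2.add (isBigO_one_mul h3
      (h.isBigO_radialVel hr)))).const_mul_left (chi lam a)).congr' ?_ EventuallyEq.rfl
    filter_upwards [hJ, (hcD.tendsto.comp hr).eventually_ne hD] with τ hτ h0
    have h0' : deltaR lam a (γ τ 1) ≠ 0 := h0
    rw [h.radialP_eq τ hτ, Pi.inv_apply]
    field_simp
    ring
  have hnb := h.not_bddBelow hg hin hlim hr hα
  -- if `R ≠ 0` or `R' ≠ 0` at the limit, then `r` or `y` drifts there and the time is bounded below
  have hρ : ∀ᶠ τ in pastEnd J, 0 < rhoSq a (γ τ 1) (γ τ 4) ∧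
      rhoSq a (γ τ 1) (γ τ 4) ≤ (rlim + 1) ^ 2 + a ^ 2 := by
    filter_upwards [hJ, hr.eventually (gt_mem_nhds (show rlim < rlim + 1 by linarith))] with τ h1 h2
    refine ⟨h.rhoSq_pos h1, ?_⟩
    have h3 := h.r_pos h1
    have h4 := h.sq_cos_le_one h1
    unfold rhoSq
    nlinarith [mul_nonneg (sq_nonneg a) (sub_nonneg.2 h4)]
  set Q := (rlim + 1) ^ 2 + a ^ 2 with hQ
  have hQ0 : 0 < Q := by
    have h1 : 0 < rlim + 1 := by linarith [S.rm_pos]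
    rw [hQ]
    positivity
  have hyR : Tendsto (fun τ => S.radialVel (γ τ) (deriv γ τ) ^ 2) (pastEnd J)
      (𝓝 (radialR lam a E L K rlim)) := by
    refine ((hasDerivAt_radialR lam a E L K rlim).continuousAt.tendsto.comp hr).congr' ?_
    filter_upwards [hJ] with τ hτ using (h.sq_radialVel hτ).symm
  have hR0 : radialR lam a E L K rlim = 0 := by
    by_contra hne0
    have hRpos : 0 < radialR lam a E L K rlim := lt_of_le_of_ne
      (ge_of_tendsto' hyR fun τ => sq_nonneg _) (Ne.symm hne0)
    obtain ⟨c, hc, hcR⟩ : ∃ c > 0, c ^ 2 < radialR lam a E L K rlim := by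
      refine ⟨√(radialR lam a E L K rlim / 2), by positivity, ?_⟩
      rw [Real.sq_sqrt (by positivity)]
      linarith
    have hyc : ∀ᶠ τ in pastEnd J, c ≤ |S.radialVel (γ τ) (deriv γ τ)| := by
      filter_upwards [hyR.eventually (lt_mem_nhds hcR)] with τ hτ
      rw [← abs_of_pos hc]
      exact sq_le_sq.1 hτ.le
    have hrd := hJ.mono fun τ hτ => h.hasDerivAt_r hτ
    rcases hsgn with hs | hs
    · refine hnb (bddBelow_of_drift h.ordConnected hne (c := c / Q) (B := rlim - 1) (by positivity)
        hrd ?_ ?_)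
      · filter_upwards [hs, hyc, hρ] with τ h1 h2 h3
        rw [abs_of_pos h1] at h2
        exact div_le_div₀ h1.le h2 h3.1 h3.2
      · exact (hr.eventually (lt_mem_nhds (show rlim - 1 < rlim by linarith))).mono
          fun τ hτ => hτ.le
    · refine hnb (bddBelow_of_drift h.ordConnected hne (c := c / Q) (B := -(rlim + 1))
        (by positivity) (hrd.mono fun τ hτ => hτ.fun_neg) ?_ ?_)
      · filter_upwards [hs, hyc, hρ] with τ h1 h2 h3
        rw [abs_of_neg h1] at h2
        rw [← neg_div]
        exact div_le_div₀ (by linarith) h2 h3.1 h3.2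
      · exact (hr.eventually (gt_mem_nhds (show rlim < rlim + 1 by linarith))).mono
          fun τ hτ => by linarith
  refine ⟨hR0, ?_⟩
  by_contra hne0
  have hy1 : ∀ᶠ τ in pastEnd J, |S.radialVel (γ τ) (deriv γ τ)| ≤ 1 := by
    rw [hR0] at hyR
    filter_upwards [hyR.eventually (gt_mem_nhds one_pos)] with τ hτ
    rw [← abs_one]
    exact sq_le_sq.1 (by linarith)
  have hyd := hJ.mono fun τ hτ => h.hasDerivAt_radialVel τ hτ
  have hcR' : ContinuousAt (radialRDeriv lam a E L K) rlim := by
    unfold radialRDeriv radialP deltaRDeriv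
    fun_prop
  have hR' := hcR'.tendsto.comp hr
  rcases lt_or_gt_of_ne hne0 with hneg | hpos
  · refine hnb (bddBelow_of_drift h.ordConnected hne
      (c := (-radialRDeriv lam a E L K rlim / 2) / (2 * Q)) (B := -1)
      (div_pos (by linarith) (by positivity)) (hyd.mono fun τ hτ => hτ.fun_neg) ?_ ?_)
    · filter_upwards [hρ, hR'.eventually (gt_mem_nhds (show radialRDeriv lam a E L K rlim
        < radialRDeriv lam a E L K rlim / 2 by linarith))] with τ h1 h2
      have h2' : radialRDeriv lam a E L K (γ τ 1) < radialRDeriv lam a E L K rlim / 2 := h2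
      rw [← neg_div]
      exact div_le_div₀ (by linarith) (by linarith) (by linarith) (by linarith)
    · filter_upwards [hy1] with τ hτ
      linarith [(abs_le.1 hτ).2]
  · refine hnb (bddBelow_of_drift h.ordConnected hne
      (c := (radialRDeriv lam a E L K rlim / 2) / (2 * Q)) (B := -1)
      (div_pos (by linarith) (by positivity)) hyd ?_ ?_)
    · filter_upwards [hρ, hR'.eventually (lt_mem_nhds (show radialRDeriv lam a E L K rlim / 2
        < radialRDeriv lam a E L K rlim by linarith))] with τ h1 h2
      have h2' : radialRDeriv lam a E L K rlim / 2 < radialRDeriv lam a E L K (γ τ 1) := h2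
      exact div_le_div₀ (by linarith) (by linarith) (by linarith) (by linarith)
    · filter_upwards [hy1] with τ hτ
      linarith [(abs_le.1 hτ).1]

end IsNullOrbit

end

section

/-! ### Convergence to a long horizon -/

/-- The Kruskal coordinate that vanishes on the long horizon: `V_+` for the event horizon and `U_c`
for the cosmological one. -/
def horizonCoord (X ε : ℝ) (p : Fin 5 → ℝ) : ℝ :=
  Real.exp (S.kappa X * (S.tBL p + ε * S.rstar (p 1)))

/-- The other Kruskal coordinate, which vanishes at `r = X`: `U_+` for the event horizon and `V_c`
for the cosmological one. -/
def crossCoord (X ε : ℝ) (p : Fin 5 → ℝ) : ℝ :=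
  -Real.sign (ε * (p 1 - X)) * Real.exp (-S.kappa X * (S.tBL p - ε * S.rstar (p 1)))

theorem kruskalPlus_eq (p : Fin 5 → ℝ) : S.kruskalPlus p
    = S.kruskalPoint S.rp (S.crossCoord S.rp 1 p) (S.horizonCoord S.rp 1 p) p := by
  simp only [kruskalPlus, crossCoord, horizonCoord, uCoord, vCoord, one_mul]

theorem kruskalC_eq (p : Fin 5 → ℝ) : S.kruskalC p
    = S.kruskalPoint S.rc (S.horizonCoord S.rc (-1) p) (S.crossCoord S.rc (-1) p) p := by
  simp only [kruskalC, crossCoord, horizonCoord, uCoord, vCoord, neg_one_mul, Real.sign_neg,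
    neg_neg, sub_neg_eq_add, ← sub_eq_add_neg]

variable {S} {X ε : ℝ}

/-- Convergence to a point of a long horizon, in the coordinates of either horizon. -/
theorem pastApproaches_of_tendsto {γ : ℝ → Fin 5 → ℝ} {J : Set ℝ} (hX : S.IsHorizon X ε)
    (hne : J.Nonempty) (hmem : ∀ τ ∈ J, γ τ ∈ S.spacetime)
    (hr : Tendsto (fun τ => γ τ 1) (pastEnd J) (𝓝 X))
    (h1 : Tendsto (fun τ => S.horizonCoord X ε (γ τ)) (pastEnd J) (𝓝 0)) {w : ℝ}
    (h2 : Tendsto (fun τ => S.crossCoord X ε (γ τ)) (pastEnd J) (𝓝 w)) {q : Fin 5 → ℝ}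
    (h3 : Tendsto (fun τ => S.kruskalPoint X 0 0 (γ τ)) (pastEnd J) (𝓝 q)) :
    S.PastApproachesPlus γ J ∨ S.PastApproachesC γ J := by
  have := pastEnd_neBot hne
  have hpc := S.rp_lt_rc
  have h3' := tendsto_pi_nhds.1 h3
  have hq : q 2 ^ 2 + q 3 ^ 2 + q 4 ^ 2 = 1 := by
    refine tendsto_nhds_unique ((((h3' 2).pow 2).add ((h3' 3).pow 2)).add ((h3' 4).pow 2))
      (tendsto_const_nhds.congr' ?_)
    filter_upwards [eventually_mem_pastEnd J] with τ hτ
    have e1 := (hmem τ hτ).2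
    have e2 := Real.sin_sq_add_cos_sq (S.angleX X (γ τ))
    simp only [kruskalPoint, Matrix.cons_val]
    linear_combination -(γ τ 2 ^ 2 + γ τ 3 ^ 2) * e2 - e1
  have key (U V : ℝ → ℝ) (u v : ℝ) (hU : Tendsto U (pastEnd J) (𝓝 u))
      (hV : Tendsto V (pastEnd J) (𝓝 v)) :
      Tendsto (fun τ => S.kruskalPoint X (U τ) (V τ) (γ τ)) (pastEnd J)
        (𝓝 ![u, v, q 2, q 3, q 4]) := by
    refine tendsto_pi_nhds.2 fun i => ?_
    fin_cases i
    exacts [hU, hV, h3' 2, h3' 3, h3' 4]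
  rcases hX with ⟨rfl, rfl⟩ | ⟨rfl, rfl⟩
  · refine Or.inl ⟨eventually_map.1 (hr.eventually (gt_mem_nhds hpc)), ![w, 0, q 2, q 3, q 4],
      ⟨rfl, hq⟩, ?_⟩
    simp only [kruskalPlus_eq]
    exact tendsto_map'_iff.1 (key _ _ _ _ h2 h1)
  · refine Or.inr ⟨eventually_map.1 (hr.eventually (lt_mem_nhds hpc)), ![0, w, q 2, q 3, q 4],
      ⟨rfl, hq⟩, ?_⟩
    simp only [kruskalC_eq]
    exact tendsto_map'_iff.1 (key _ _ _ _ h1 h2)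

/-- The tortoise coordinate diverges logarithmically at a horizon. -/
theorem IsHorizon.tendsto_rstar (hX : S.IsHorizon X ε) :
    Tendsto (fun r => ε * S.rstar r) (𝓝[≠] X) atBot := by
  have hlog : Tendsto (fun r => Real.log |r - X|) (𝓝[≠] X) atBot := by
    simp only [Real.log_abs]
    refine Real.tendsto_log_nhdsNE_zero.comp (tendsto_nhdsWithin_iff.2 ⟨?_, ?_⟩)
    · have : ContinuousAt (fun r => r - X) X := by fun_prop
      simpa using this.tendsto.mono_left nhdsWithin_le_nhds
    · filter_upwards [self_mem_nhdsWithin] with r hr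
      simpa [sub_eq_zero] using hr
  -- the sign of `Δ_r'(X)` is `ε`
  have hcoef : 0 < ε * (chi lam a * (X ^ 2 + a ^ 2) / deriv (deltaR lam a) X) := by
    have h1 := S.chi_pos
    have h2 := hX.deltaQuot_self_pos
    have h3 := hX.pos
    have h4 := hX.sq_eq_one
    rw [(hasDerivAt_deltaR lam a X).deriv, hX.deltaRDeriv_self,
      show ε * (chi lam a * (X ^ 2 + a ^ 2) / (ε * S.deltaQuot X ε X))
        = (ε * ε) * (chi lam a * (X ^ 2 + a ^ 2) / ((ε * ε) * S.deltaQuot X ε X)) by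
          have : ε ≠ 0 := by rintro rfl; simp at h4
          field_simp, h4, one_mul, one_mul]
    positivity
  have hmain := hlog.const_mul_atBot hcoef
  have hm := S.rm_lt_rp
  have hc := S.rp_lt_rc
  have h0 := S.rm_pos
  have hn := S.rn_neg
  have hcont (c b : ℝ) (hb : X ≠ b) : Tendsto (fun r => ε * (c * Real.log |r - b|)) (𝓝[≠] X)
      (𝓝 (ε * (c * Real.log |X - b|))) := by
    have : ContinuousAt (fun r => ε * (c * Real.log |r - b|)) X := by
      refine (ContinuousAt.log (by fun_prop) ?_).const_mul c |>.const_mul ε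
      simpa [sub_eq_zero] using hb
    exact this.tendsto.mono_left nhdsWithin_le_nhds
  have hXn : X ≠ S.rn := by
    have := hX.pos
    linarith
  have hXm : X ≠ S.rm := hX.rm_lt.ne'
  have hrest (b : ℝ) (hb : X ≠ b) :=
    ((hcont (chi lam a * (S.rn ^ 2 + a ^ 2) / deriv (deltaR lam a) S.rn) _ hXn).add
    (hcont (chi lam a * (S.rm ^ 2 + a ^ 2) / deriv (deltaR lam a) S.rm) _ hXm)).add
    (hcont (chi lam a * (b ^ 2 + a ^ 2) / deriv (deltaR lam a) b) b hb)
  rcases hX with ⟨rfl, rfl⟩ | ⟨rfl, rfl⟩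
  · refine ((hrest S.rc hc.ne).add_atBot hmain).congr fun r => ?_
    simp only [rstar, Fin.sum_univ_four, root, Matrix.cons_val]
    ring
  · refine ((hrest S.rp hc.ne').add_atBot hmain).congr fun r => ?_
    simp only [rstar, Fin.sum_univ_four, root, Matrix.cons_val]
    ring

variable (S) in
theorem rhoSq_mul_velocity_zero (p v : Fin 5 → ℝ) : rhoSq a (p 1) (p 4) * v 0
    = (p 1 ^ 2 + a ^ 2) * S.alpha p v - a * S.azimuthal p v := by
  unfold azimuthal alpha rhoSq
  ring

namespace IsNullOrbit

open Asymptotics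

variable {γ : ℝ → Fin 5 → ℝ} {J : Set ℝ} {E L K : ℝ} {τ : ℝ}

theorem hasDerivAt_tBL (h : S.IsNullOrbit γ J E L K) (hτ : τ ∈ J)
    (hD : deltaR lam a (γ τ 1) ≠ 0) : HasDerivAt (fun τ => S.tBL (γ τ))
      (((γ τ 1 ^ 2 + a ^ 2) * chi lam a * radialP lam a E L (γ τ 1) / deltaR lam a (γ τ 1)
        - a * S.azimuthal (γ τ) (deriv γ τ)) / rhoSq a (γ τ 1) (γ τ 4)) τ := by
  have hρ := (h.rhoSq_pos hτ).ne'
  have hX := S.chi_pos.ne'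
  refine ((hasDerivAt_pi.1 (h.hasDerivAt τ hτ) 0).fun_sub
    ((S.hasDerivAt_tShift _ hD).comp τ (h.hasDerivAt_r hτ))).congr_deriv ?_
  have h1 := S.rhoSq_mul_velocity_zero (γ τ) (deriv γ τ)
  rw [h.radialP_eq τ hτ]
  field_simp
  linear_combination deltaR lam a (γ τ 1) * h1

/-- The derivative of the coordinate `t - ε r_*`. The factor `Δ_r` in the denominator cancels by the
radial equation `Δ_r K = (f - ε y) (f + ε y)`. -/
theorem hasDerivAt_tBL_sub (h : S.IsNullOrbit γ J E L K) (hX : S.IsHorizon X ε) (hτ : τ ∈ J)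
    (hD : deltaR lam a (γ τ 1) ≠ 0)
    (hs : radialP lam a E L (γ τ 1) + ε * S.radialVel (γ τ) (deriv γ τ) ≠ 0) :
    HasDerivAt (fun τ => S.tBL (γ τ) - ε * S.rstar (γ τ 1))
      (((γ τ 1 ^ 2 + a ^ 2) * chi lam a * K
          / (radialP lam a E L (γ τ 1) + ε * S.radialVel (γ τ) (deriv γ τ))
        - a * S.azimuthal (γ τ) (deriv γ τ)) / rhoSq a (γ τ 1) (γ τ 4)) τ := by
  have hρ := (h.rhoSq_pos hτ).ne'
  refine ((h.hasDerivAt_tBL hτ hD).fun_sub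
    (((S.hasDerivAt_rstar _ hD).comp τ (h.hasDerivAt_r hτ)).const_mul ε)).congr_deriv ?_
  have hR := h.sq_radialVel hτ
  unfold radialR at hR
  have hεε := hX.sq_eq_one
  field_simp
  linear_combination (-(γ τ 1 ^ 2 + a ^ 2) * chi lam a) * hR
    - (γ τ 1 ^ 2 + a ^ 2) * chi lam a * S.radialVel (γ τ) (deriv γ τ) ^ 2 * hεε

/-- The angular velocity of the co-rotating azimuth: apart from the term with `α`, which is absorbed
by the metric, it is bounded at the horizon, because `ε (r - X)` divides both `Δ_r` and
`a - a (r² + a²) / (X² + a²)`. -/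
theorem hasDerivAt_angleX (h : S.IsNullOrbit γ J E L K) (hX : S.IsHorizon X ε) (hτ : τ ∈ J)
    (hD : deltaR lam a (γ τ 1) ≠ 0) : HasDerivAt (fun τ => S.angleX X (γ τ))
      ((-(chi lam a * radialP lam a E L (γ τ 1) * (a / (X ^ 2 + a ^ 2)) * (γ τ 1 + X) * ε
          / S.deltaQuot X ε (γ τ 1))
        + a / (X ^ 2 + a ^ 2) * a * S.azimuthal (γ τ) (deriv γ τ)
        - a * S.alpha (γ τ) (deriv γ τ)) / rhoSq a (γ τ 1) (γ τ 4)) τ := by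
  have hρ := (h.rhoSq_pos hτ).ne'
  have hχ := S.chi_pos.ne'
  have hXa : X ^ 2 + a ^ 2 ≠ 0 := by have := hX.pos; positivity
  refine (((S.hasDerivAt_phiShift _ hD).comp τ (h.hasDerivAt_r hτ)).fun_neg.fun_sub
    ((h.hasDerivAt_tBL hτ hD).const_mul (a / (X ^ 2 + a ^ 2)))).congr_deriv ?_
  have hP := h.radialP_eq τ hτ
  have hDe := hX.deltaR_eq (γ τ 1)
  have hεε := hX.sq_eq_one
  have hQ : S.deltaQuot X ε (γ τ 1) ≠ 0 := by
    rintro h0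
    rw [h0, mul_zero] at hDe
    exact hD hDe
  have hα : S.alpha (γ τ) (deriv γ τ) = chi lam a * (radialP lam a E L (γ τ 1)
      + S.slope (γ τ 1) * S.radialVel (γ τ) (deriv γ τ)) / deltaR lam a (γ τ 1) := by
    rw [hP]
    field_simp
    ring
  have hq : ε / S.deltaQuot X ε (γ τ 1) = (γ τ 1 - X) / deltaR lam a (γ τ 1) := by
    rw [div_eq_div_iff hQ hD, hDe]
    linear_combination (γ τ 1 - X) * S.deltaQuot X ε (γ τ 1) * hεε
  rw [mul_div_assoc (_ * (γ τ 1 + X)) ε, hq, hα]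
  field_simp
  ring

/-- The velocity of the point on the sphere, in coordinates rotating with an angle `A`, is
controlled by the constants of motion and the combination `A' + a α / ρ²`. -/
theorem sq_rotating_velocity (h : S.IsNullOrbit γ J E L K) (hτ : τ ∈ J) (c s A D : ℝ)
    (hcs : s ^ 2 + c ^ 2 = 1)
    (hD : A = (D - a * S.alpha (γ τ) (deriv γ τ)) / rhoSq a (γ τ 1) (γ τ 4)) :
    (deriv γ τ 2 * c - deriv γ τ 3 * s - A * (γ τ 2 * s + γ τ 3 * c)) ^ 2
      + (deriv γ τ 2 * s + deriv γ τ 3 * c + A * (γ τ 2 * c - γ τ 3 * s)) ^ 2 + deriv γ τ 4 ^ 2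
    = (K * deltaTheta lam a (γ τ 4) + a ^ 2 * lam * (deltaTheta lam a (γ τ 4) + chi lam a)
          * S.azimuthal (γ τ) (deriv γ τ) ^ 2 / chi lam a ^ 2 + D ^ 2 * (1 - γ τ 4 ^ 2)
        - 2 * D * S.azimuthal (γ τ) (deriv γ τ)) / rhoSq a (γ τ 1) (γ τ 4) ^ 2 := by
  have hρ := (h.rhoSq_pos hτ).ne'
  have hχ := S.chi_pos.ne'
  have h1 := S.carter_eq_of_null (h.mem τ hτ) (h.null τ hτ)
  rw [h.carter_eq τ hτ] at h1
  have h2 := (h.mem τ hτ).2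
  have h3 : (deriv γ τ 2 * c - deriv γ τ 3 * s - A * (γ τ 2 * s + γ τ 3 * c)) ^ 2
      + (deriv γ τ 2 * s + deriv γ τ 3 * c + A * (γ τ 2 * c - γ τ 3 * s)) ^ 2 + deriv γ τ 4 ^ 2
      = sphereSq (deriv γ τ) + A ^ 2 * (1 - γ τ 4 ^ 2) + 2 * A * sigma (γ τ) (deriv γ τ) := by
    unfold sphereSq sigma
    linear_combination (deriv γ τ 2 ^ 2 + deriv γ τ 3 ^ 2 + A ^ 2 * (γ τ 2 ^ 2 + γ τ 3 ^ 2)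
      + 2 * A * (γ τ 2 * deriv γ τ 3 - γ τ 3 * deriv γ τ 2)) * hcs + A ^ 2 * h2
  rw [h3, ← h1, hD]
  unfold azimuthal
  field_simp
  ring

/-- In coordinates rotating with the horizon, the point on the sphere converges at a finite end. -/
theorem exists_tendsto_kruskalPoint (h : S.IsNullOrbit γ J E L K) (hb : BddBelow J) {D : ℝ → ℝ}
    (hA : ∀ᶠ τ in pastEnd J, HasDerivAt (fun τ => S.angleX X (γ τ))
      ((D τ - a * S.alpha (γ τ) (deriv γ τ)) / rhoSq a (γ τ 1) (γ τ 4)) τ)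
    (hD : D =O[pastEnd J] fun _ => (1 : ℝ)) :
    ∃ q, Tendsto (fun τ => S.kruskalPoint X 0 0 (γ τ)) (pastEnd J) (𝓝 q) := by
  have hJ := eventually_mem_pastEnd J
  have hb1 := h.isBigO_azimuthal
  have hρ := h.isBigO_inv_rhoSq
  have hB : (fun τ => (K * deltaTheta lam a (γ τ 4) + a ^ 2 * lam * (deltaTheta lam a (γ τ 4)
      + chi lam a) * S.azimuthal (γ τ) (deriv γ τ) ^ 2 / chi lam a ^ 2 + D τ ^ 2 * (1 - γ τ 4 ^ 2)
      - 2 * D τ * S.azimuthal (γ τ) (deriv γ τ)) / rhoSq a (γ τ 1) (γ τ 4) ^ 2) =O[pastEnd J]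
      fun _ => (1 : ℝ) := by
    have h1 := h.isBigO_deltaTheta.const_mul_left K
    have h2 := (isBigO_one_mul (h.isBigO_deltaTheta.add
      (isBigO_const_const (chi lam a) one_ne_zero (pastEnd J)))
      (isBigO_one_mul hb1 hb1)).const_mul_left (a ^ 2 * lam / chi lam a ^ 2)
    have h3 := isBigO_one_mul (isBigO_one_mul hD hD) h.isBigO_sinSq
    have h4 := (isBigO_one_mul hD hb1).const_mul_left 2
    refine (isBigO_one_mul (((h1.add h2).add h3).sub h4) (isBigO_one_mul hρ hρ)).congr_left
      fun τ => ?_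
    simp only [div_eq_mul_inv]
    ring
  have hlim (f f' : ℝ → ℝ) (hf : ∀ᶠ τ in pastEnd J, HasDerivAt f (f' τ) τ)
      (hf' : f' =O[pastEnd J] fun _ => (1 : ℝ)) : ∃ l, Tendsto f (pastEnd J) (𝓝 l) := by
    obtain ⟨M, hM⟩ := exists_abs_le_of_isBigO_one hf'
    exact exists_tendsto_of_bounded_deriv h.isOpen h.ordConnected h.nonempty hb hf hM
  have hd := hJ.mono fun τ hτ => hasDerivAt_pi.1 (h.hasDerivAt τ hτ)
  have hsq : ∀ᶠ τ in pastEnd J, _ := hJ.mono fun τ hτ => h.sq_rotating_velocity hτ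
    (Real.cos (S.angleX X (γ τ))) (Real.sin (S.angleX X (γ τ))) _ (D τ)
    (Real.sin_sq_add_cos_sq _) rfl
  obtain ⟨q2, h2⟩ := hlim (fun τ => γ τ 2 * Real.cos (S.angleX X (γ τ))
    - γ τ 3 * Real.sin (S.angleX X (γ τ))) _ (by
      filter_upwards [hd, hA] with τ h1 h2
      exact ((h1 2).fun_mul h2.cos).fun_sub ((h1 3).fun_mul h2.sin)) (by
      refine isBigO_one_of_sq_le hB ?_
      filter_upwards [hsq] with τ h1
      rw [← h1]
      refine le_trans (le_of_eq ?_) (le_add_of_le_of_nonneg (le_add_of_nonneg_right (sq_nonneg _))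
        (sq_nonneg _))
      ring)
  obtain ⟨q3, h3⟩ := hlim (fun τ => γ τ 2 * Real.sin (S.angleX X (γ τ))
    + γ τ 3 * Real.cos (S.angleX X (γ τ))) _ (by
      filter_upwards [hd, hA] with τ h1 h2
      exact ((h1 2).fun_mul h2.sin).fun_add ((h1 3).fun_mul h2.cos)) (by
      refine isBigO_one_of_sq_le hB ?_
      filter_upwards [hsq] with τ h1
      rw [← h1]
      refine le_trans (le_of_eq ?_) (le_add_of_le_of_nonneg (le_add_of_nonneg_left (sq_nonneg _))
        (sq_nonneg _))
      ring)
  obtain ⟨q4, h4⟩ := hlim (fun τ => γ τ 4) _ (hd.mono fun τ h => h 4) (by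
      refine isBigO_one_of_sq_le hB ?_
      filter_upwards [hsq] with τ h1
      rw [← h1]
      exact le_add_of_nonneg_left (add_nonneg (sq_nonneg _) (sq_nonneg _)))
  refine ⟨![0, 0, q2, q3, q4], tendsto_pi_nhds.2 fun i => ?_⟩
  fin_cases i
  exacts [tendsto_const_nhds, tendsto_const_nhds, h2, h3, h4]

/-- The co-rotating azimuth converges along an orbit that tends to the horizon without lying on it. -/
theorem exists_tendsto_kruskalPoint_of_ne (h : S.IsNullOrbit γ J E L K) (hX : S.IsHorizon X ε)
    (hb : BddBelow J) (hr : Tendsto (fun τ => γ τ 1) (pastEnd J) (𝓝 X))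
    (hD : ∀ᶠ τ in pastEnd J, deltaR lam a (γ τ 1) ≠ 0) :
    ∃ q, Tendsto (fun τ => S.kruskalPoint X 0 0 (γ τ)) (pastEnd J) (𝓝 q) := by
  have hJ := eventually_mem_pastEnd J
  refine h.exists_tendsto_kruskalPoint hb (D := fun τ => -(chi lam a * radialP lam a E L (γ τ 1)
    * (a / (X ^ 2 + a ^ 2)) * (γ τ 1 + X) * ε / S.deltaQuot X ε (γ τ 1))
      + a / (X ^ 2 + a ^ 2) * a * S.azimuthal (γ τ) (deriv γ τ)) ?_ ?_
  · filter_upwards [hJ, hD] with τ h1 h2 using h.hasDerivAt_angleX hX h1 h2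
  · refine IsBigO.add ?_ (h.isBigO_azimuthal.const_mul_left _)
    refine isBigO_of_continuous hr (f := fun r => -(chi lam a * radialP lam a E L r
      * (a / (X ^ 2 + a ^ 2)) * (r + X) * ε / S.deltaQuot X ε r)) ?_
    have h1 := (hasDerivAt_radialP lam a E L X).continuousAt
    have h2 : ContinuousAt (S.deltaQuot X ε) X := IsHorizon.continuous_deltaQuot.continuousAt
    have h3 := hX.deltaQuot_self_pos.ne'
    fun_prop (disch := assumption)

theorem isBigO_scaled_azimuthal (h : S.IsNullOrbit γ J E L K) {f : ℝ → ℝ}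
    (hf : f =O[pastEnd J] fun _ => (1 : ℝ)) :
    (fun τ => (f τ - a * S.azimuthal (γ τ) (deriv γ τ)) / rhoSq a (γ τ 1) (γ τ 4))
      =O[pastEnd J] fun _ => (1 : ℝ) := by
  refine (isBigO_one_mul (hf.sub (h.isBigO_azimuthal.const_mul_left a))
    h.isBigO_inv_rhoSq).congr_left fun τ => ?_
  rw [mul_one_div]

/-- An orbit that reaches `r = X` toward the past in finite time, with nonzero radial velocity in
the direction in which `t - ε r_*` stays bounded, converges to the long horizon. The sign condition
selects one of the two values of the other Kruskal coordinate. -/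
theorem pastApproaches_of_radialP_ne_zero (h : S.IsNullOrbit γ J E L K) (hX : S.IsHorizon X ε)
    (hb : BddBelow J) (hr : Tendsto (fun τ => γ τ 1) (pastEnd J) (𝓝 X))
    (hsgn : (∀ᶠ τ in pastEnd J, 0 < ε * (γ τ 1 - X)) ∨ ∀ᶠ τ in pastEnd J, ε * (γ τ 1 - X) < 0)
    (hP : radialP lam a E L X ≠ 0)
    (hy : Tendsto (fun τ => ε * S.radialVel (γ τ) (deriv γ τ)) (pastEnd J)
      (𝓝 (radialP lam a E L X))) :
    S.PastApproachesPlus γ J ∨ S.PastApproachesC γ J := by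
  have hJ := eventually_mem_pastEnd J
  have := pastEnd_neBot h.nonempty
  have hκ := hX.kappa_pos
  have hne : ∀ᶠ τ in pastEnd J, γ τ 1 ≠ X := by
    rcases hsgn with hs | hs <;> filter_upwards [hs] with τ h1 h2 <;> simp [h2] at h1
  have hD : ∀ᶠ τ in pastEnd J, deltaR lam a (γ τ 1) ≠ 0 := by
    filter_upwards [hne, (IsHorizon.continuous_deltaQuot.continuousAt.tendsto.comp hr).eventually_ne
      hX.deltaQuot_self_pos.ne'] with τ h1 h2
    rw [hX.deltaR_eq]
    refine mul_ne_zero (mul_ne_zero ?_ (sub_ne_zero.2 h1)) h2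
    rintro rfl
    simpa using hX.sq_eq_one
  have hPr := (hasDerivAt_radialP lam a E L X).continuousAt.tendsto.comp hr
  have hsum := hPr.add hy
  have hsum0 : radialP lam a E L X + radialP lam a E L X ≠ 0 := by
    rw [← two_mul]
    exact mul_ne_zero two_ne_zero hP
  have hbd : (fun τ => (((γ τ 1 ^ 2 + a ^ 2) * chi lam a * K
      / (radialP lam a E L (γ τ 1) + ε * S.radialVel (γ τ) (deriv γ τ))
      - a * S.azimuthal (γ τ) (deriv γ τ)) / rhoSq a (γ τ 1) (γ τ 4)))
      =O[pastEnd J] fun _ => (1 : ℝ) := by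
    exact h.isBigO_scaled_azimuthal (Tendsto.isBigO_one ℝ
      (((((hr.pow 2).add_const (a ^ 2)).mul_const (chi lam a)).mul_const K).div hsum hsum0))
  obtain ⟨M, hM⟩ := exists_abs_le_of_isBigO_one hbd
  obtain ⟨l, hl⟩ := exists_tendsto_of_bounded_deriv h.isOpen h.ordConnected h.nonempty hb (by
    filter_upwards [hJ, hD, hsum.eventually_ne hsum0] with τ h1 h2 h3
    exact h.hasDerivAt_tBL_sub hX h1 h2 h3) hM
  obtain ⟨q, hq⟩ := h.exists_tendsto_kruskalPoint_of_ne hX hb hr hD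
  have hrs := hX.tendsto_rstar.comp (tendsto_nhdsWithin_iff.2 ⟨hr, hne⟩)
  have hexp := Real.continuous_exp.continuousAt.tendsto.comp (hl.const_mul (-S.kappa X))
  have h1 : Tendsto (fun τ => S.horizonCoord X ε (γ τ)) (pastEnd J) (𝓝 0) := by
    refine Real.tendsto_exp_atBot.comp (Tendsto.const_mul_atBot hκ ?_)
    refine (hl.add_atBot (hrs.const_mul_atBot two_pos)).congr fun τ => ?_
    simp only [Function.comp_apply]
    ring
  rcases hsgn with hs | hs
  · refine pastApproaches_of_tendsto hX h.nonempty h.mem hr h1 ((hexp.const_mul (-1)).congr' ?_) hq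
    filter_upwards [hs] with τ h2
    rw [crossCoord, Real.sign_of_pos h2]
    rfl
  · refine pastApproaches_of_tendsto hX h.nonempty h.mem hr h1 ((hexp.const_mul 1).congr' ?_) hq
    filter_upwards [hs] with τ h2
    rw [crossCoord, Real.sign_of_neg h2, neg_neg]
    rfl

/-- An orbit that reaches `r = X` toward the past in finite time and whose radial function vanishes
there converges to the bifurcation sphere: the time `t` converges, and both Kruskal coordinates tend
to zero. -/
theorem pastApproaches_of_radialP_eq_zero (h : S.IsNullOrbit γ J E L K) (hX : S.IsHorizon X ε)
    (hb : BddBelow J) (hr : Tendsto (fun τ => γ τ 1) (pastEnd J) (𝓝 X))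
    (hne : ∀ᶠ τ in pastEnd J, γ τ 1 ≠ X) (hP : radialP lam a E L X = 0) :
    S.PastApproachesPlus γ J ∨ S.PastApproachesC γ J := by
  have hJ := eventually_mem_pastEnd J
  have := pastEnd_neBot h.nonempty
  have hκ := hX.kappa_pos
  have hε : ε ≠ 0 := by
    rintro rfl
    simpa using hX.sq_eq_one
  have hQ := (IsHorizon.continuous_deltaQuot.continuousAt.tendsto.comp hr).eventually_ne
      hX.deltaQuot_self_pos.ne'
  have hD : ∀ᶠ τ in pastEnd J, deltaR lam a (γ τ 1) ≠ 0 := by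
    filter_upwards [hne, hQ] with τ h1 h2
    rw [hX.deltaR_eq]
    exact mul_ne_zero (mul_ne_zero hε (sub_ne_zero.2 h1)) h2
  have hPr (r : ℝ) : radialP lam a E L r = chi lam a * E * (r + X) * (r - X) := by
    have : radialP lam a E L r = radialP lam a E L r - radialP lam a E L X := by
      rw [hP, sub_zero]
    rw [this]
    unfold radialP
    ring
  have hbd : (fun τ => ((γ τ 1 ^ 2 + a ^ 2) * chi lam a * radialP lam a E L (γ τ 1)
      / deltaR lam a (γ τ 1) - a * S.azimuthal (γ τ) (deriv γ τ)) / rhoSq a (γ τ 1) (γ τ 4))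
      =O[pastEnd J] fun _ => (1 : ℝ) := by
    refine h.isBigO_scaled_azimuthal ?_
    have hc : ContinuousAt (fun r => (r ^ 2 + a ^ 2) * chi lam a * (chi lam a * E * (r + X))
        / (ε * S.deltaQuot X ε r)) X := by
      have h2 : ContinuousAt (S.deltaQuot X ε) X := IsHorizon.continuous_deltaQuot.continuousAt
      have h3 : ε * S.deltaQuot X ε X ≠ 0 := mul_ne_zero hε hX.deltaQuot_self_pos.ne'
      fun_prop (disch := assumption)
    refine (isBigO_of_continuous hr hc).congr' ?_ EventuallyEq.rfl
    filter_upwards [hne, hQ] with τ h1 h2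
    have h2' : S.deltaQuot X ε (γ τ 1) ≠ 0 := h2
    have h1' := sub_ne_zero.2 h1
    rw [hPr, hX.deltaR_eq]
    field_simp
  obtain ⟨M, hM⟩ := exists_abs_le_of_isBigO_one hbd
  obtain ⟨l, hl⟩ := exists_tendsto_of_bounded_deriv h.isOpen h.ordConnected h.nonempty hb (by
    filter_upwards [hJ, hD] with τ h1 h2 using h.hasDerivAt_tBL h1 h2) hM
  obtain ⟨q, hq⟩ := h.exists_tendsto_kruskalPoint_of_ne hX hb hr hD
  have hrs := hX.tendsto_rstar.comp (tendsto_nhdsWithin_iff.2 ⟨hr, hne⟩)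
  have h1 : Tendsto (fun τ => S.horizonCoord X ε (γ τ)) (pastEnd J) (𝓝 0) :=
    Real.tendsto_exp_atBot.comp (Tendsto.const_mul_atBot hκ (hl.add_atBot hrs))
  have h2 : Tendsto (fun τ => Real.exp (-S.kappa X * (S.tBL (γ τ) - ε * S.rstar (γ τ 1))))
      (pastEnd J) (𝓝 0) := by
    refine Real.tendsto_exp_atBot.comp (Tendsto.const_mul_atTop_of_neg (neg_lt_zero.2 hκ) ?_)
    simp only [sub_eq_add_neg]
    exact hl.add_atTop (tendsto_neg_atBot_atTop.comp hrs)
  refine pastApproaches_of_tendsto hX h.nonempty h.mem hr h1 (w := 0)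
    (squeeze_zero_norm (fun τ => ?_) h2) hq
  rw [crossCoord, norm_mul, norm_neg, Real.norm_of_nonneg (Real.exp_pos _).le]
  refine mul_le_of_le_one_left (Real.exp_pos _).le ?_
  rcases Real.sign_apply_eq (ε * (γ τ 1 - X)) with h3 | h3 | h3 <;> rw [h3] <;> norm_num

/-- A generator of a horizon, followed toward the past, leaves the spacetime in finite time through
the bifurcation sphere. -/
theorem pastApproaches_of_eventually_eq (h : S.IsNullOrbit γ J E L K) (hg : S.IsGeodesic γ J)
    (hin : S.IsInextendible γ J) (hX : S.IsHorizon X ε) (hr : ∀ᶠ τ in pastEnd J, γ τ 1 = X) :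
    S.PastApproachesPlus γ J ∨ S.PastApproachesC γ J := by
  obtain ⟨τ₁, hτ₁, hr₁⟩ := (eventually_pastEnd h.nonempty).1 hr
  have := pastEnd_neBot h.nonempty
  have hχ := S.chi_pos
  have hXp := hX.pos
  have hεε := hX.sq_eq_one
  have hQ := hX.deltaQuot_self_pos
  set J' := J ∩ Set.Iio τ₁ with hJ'
  have hJo : IsOpen J' := h.isOpen.inter isOpen_Iio
  have hJc : J'.OrdConnected := h.ordConnected.inter Set.ordConnected_Iio
  have hrJ : ∀ τ ∈ J', γ τ 1 = X := fun τ hτ => hr₁ τ hτ.1 (le_of_lt hτ.2)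
  obtain ⟨τ₀, hτ₀⟩ : J'.Nonempty := by
    obtain ⟨δ, hδ, hball⟩ := Metric.isOpen_iff.1 h.isOpen τ₁ hτ₁
    refine ⟨τ₁ - δ / 2, hball ?_, ?_⟩
    · rw [Metric.mem_ball, Real.dist_eq, abs_lt]
      constructor <;> linarith
    · rw [Set.mem_Iio]
      linarith
  have hJ : ∀ᶠ τ in pastEnd J, τ ∈ J' := by
    filter_upwards [eventually_mem_pastEnd J, eventually_le_pastEnd hτ₀.1] with τ h1 h2
    exact ⟨h1, h2.trans_lt hτ₀.2⟩
  have hy : ∀ τ ∈ J', S.radialVel (γ τ) (deriv γ τ) = 0 := by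
    intro τ hτ
    have h1 : HasDerivAt (fun τ => γ τ 1) 0 τ := by
      refine (hasDerivAt_const τ X).congr_of_eventuallyEq ?_
      filter_upwards [hJo.mem_nhds hτ] with t ht using hrJ t ht
    have h2 := (h.hasDerivAt_r hτ.1).unique h1
    simpa [(h.rhoSq_pos hτ.1).ne'] using h2
  have hD := hX.deltaR_self
  have hP : radialP lam a E L X = 0 := by
    have h1 := h.radialP_eq τ₀ hτ₀.1
    rw [hy τ₀ hτ₀, hrJ τ₀ hτ₀, hD] at h1
    rw [h1]
    ring
  have hK : K = 0 := by
    have h1 := h.carter_eq τ₀ hτ₀.1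
    unfold carter at h1
    rw [hy τ₀ hτ₀, hrJ τ₀ hτ₀, hD] at h1
    rw [← h1]
    ring
  obtain ⟨rfl, rfl⟩ := h.eq_zero_of_carter_eq_zero hK hXp hP
  obtain rfl := hK
  have hb : ∀ τ ∈ J', S.azimuthal (γ τ) (deriv γ τ) = 0 := by
    intro τ hτ
    have h1 := h.azimuthal_eq τ hτ.1
    simpa [(S.deltaTheta_pos (γ τ 4)).ne'] using h1
  -- the momentum `g(γ', ∂_r)`, which is `ε α / χ` here, satisfies an autonomous equation
  have hα : ∀ τ ∈ J', HasDerivAt (fun τ => S.alpha (γ τ) (deriv γ τ))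
      (-(S.deltaQuot X ε X / (2 * chi lam a)) * S.alpha (γ τ) (deriv γ τ) ^ 2
        / rhoSq a (γ τ 1) (γ τ 4)) τ := by
    intro τ hτ
    have h1 := ((h.hasDerivAt_metric_dr τ hτ.1).const_mul (ε * chi lam a))
    refine (h1.congr_of_eventuallyEq ?_).congr_deriv ?_
    · filter_upwards [hJo.mem_nhds hτ] with t ht
      rw [S.metric_dr, hy t ht, hrJ t ht, hX.slope_eq]
      field_simp
      linear_combination -S.alpha (γ t) (deriv γ t) * hεε
    · have hρ := (h.rhoSq_pos hτ.1).ne'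
      rw [hy τ hτ, show γ τ 1 = X from hrJ τ hτ] at *
      rw [hX.deltaRDeriv_self]
      field_simp
      linear_combination (-S.deltaQuot X ε X * S.alpha (γ τ) (deriv γ τ) ^ 2) * hεε
  have hαpos (τ) (hτ : τ ∈ J') := h.alpha_pos τ hτ.1
  have hinv : ∀ τ ∈ J', HasDerivAt (fun τ => (S.alpha (γ τ) (deriv γ τ))⁻¹)
      (S.deltaQuot X ε X / (2 * chi lam a) / rhoSq a (γ τ 1) (γ τ 4)) τ := by
    intro τ hτ
    have h1 := (hαpos τ hτ).ne'
    refine ((hα τ hτ).fun_inv h1).congr_deriv ?_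
    field_simp
  have hρ : ∀ τ ∈ J', 0 < rhoSq a (γ τ 1) (γ τ 4) ∧ rhoSq a (γ τ 1) (γ τ 4) ≤ X ^ 2 + a ^ 2 := by
    intro τ hτ
    refine ⟨h.rhoSq_pos hτ.1, ?_⟩
    have h4 := h.sq_cos_le_one hτ.1
    rw [hrJ τ hτ]
    unfold rhoSq
    nlinarith [mul_nonneg (sq_nonneg a) (sub_nonneg.2 h4)]
  have hbdd : BddBelow J := bddBelow_of_drift h.ordConnected h.nonempty
    (c := S.deltaQuot X ε X / (2 * chi lam a) / (X ^ 2 + a ^ 2)) (B := 0) (by positivity)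
    (hJ.mono hinv) (hJ.mono fun τ hτ => by have := hρ τ hτ; gcongr <;> linarith)
    (hJ.mono fun τ hτ => (inv_pos.2 (hαpos τ hτ)).le)
  have hrlim : Tendsto (fun τ => γ τ 1) (pastEnd J) (𝓝 X) :=
    tendsto_const_nhds.congr' (hJ.mono fun τ hτ => (hrJ τ hτ).symm)
  obtain ⟨l, hl, hl0, -⟩ := exists_tendsto_of_deriv_nonneg h.ordConnected hτ₀.1
    (fun τ hτ hle => hinv τ ⟨hτ, hle.trans_lt hτ₀.2⟩)
    (fun τ hτ hle => by have := (hρ τ ⟨hτ, hle.trans_lt hτ₀.2⟩).1; positivity)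
    (B := 0) (fun τ hτ hle => (inv_pos.2 (hαpos τ ⟨hτ, hle.trans_lt hτ₀.2⟩)).le)
  -- if `1 / α` had a positive limit, the orbit could be extended
  rcases hl0.eq_or_lt with rfl | hl0
  swap
  · refine absurd hbdd (h.not_bddBelow hg hin hX.rm_lt hrlim ?_)
    simpa using (hl.inv₀ hl0.ne').isBigO_one ℝ
  have hT : ∀ τ ∈ J', HasDerivAt (fun τ => γ τ 0)
      ((X ^ 2 + a ^ 2) * S.alpha (γ τ) (deriv γ τ) / rhoSq a (γ τ 1) (γ τ 4)) τ := by
    intro τ hτ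
    refine (hasDerivAt_pi.1 (h.hasDerivAt τ hτ.1) 0).congr_deriv ?_
    have h1 := S.rhoSq_mul_velocity_zero (γ τ) (deriv γ τ)
    have h2 := (hρ τ hτ).1.ne'
    rw [hb τ hτ, hrJ τ hτ, mul_zero, sub_zero] at h1
    rw [hrJ τ hτ] at h2 ⊢
    rw [← h1]
    field_simp
  have hA : ∀ τ ∈ J', HasDerivAt (fun τ => S.angleX X (γ τ))
      ((0 - a * S.alpha (γ τ) (deriv γ τ)) / rhoSq a (γ τ 1) (γ τ 4)) τ := by
    intro τ hτ
    have h1 := (((hT τ hτ).sub_const (S.tShift X)).const_mul (a / (X ^ 2 + a ^ 2))).const_sub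
      (-S.phiShift X)
    refine (h1.congr_of_eventuallyEq ?_).congr_deriv ?_
    · filter_upwards [hJo.mem_nhds hτ] with t ht
      rw [angleX, tBL, hrJ t ht]
    · have h2 := (hρ τ hτ).1.ne'
      field_simp
      ring
  obtain ⟨q, hq⟩ := h.exists_tendsto_kruskalPoint hbdd (X := X) (D := fun _ => 0) (hJ.mono hA)
    (isBigO_zero _ _)
  -- the Kruskal coordinate is an affine parameter of the generator
  have hW : ∀ τ ∈ J', HasDerivAt
      (fun τ => S.horizonCoord X ε (γ τ) * S.alpha (γ τ) (deriv γ τ)) 0 τ := by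
    intro τ hτ
    have h1 : HasDerivAt (fun τ => S.horizonCoord X ε (γ τ)) _ τ :=
      ((((hT τ hτ).sub_const (S.tShift X)).add_const (ε * S.rstar X)).const_mul
        (S.kappa X)).exp.congr_of_eventuallyEq (by
          filter_upwards [hJo.mem_nhds hτ] with t ht
          rw [horizonCoord, tBL, hrJ t ht])
    refine (h1.fun_mul (hα τ hτ)).congr_deriv ?_
    have h2 := (hρ τ hτ).1.ne'
    rw [horizonCoord, tBL, hrJ τ hτ, hX.kappa_eq] at *
    field_simp
    ring
  obtain ⟨C, hC⟩ := exists_eq_const_of_hasDerivAt_zero hJo hJc hW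
  refine pastApproaches_of_tendsto hX h.nonempty h.mem hrlim (w := 0) ?_
    (tendsto_const_nhds.congr' ?_) hq
  · refine (by simpa using hl.const_mul C : Tendsto _ _ (𝓝 (0 : ℝ))).congr' ?_
    filter_upwards [hJ] with τ hτ
    have h1 := (hαpos τ hτ).ne'
    rw [← hC τ hτ]
    field_simp
  · -- on the horizon the other Kruskal coordinate is zero, as the sign of `0` is `0`
    filter_upwards [hJ] with τ hτ
    rw [crossCoord, hrJ τ hτ]
    simp

end IsNullOrbit

end

section

variable {S}

/-! ### Orbits beyond a horizon -/

theorem tendsto_abs_of_sq {l : Filter ℝ} {g : ℝ → ℝ} {c : ℝ}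
    (h : Tendsto (fun τ => g τ ^ 2) l (𝓝 (c ^ 2))) (hg : ∀ᶠ τ in l, 0 ≤ g τ) :
    Tendsto g l (𝓝 |c|) := by
  have := (Real.continuous_sqrt.continuousAt.tendsto.comp h)
  rw [Real.sqrt_sq_eq_abs] at this
  exact this.congr' (hg.mono fun τ hτ => Real.sqrt_sq hτ)

namespace IsNullOrbit

open Asymptotics

variable {γ : ℝ → Fin 5 → ℝ} {J : Set ℝ} {E L K X ε rlim : ℝ}

/-- The only orbits with `K = 0` and a zero of the radial function are the generators of the
horizons, on which `r` is constant. -/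
theorem carter_pos_of_radialVel_ne_zero (h : S.IsNullOrbit γ J E L K)
    (hy : ∃ τ ∈ J, S.radialVel (γ τ) (deriv γ τ) ≠ 0) {r : ℝ} (hr : 0 < r)
    (hP : radialP lam a E L r = 0) : 0 < K := by
  refine lt_of_le_of_ne h.carter_nonneg fun hK => ?_
  obtain ⟨rfl, rfl⟩ := h.eq_zero_of_carter_eq_zero hK.symm hr hP
  obtain rfl := hK
  obtain ⟨τ, hτ, h1⟩ := hy
  exact h1 (h.radialVel_eq_zero_of_trivial hτ)

theorem tendsto_sq_radialVel (h : S.IsNullOrbit γ J E L K) (hX : S.IsHorizon X ε)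
    (hr : Tendsto (fun τ => γ τ 1) (pastEnd J) (𝓝 X)) :
    Tendsto (fun τ => (ε * S.radialVel (γ τ) (deriv γ τ)) ^ 2) (pastEnd J)
      (𝓝 (radialP lam a E L X ^ 2)) := by
  have h1 := (hasDerivAt_radialR lam a E L K X).continuousAt.tendsto.comp hr
  rw [radialR, hX.deltaR_self, zero_mul, sub_zero] at h1
  refine h1.congr' ?_
  filter_upwards [eventually_mem_pastEnd J] with τ hτ
  rw [Function.comp_apply, ← h.sq_radialVel hτ, mul_pow, sq ε, hX.sq_eq_one, one_mul]

theorem exists_rhoSq_le (h : S.IsNullOrbit γ J E L K)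
    (hr : Tendsto (fun τ => γ τ 1) (pastEnd J) (𝓝 rlim)) :
    ∃ Q > 0, ∀ᶠ τ in pastEnd J, 0 < rhoSq a (γ τ 1) (γ τ 4) ∧ rhoSq a (γ τ 1) (γ τ 4) ≤ Q := by
  have ha := S.a_pos
  refine ⟨(|rlim| + 1) ^ 2 + a ^ 2, by positivity, ?_⟩
  filter_upwards [eventually_mem_pastEnd J,
    hr.eventually (gt_mem_nhds (show rlim < |rlim| + 1 by linarith [le_abs_self rlim]))]
    with τ h1 h2
  refine ⟨h.rhoSq_pos h1, ?_⟩
  have h3 := h.r_pos h1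
  have h4 := h.sq_cos_le_one h1
  unfold rhoSq
  nlinarith [mul_nonneg (sq_nonneg a) (sub_nonneg.2 h4), abs_nonneg rlim]

/-- A limiting radius is reached in finite time if the limiting radial velocity is not zero. -/
theorem bddBelow_of_radialVel {c : ℝ} (h : S.IsNullOrbit γ J E L K)
    (hr : Tendsto (fun τ => γ τ 1) (pastEnd J) (𝓝 rlim)) {η : ℝ} (hc : 0 < c)
    (hy : Tendsto (fun τ => η * S.radialVel (γ τ) (deriv γ τ)) (pastEnd J) (𝓝 c)) :
    BddBelow J := by
  obtain ⟨Q, hQ, hρ⟩ := h.exists_rhoSq_le hr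
  refine bddBelow_of_drift h.ordConnected h.nonempty (f := fun τ => η * γ τ 1) (c := c / 2 / Q)
    (B := η * rlim - 1) (by positivity) ((eventually_mem_pastEnd J).mono fun τ hτ =>
      (h.hasDerivAt_r hτ).const_mul η) ?_ ?_
  · filter_upwards [hρ, hy.eventually (lt_mem_nhds (show c / 2 < c by linarith))] with τ h1 h2
    rw [← mul_div_assoc]
    exact div_le_div₀ (by linarith) h2.le h1.1 h1.2
  · exact ((hr.const_mul η).eventually (lt_mem_nhds (show η * rlim - 1 < η * rlim by
      linarith))).mono fun τ hτ => hτ.le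

/-- Along an orbit that comes out of the block `I` through `r = X` with nonzero radial velocity,
`dT - a sin² θ dΦ` is bounded at the crossing. -/
theorem isBigO_alpha_of_crossing (h : S.IsNullOrbit γ J E L K) (hX : S.IsHorizon X ε)
    (hr : Tendsto (fun τ => γ τ 1) (pastEnd J) (𝓝 X)) (hne : ∀ᶠ τ in pastEnd J, γ τ 1 ≠ X)
    (hP : radialP lam a E L X ≠ 0)
    (hy : Tendsto (fun τ => ε * S.radialVel (γ τ) (deriv γ τ)) (pastEnd J)
      (𝓝 (-radialP lam a E L X))) :
    (fun τ => S.alpha (γ τ) (deriv γ τ)) =O[pastEnd J] fun _ => (1 : ℝ) := by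
  have hχ := S.chi_pos.ne'
  have hεε := hX.sq_eq_one
  have hQ := (IsHorizon.continuous_deltaQuot (S := S) (X := X) (ε := ε)).continuousAt.tendsto.comp hr
  have hPr := (hasDerivAt_radialP lam a E L X).continuousAt.tendsto.comp hr
  have hdif := hPr.sub hy
  have hdif0 : radialP lam a E L X - -radialP lam a E L X ≠ 0 := by
    rw [sub_neg_eq_add, ← two_mul]
    exact mul_ne_zero two_ne_zero hP
  have hlim := (((tendsto_const_nhds (x := K)).div hdif hdif0).sub
    ((hy.const_mul (2 / (S.rc - S.rp))).div hQ hX.deltaQuot_self_pos.ne')).const_mul (chi lam a)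
  refine (hlim.isBigO_one ℝ).congr' ?_ EventuallyEq.rfl
  filter_upwards [eventually_mem_pastEnd J, hne, hQ.eventually_ne hX.deltaQuot_self_pos.ne',
    hdif.eventually_ne hdif0] with τ h1 h2 h3 h4
  simp only [Function.comp_apply, Pi.div_apply] at h3 h4 ⊢
  have hD := hX.deltaR_eq (γ τ 1)
  have hs := hX.one_sub_slope (γ τ 1)
  have hp := h.radialP_eq τ h1
  have hR := h.sq_radialVel h1
  unfold radialR at hR
  have hx : ε * (γ τ 1 - X) ≠ 0 := mul_ne_zero (by rintro rfl; simp at hεε) (sub_ne_zero.2 h2)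
  generalize S.radialVel (γ τ) (deriv γ τ) = y at *
  generalize S.alpha (γ τ) (deriv γ τ) = α at *
  generalize radialP lam a E L (γ τ 1) = f at *
  generalize S.deltaQuot X ε (γ τ 1) = Q at *
  generalize S.slope (γ τ 1) = s at *
  generalize ε * (γ τ 1 - X) = x at *
  generalize 2 / (S.rc - S.rp) = k at *
  rw [hD] at hp hR
  apply mul_left_cancel₀ (mul_ne_zero hx h3)
  have e1 : K * (x * Q) = (f - ε * y) * (f + ε * y) := by
    linear_combination hR + y ^ 2 * hεε
  have e2 : x * Q * α = chi lam a * (f + s * y) := by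
    rw [hp]
    field_simp
    ring
  rw [e2]
  field_simp
  linear_combination e1 + (f - ε * y) * (ε * y) * hs + (f - ε * y) * s * y * hεε

/-- An inextendible orbit that stays beyond a horizon converges toward the past to the long
horizon. -/
theorem pastApproaches_of_beyond (h : S.IsNullOrbit γ J E L K) (hg : S.IsGeodesic γ J)
    (hin : S.IsInextendible γ J) (hX : S.IsHorizon X ε) (hle : ∀ τ ∈ J, ε * (γ τ 1 - X) ≤ 0) :
    S.PastApproachesPlus γ J ∨ S.PastApproachesC γ J := by
  have hJ := eventually_mem_pastEnd J
  have := pastEnd_neBot h.nonempty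
  have hεε := hX.sq_eq_one
  have hzero (τ) (h0 : ε * (γ τ 1 - X) = 0) : γ τ 1 = X := by
    linear_combination ε * h0 - (γ τ 1 - X) * hεε
  have hd : ∀ τ ∈ J, HasDerivAt (fun τ => -(ε * (γ τ 1 - X)))
      (-(ε * S.radialVel (γ τ) (deriv γ τ)) / rhoSq a (γ τ 1) (γ τ 4)) τ := fun τ hτ => by
    refine (((h.hasDerivAt_r hτ).sub_const X).const_mul ε).fun_neg.congr_deriv ?_
    ring
  have hd0 : ∀ τ ∈ J, 0 ≤ -(ε * S.radialVel (γ τ) (deriv γ τ)) / rhoSq a (γ τ 1) (γ τ 4) := by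
    intro τ hτ
    refine div_nonneg ?_ (h.rhoSq_pos hτ).le
    rcases (hle τ hτ).lt_or_eq with h1 | h1
    · linarith [h.radialVel_neg_of_beyond hX hτ h1]
    · linarith [(h.radialVel_of_horizon hX hτ (hzero τ h1)).2]
  obtain ⟨τ₁, hτ₁⟩ := h.nonempty
  -- on reaching the horizon in the past, the orbit stays on it, as `r` is monotone
  by_cases hex : ∃ τ₀ ∈ J, γ τ₀ 1 = X
  · obtain ⟨τ₀, hτ₀, hX0⟩ := hex
    refine h.pastApproaches_of_eventually_eq hg hin hX ?_
    have hmono : MonotoneOn (fun τ => -(ε * (γ τ 1 - X))) J := by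
      refine monotoneOn_of_deriv_nonneg h.ordConnected.convex
        (fun s hs => (hd s hs).continuousAt.continuousWithinAt)
        (fun s hs => (hd s (interior_subset hs)).differentiableAt.differentiableWithinAt)
        fun s hs => ?_
      rw [(hd s (interior_subset hs)).deriv]
      exact hd0 s (interior_subset hs)
    filter_upwards [hJ, eventually_le_pastEnd hτ₀] with τ h1 h2
    have h3 := hmono h1 hτ₀ h2
    simp only [hX0, sub_self, mul_zero, neg_zero] at h3
    exact hzero τ (le_antisymm (hle τ h1) (by linarith))
  push Not at hex
  have hlt : ∀ τ ∈ J, ε * (γ τ 1 - X) < 0 := fun τ hτ =>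
    lt_of_le_of_ne (hle τ hτ) fun h0 => hex τ hτ (hzero τ h0)
  have hyneg : ∀ τ ∈ J, ε * S.radialVel (γ τ) (deriv γ τ) < 0 := fun τ hτ =>
    h.radialVel_neg_of_beyond hX hτ (hlt τ hτ)
  have hyne : ∃ τ ∈ J, S.radialVel (γ τ) (deriv γ τ) ≠ 0 :=
    ⟨τ₁, hτ₁, fun h0 => by simpa [h0] using hyneg τ₁ hτ₁⟩
  obtain ⟨l, hl, hl0, hlle⟩ := exists_tendsto_of_deriv_nonneg h.ordConnected hτ₁
    (fun τ hτ _ => hd τ hτ) (fun τ hτ _ => hd0 τ hτ) (B := 0)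
    (fun τ hτ _ => neg_nonneg.2 (hle τ hτ))
  have hr : Tendsto (fun τ => γ τ 1) (pastEnd J) (𝓝 (X - ε * l)) := by
    refine ((hl.const_mul ε).const_sub X).congr fun τ => ?_
    linear_combination (γ τ 1 - X) * hεε
  rcases hl0.eq_or_lt with rfl | hl0
  · rw [mul_zero, sub_zero] at hr
    have hlt' := hJ.mono hlt
    have hne := hJ.mono hex
    by_cases hP : radialP lam a E L X = 0
    · have hK := h.carter_pos_of_radialVel_ne_zero hyne hX.pos hP
      refine h.pastApproaches_of_radialP_eq_zero hX ?_ hr hne hP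
      -- the radial velocity tends to zero, but its derivative does not, as `K > 0`
      have hQ0 := hX.deltaQuot_self_pos
      obtain ⟨Q, hQ, hρ⟩ := h.exists_rhoSq_le hr
      have hcR' : ContinuousAt (fun r => -(ε * radialRDeriv lam a E L K r)) X := by
        unfold radialRDeriv radialP deltaRDeriv
        fun_prop
      have hR' := hcR'.tendsto.comp hr
      have hval : -(ε * radialRDeriv lam a E L K X) = S.deltaQuot X ε X * K := by
        rw [radialRDeriv, hP, hX.deltaRDeriv_self]
        linear_combination S.deltaQuot X ε X * K * hεε
      rw [hval] at hR'
      have hpos : 0 < S.deltaQuot X ε X * K := by positivity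
      refine bddBelow_of_drift h.ordConnected h.nonempty
        (c := S.deltaQuot X ε X * K / 2 / (2 * Q)) (B := 0) (by positivity)
        (hJ.mono fun τ hτ => ((h.hasDerivAt_radialVel τ hτ).const_mul ε).fun_neg) ?_
        (hJ.mono fun τ hτ => neg_nonneg.2 (hyneg τ hτ).le)
      filter_upwards [hρ, hR'.eventually (lt_mem_nhds (half_lt_self hpos))] with τ h1 h2
      rw [← mul_div_assoc, ← neg_div]
      exact div_le_div₀ ((half_pos hpos).le.trans h2.le) h2.le
        (by linarith) (by linarith)
    have hy := (tendsto_abs_of_sq (g := fun τ => -(ε * S.radialVel (γ τ) (deriv γ τ)))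
      ((h.tendsto_sq_radialVel hX hr).congr fun τ => (neg_sq _).symm)
      (hJ.mono fun τ hτ => neg_nonneg.2 (hyneg τ hτ).le))
    have hb : BddBelow J := h.bddBelow_of_radialVel hr (η := -ε) (abs_pos.2 hP)
      (hy.congr fun τ => (neg_mul _ _).symm)
    have hy' := hy.neg
    simp only [neg_neg] at hy'
    rcases lt_or_gt_of_ne hP with hneg | hpos
    · rw [abs_of_neg hneg, neg_neg] at hy'
      exact h.pastApproaches_of_radialP_ne_zero hX hb hr (Or.inr hlt') hP hy'
    · rw [abs_of_pos hpos] at hy'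
      exact absurd hb (h.not_bddBelow hg hin hX.rm_lt hr
        (h.isBigO_alpha_of_crossing hX hr hne hP hy'))
  · -- a limit beyond the horizon, where `Δ_r < 0`, is not a root of `R`
    exfalso
    have hx : ε * (X - ε * l - X) = -l := by linear_combination (-l) * hεε
    have hrm : S.rm < X - ε * l := by
      have h1 := hlle τ₁ hτ₁ le_rfl
      have h2 := (h.mem τ₁ hτ₁).1
      have h3 := hX.rm_lt
      rcases hX with ⟨rfl, rfl⟩ | ⟨rfl, rfl⟩ <;> linarith
    have hD : deltaR lam a (X - ε * l) < 0 := by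
      rw [hX.deltaR_eq, hx]
      refine mul_neg_of_neg_of_pos (by linarith) (hX.deltaQuot_pos hrm ?_)
      have := hX.self_lt_other
      linear_combination this + hl0 - l * hεε
    obtain ⟨hR, -⟩ := h.double_root_of_tendsto hg hin hrm hr hD.ne (by
      rcases hX with ⟨rfl, rfl⟩ | ⟨rfl, rfl⟩
      · exact Or.inr (hJ.mono fun τ hτ => by linarith [hyneg τ hτ])
      · exact Or.inl (hJ.mono fun τ hτ => by linarith [hyneg τ hτ]))
    unfold radialR at hR
    have hK := h.carter_nonneg
    have hP : radialP lam a E L (X - ε * l) = 0 := by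
      have : radialP lam a E L (X - ε * l) ^ 2 ≤ 0 := by nlinarith
      exact pow_eq_zero_iff two_ne_zero |>.1 (le_antisymm this (sq_nonneg _))
    have hKpos := h.carter_pos_of_radialVel_ne_zero hyne (S.rm_pos.trans hrm) hP
    rw [hP] at hR
    nlinarith

end IsNullOrbit

end

section

variable {S}

/-! ### Orbits in the block `I` close to a horizon -/

namespace IsNullOrbit

variable {γ : ℝ → Fin 5 → ℝ} {J : Set ℝ} {E L K X ε m : ℝ}

/-- In the block `I`, the limiting radius of an inextendible orbit is that of a horizon, if there
are no circular orbits nearby. -/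
theorem false_of_tendsto_block (h : S.IsNullOrbit γ J E L K) (hg : S.IsGeodesic γ J)
    (hin : S.IsInextendible γ J) {rlim : ℝ}
    (hr : Tendsto (fun τ => γ τ 1) (pastEnd J) (𝓝 rlim)) (h1 : S.rp < rlim) (h2 : rlim < S.rc)
    (hsgn : (∀ᶠ τ in pastEnd J, 0 < S.radialVel (γ τ) (deriv γ τ)) ∨
      ∀ᶠ τ in pastEnd J, S.radialVel (γ τ) (deriv γ τ) < 0)
    (hneg : 0 < radialP lam a E L rlim → radialR lam a E L K rlim = 0 →
      radialRDeriv lam a E L K rlim ≠ 0) : False := by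
  have hJ := eventually_mem_pastEnd J
  have := pastEnd_neBot h.nonempty
  have hrm := S.rm_lt_rp
  have hD := deltaR_pos h1 h2
  obtain ⟨hR, hR'⟩ := h.double_root_of_tendsto hg hin (hrm.trans h1) hr hD.ne' hsgn
  have hPr := (hasDerivAt_radialP lam a E L rlim).continuousAt.tendsto.comp hr
  have hP0 : 0 ≤ radialP lam a E L rlim := by
    refine ge_of_tendsto hPr ?_
    filter_upwards [hJ, hr.eventually (lt_mem_nhds h1), hr.eventually (gt_mem_nhds h2)]
      with τ e1 e2 e3 using (h.radialP_pos e1 e2 e3).le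
  rcases hP0.eq_or_lt with hP | hP
  · have hK : 0 < K := by
      refine h.carter_pos_of_radialVel_ne_zero ?_ ((S.rm_pos.trans hrm).trans h1) hP.symm
      rcases hsgn with hs | hs
      · obtain ⟨τ, e1, e2⟩ := (hJ.and hs).exists
        exact ⟨τ, e1, e2.ne'⟩
      · obtain ⟨τ, e1, e2⟩ := (hJ.and hs).exists
        exact ⟨τ, e1, e2.ne⟩
    rw [radialR, ← hP] at hR
    nlinarith
  · exact hneg hP hR hR'

/-- An inextendible orbit which in the past stays in a part of the block `I` next to a horizon
where all radial turning points face the horizon converges to the long horizon: it has at most one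
turning point, so its radius converges, and the horizon is the only possible limit. -/
theorem pastApproaches_of_block (h : S.IsNullOrbit γ J E L K) (hg : S.IsGeodesic γ J)
    (hin : S.IsInextendible γ J) (hX : S.IsHorizon X ε)
    (hm : ε * (m - (S.rp + S.rc - X)) < 0)
    (hblock : ∀ᶠ τ in pastEnd J, 0 < ε * (γ τ 1 - X) ∧ ε * (γ τ 1 - m) ≤ 0)
    (hneg : ∀ r, 0 < ε * (r - X) → ε * (r - m) ≤ 0 → 0 < radialP lam a E L r →
      radialR lam a E L K r = 0 → ε * radialRDeriv lam a E L K r < 0) :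
    S.PastApproachesPlus γ J ∨ S.PastApproachesC γ J := by
  have hJ := eventually_mem_pastEnd J
  have := pastEnd_neBot h.nonempty
  have hεε := hX.sq_eq_one
  have hε : ε ≠ 0 := by rintro rfl; simp at hεε
  obtain ⟨τ₁, hτ₁, hb₁⟩ := (eventually_pastEnd h.nonempty).1 hblock
  have hin' (r : ℝ) (e1 : 0 < ε * (r - X)) (e2 : ε * (r - m) ≤ 0) : S.rp < r ∧ r < S.rc :=
    (hX.mem_block_iff r).1 ⟨e1, by linarith⟩
  have hP : ∀ τ ∈ J, τ ≤ τ₁ → 0 < radialP lam a E L (γ τ 1) := fun τ hτ hle =>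
    have hI := hin' _ (hb₁ τ hτ hle).1 (hb₁ τ hτ hle).2
    h.radialP_pos hτ hI.1 hI.2
  have hd : ∀ τ ∈ J, HasDerivAt (fun τ => ε * (γ τ 1 - X))
      (ε * S.radialVel (γ τ) (deriv γ τ) / rhoSq a (γ τ 1) (γ τ 4)) τ := fun τ hτ => by
    refine (((h.hasDerivAt_r hτ).sub_const X).const_mul ε).congr_deriv ?_
    ring
  -- `ε y` changes sign at most once, from positive to negative
  have hturn (s t : ℝ) (hs : s ∈ J) (ht : t ∈ J) (hst : s < t) (ht₁ : t ≤ τ₁)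
      (hs0 : ε * S.radialVel (γ s) (deriv γ s) ≤ 0) : ε * S.radialVel (γ t) (deriv γ t) < 0 := by
    have hsub : Set.Icc s t ⊆ J := h.ordConnected.out hs ht
    refine neg_of_deriv_neg_at_zeros (f := fun τ => ε * S.radialVel (γ τ) (deriv γ τ)) hst
      (fun τ hτ => (h.hasDerivAt_radialVel τ (hsub hτ)).const_mul ε) (fun τ hτ h0 => ?_) hs0
    have e := hb₁ τ (hsub hτ) (hτ.2.trans ht₁)
    have hR := h.sq_radialVel (hsub hτ)
    have hy0 : S.radialVel (γ τ) (deriv γ τ) = 0 := by simpa [hε] using h0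
    rw [hy0, zero_pow two_ne_zero] at hR
    rw [← mul_div_assoc]
    exact div_neg_of_neg_of_pos
      (hneg _ e.1 e.2 (hP τ (hsub hτ) (hτ.2.trans ht₁)) hR.symm)
      (mul_pos two_pos (h.rhoSq_pos (hsub hτ)))
  have hlimit (l : ℝ) (hl : Tendsto (fun τ => ε * (γ τ 1 - X)) (pastEnd J) (𝓝 l)) :
      Tendsto (fun τ => γ τ 1) (pastEnd J) (𝓝 (X + ε * l)) ∧ ε * (X + ε * l - m) ≤ 0 := by
    have hr : Tendsto (fun τ => γ τ 1) (pastEnd J) (𝓝 (X + ε * l)) := by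
      refine ((hl.const_mul ε).const_add X).congr fun τ => ?_
      linear_combination (γ τ 1 - X) * hεε
    exact ⟨hr, le_of_tendsto ((hr.sub_const m).const_mul ε) (hblock.mono fun τ hτ => hτ.2)⟩
  have hcase (l : ℝ) (hl : Tendsto (fun τ => ε * (γ τ 1 - X)) (pastEnd J) (𝓝 l)) (hl0 : 0 < l)
      (hs : (∀ᶠ τ in pastEnd J, 0 < ε * S.radialVel (γ τ) (deriv γ τ)) ∨
        ∀ᶠ τ in pastEnd J, ε * S.radialVel (γ τ) (deriv γ τ) < 0) : False := by
    obtain ⟨hr, hlm⟩ := hlimit l hl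
    have hx : ε * (X + ε * l - X) = l := by linear_combination l * hεε
    have hI := hin' _ (hx.symm ▸ hl0) hlm
    refine h.false_of_tendsto_block hg hin hr hI.1 hI.2 ?_ fun e1 e2 e3 => ?_
    · rcases hX with ⟨-, rfl⟩ | ⟨-, rfl⟩
      · simpa only [one_mul] using hs
      · simpa only [neg_one_mul, neg_pos, neg_neg_iff_pos, Left.neg_neg_iff] using hs.symm
    · have := hneg _ (hx.symm ▸ hl0) hlm e1 e2
      rw [e3, mul_zero] at this
      exact lt_irrefl _ this
  -- either the orbit recedes from the horizon at all early times, or it approaches it until `τ₁`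
  by_cases hs : ∃ s ∈ J, s ≤ τ₁ ∧ ∀ t ∈ J, t ≤ s → 0 < ε * S.radialVel (γ t) (deriv γ t)
  · obtain ⟨s, hsJ, hs₁, hpos⟩ := hs
    have hpos' : ∀ᶠ τ in pastEnd J, 0 < ε * S.radialVel (γ τ) (deriv γ τ) :=
      (eventually_pastEnd h.nonempty).2 ⟨s, hsJ, hpos⟩
    obtain ⟨l, hl, hl0, -⟩ := exists_tendsto_of_deriv_nonneg h.ordConnected hsJ
      (fun τ hτ _ => hd τ hτ)
      (fun τ hτ hle => div_nonneg (hpos τ hτ hle).le (h.rhoSq_pos hτ).le) (B := 0)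
      (fun τ hτ hle => (hb₁ τ hτ (hle.trans hs₁)).1.le)
    rcases hl0.eq_or_lt with rfl | hl0
    swap
    · exact (hcase l hl hl0 (Or.inl hpos')).elim
    have hr := (hlimit 0 hl).1
    rw [mul_zero, add_zero] at hr
    have hPr := (hasDerivAt_radialP lam a E L X).continuousAt.tendsto.comp hr
    have hP0 : 0 ≤ radialP lam a E L X := by
      refine ge_of_tendsto hPr ((eventually_pastEnd h.nonempty).2
        ⟨τ₁, hτ₁, fun τ hτ hle => (hP τ hτ hle).le⟩)
    have hyne : ∃ τ ∈ J, S.radialVel (γ τ) (deriv γ τ) ≠ 0 :=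
      ⟨s, hsJ, fun h0 => by simpa [h0] using hpos s hsJ le_rfl⟩
    rcases hP0.eq_or_lt with hP0 | hP0
    · -- near the horizon the potential would be negative
      exfalso
      have hK := h.carter_pos_of_radialVel_ne_zero hyne hX.pos hP0.symm
      have hQ := hX.deltaQuot_self_pos
      have hPeq (r : ℝ) : radialP lam a E L r = chi lam a * E * (r + X) * (r - X) := by
        have : radialP lam a E L r = radialP lam a E L r - radialP lam a E L X := by
          rw [← hP0, sub_zero]
        rw [this]
        unfold radialP
        ring
      have hc : ContinuousAt (fun r => (chi lam a * E * (r + X)) ^ 2 * (ε * (r - X))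
          - S.deltaQuot X ε r * K) X := by
        have := (IsHorizon.continuous_deltaQuot (S := S) (X := X) (ε := ε)).continuousAt (x := X)
        fun_prop
      have hlim := hc.tendsto.comp hr
      have h0 : 0 ≤ (chi lam a * E * (X + X)) ^ 2 * (ε * (X - X)) - S.deltaQuot X ε X * K := by
        refine ge_of_tendsto hlim ?_
        filter_upwards [hJ, hblock] with τ e1 e2
        have hR := h.sq_radialVel e1
        rw [radialR, hPeq, hX.deltaR_eq] at hR
        have e3 : S.radialVel (γ τ) (deriv γ τ) ^ 2 = ε * (γ τ 1 - X) *
            ((chi lam a * E * (γ τ 1 + X)) ^ 2 * (ε * (γ τ 1 - X))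
              - S.deltaQuot X ε (γ τ 1) * K) := by
          rw [hR]
          linear_combination (-(chi lam a * E * (γ τ 1 + X) * (γ τ 1 - X)) ^ 2) * hεε
        exact nonneg_of_mul_nonneg_right (e3 ▸ sq_nonneg _) e2.1
      rw [sub_self, mul_zero, mul_zero, zero_sub] at h0
      nlinarith
    · have hy := tendsto_abs_of_sq (h.tendsto_sq_radialVel hX hr) (hpos'.mono fun τ hτ => hτ.le)
      rw [abs_of_pos hP0] at hy
      exact h.pastApproaches_of_radialP_ne_zero hX (h.bddBelow_of_radialVel hr hP0 hy) hr
        (Or.inl (hblock.mono fun τ hτ => hτ.1)) hP0.ne' hy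
  · push Not at hs
    exfalso
    have hneg' : ∀ t ∈ J, t ≤ τ₁ → ε * S.radialVel (γ t) (deriv γ t) < 0 := by
      intro t ht ht₁
      obtain ⟨δ, hδ, hball⟩ := Metric.isOpen_iff.1 h.isOpen t ht
      have ht' : t - δ / 2 ∈ J := hball (by
        rw [Metric.mem_ball, Real.dist_eq, abs_lt]
        constructor <;> linarith)
      obtain ⟨s, hsJ, hst, hs0⟩ := hs (t - δ / 2) ht' (by linarith)
      exact hturn s t hsJ ht (by linarith) ht₁ hs0
    obtain ⟨l, hl, -, hle⟩ := exists_tendsto_of_deriv_nonneg h.ordConnected hτ₁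
      (fun τ hτ _ => (hd τ hτ).fun_neg)
      (fun τ hτ hle => by
        rw [← neg_div]
        exact div_nonneg (neg_nonneg.2 (hneg' τ hτ hle).le) (h.rhoSq_pos hτ).le)
      (B := -(ε * (m - X)))
      (fun τ hτ hle => by linarith [(hb₁ τ hτ hle).2])
    refine hcase (-l) (by simpa using hl.neg) ?_ (Or.inr ?_)
    · linarith [hle τ₁ hτ₁ le_rfl, (hb₁ τ₁ hτ₁ le_rfl).1]
    · exact (eventually_pastEnd h.nonempty).2 ⟨τ₁, hτ₁, hneg'⟩

end IsNullOrbit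

end

section

/-! ### Small parameters -/

theorem nonempty_of_small (hl : 0 < lam) (hl1 : lam < 1 / 1000) (ha : 0 < a) (ha1 : a < 1 / 100) :
    Nonempty (KerrDeSitter lam a) := by
  have hc : Continuous (deltaR lam a) := by
    unfold deltaR
    fun_prop
  have ha2 : a ^ 2 < 1 / 10000 := by nlinarith
  have hla : 0 < lam * a ^ 2 := by positivity
  have h0 : 0 < deltaR lam a 0 := by
    unfold deltaR
    nlinarith
  have h1 : deltaR lam a 1 < 0 := by
    unfold deltaR
    nlinarith
  have h3 : 0 < deltaR lam a 3 := by
    unfold deltaR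
    nlinarith
  set R := 1 / √lam with hR
  have hs : 0 < √lam := Real.sqrt_pos.2 hl
  have hs3 : √lam < 1 / 3 := by
    rw [Real.sqrt_lt' (by norm_num)]
    linarith
  have hR3 : 3 < R := by
    rw [hR, lt_div_iff₀ hs]
    linarith
  have h4 : deltaR lam a R < 0 := by
    have : lam * R ^ 2 = 1 := by
      rw [hR, div_pow, Real.sq_sqrt hl.le]
      field_simp
    unfold deltaR
    rw [this]
    linarith
  obtain ⟨rm, hm, hm0⟩ := intermediate_value_Ioo' zero_le_one hc.continuousOn ⟨h1, h0⟩
  obtain ⟨rp, hp, hp0⟩ := intermediate_value_Ioo (by norm_num) hc.continuousOn ⟨h1, h3⟩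
  obtain ⟨rc, hcc, hc0⟩ := intermediate_value_Ioo' hR3.le hc.continuousOn ⟨h4, h3⟩
  exact ⟨⟨rm, rp, rc, hl, ha, hm.1, hm.2.trans hp.1, hp.2.trans hcc.1, hm0, hp0, hc0⟩⟩

/-- For small parameters, the horizons are separated by the radii `3/2`, `5/2` and `4`. -/
theorem bounds_of_small (hl1 : lam < 1 / 1000) (ha1 : a < 1 / 100) :
    3 / 2 < S.rp ∧ S.rp < 5 / 2 ∧ 4 < S.rc := by
  have hl := S.lam_pos
  have ha := S.a_pos
  have ha2 : a ^ 2 < 1 / 10000 := by nlinarith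
  have hla : 0 < lam * a ^ 2 := by positivity
  have hla2 : lam * a ^ 2 < 1 / 1000 := by nlinarith
  have hn := S.rn_neg
  have hm := S.rm_pos
  have hmp := S.rm_lt_rp
  have hpc := S.rp_lt_rc
  have h1 : deltaR lam a (3 / 2) < 0 := by
    unfold deltaR
    nlinarith
  have h2 : 0 < deltaR lam a (5 / 2) := by
    unfold deltaR
    nlinarith
  have h3 : 0 < deltaR lam a 4 := by
    unfold deltaR
    nlinarith
  have hneg (r : ℝ) (h : S.rc ≤ r) : deltaR lam a r ≤ 0 := by
    rw [S.deltaR_factor]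
    have e1 : 0 ≤ r - S.rp := by linarith
    have e2 : 0 ≤ r - S.rc := by linarith
    have e3 : 0 ≤ (r - S.rm) * (r - S.rn) := mul_nonneg (by linarith) (by linarith)
    have : 0 ≤ lam * (r - S.rp) * (r - S.rc) * ((r - S.rm) * (r - S.rn)) := by positivity
    linarith
  have hneg' (r : ℝ) (h : S.rm ≤ r) (h' : r ≤ S.rp) : deltaR lam a r ≤ 0 := by
    rw [S.deltaR_factor]
    have e1 : 0 ≤ S.rp - r := by linarith
    have e2 : 0 ≤ S.rc - r := by linarith
    have e3 : 0 ≤ (r - S.rm) * (r - S.rn) := mul_nonneg (by linarith) (by linarith)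
    have : 0 ≤ lam * (S.rp - r) * (S.rc - r) * ((r - S.rm) * (r - S.rn)) := by positivity
    linarith
  have hpos (r : ℝ) (h0 : 0 < r) (h : r ≤ S.rm) : 0 ≤ deltaR lam a r := by
    rw [S.deltaR_factor]
    have e1 : 0 ≤ S.rp - r := by linarith
    have e2 : 0 ≤ S.rc - r := by linarith
    have e3 : 0 ≤ (S.rm - r) * (r - S.rn) := mul_nonneg (by linarith) (by linarith)
    have : 0 ≤ lam * (S.rp - r) * (S.rc - r) * ((S.rm - r) * (r - S.rn)) := by positivity
    linarith
  have hc4 : 4 < S.rc := by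
    by_contra hcon
    push Not at hcon
    linarith [hneg 4 hcon]
  have hm1 : S.rm < 3 / 2 := by
    by_contra hcon
    push Not at hcon
    linarith [hpos (3 / 2) (by norm_num) hcon]
  refine ⟨?_, ?_, hc4⟩
  · by_contra hcon
    push Not at hcon
    rcases hcon.lt_or_eq with h | h
    · linarith [deltaR_pos (S := S) h (by linarith)]
    · have := S.root_rp
      rw [h] at this
      unfold deltaR at h1
      linarith
  · by_contra hcon
    push Not at hcon
    linarith [hneg' (5 / 2) (by linarith) hcon]

/-- The square of a Killing field `∂_t + ω ∂_φ`, up to a positive factor. -/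
theorem rhoSq_mul_metric_killing {p : Fin 5 → ℝ} (hp : p ∈ S.spacetime) (rX : ℝ) :
    rhoSq a (p 1) (p 4) * chi lam a ^ 2 * S.metric p (S.killing rX p) (S.killing rX p)
      = -deltaR lam a (p 1) * (1 - a * (a / (rX ^ 2 + a ^ 2)) * (1 - p 4 ^ 2)) ^ 2
        + deltaTheta lam a (p 4) * (1 - p 4 ^ 2)
          * (a - (p 1 ^ 2 + a ^ 2) * (a / (rX ^ 2 + a ^ 2))) ^ 2 := by
  have h1 := S.rhoSq_mul_metric_self hp (S.killing rX p)
  have hc := S.chi_pos.ne'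
  have hT := (S.deltaTheta_pos (p 4)).ne'
  have hk : chi lam a = deltaTheta lam a (p 4) + a ^ 2 * lam * (1 - p 4 ^ 2) := by
    unfold deltaTheta chi; ring
  have hρ' : p 1 ^ 2 + a ^ 2 = rhoSq a (p 1) (p 4) + a ^ 2 * (1 - p 4 ^ 2) := by
    unfold rhoSq; ring
  generalize hω : a / (rX ^ 2 + a ^ 2) = ω at *
  have hS : p 2 ^ 2 + p 3 ^ 2 = 1 - p 4 ^ 2 := by linarith [hp.2]
  have e1 : sphereSq (S.killing rX p) = ω ^ 2 * (1 - p 4 ^ 2) := by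
    simp [sphereSq, killing, dt, dphi, hω]
    linear_combination ω ^ 2 * hS
  have e2 : sigma p (S.killing rX p) = ω * (1 - p 4 ^ 2) := by
    simp [sigma, killing, dt, dphi, hω]
    linear_combination ω * hS
  have e3 : S.alpha p (S.killing rX p) = 1 - a * ω * (1 - p 4 ^ 2) := by
    rw [alpha, e2]
    simp [killing, dt, dphi]
    ring
  have e4 : S.radialVel p (S.killing rX p) = 0 := by
    simp [radialVel, killing, dt, dphi]
  unfold carter azimuthal at h1
  rw [e1, e2, e3, e4] at h1
  rw [hρ']
  generalize 1 - p 4 ^ 2 = s at *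
  generalize deltaR lam a (p 1) = D at *
  generalize deltaTheta lam a (p 4) = Dt at *
  generalize rhoSq a (p 1) (p 4) = q at *
  rw [mul_right_comm, h1]
  have hk' : a ^ 2 * lam * s = chi lam a - Dt := by linarith
  generalize chi lam a = c at *
  field_simp
  linear_combination (-s * (Dt + c) * (a - (q + a ^ 2 * s) * ω) ^ 2) * hk'

/-- A lower bound for `Δ_r` on the region where both Killing fields are timelike. -/
theorem one_lt_deltaR (hl : 0 < lam) (hl1 : lam < 1 / 1000) {r : ℝ} (h1 : 5 / 2 ≤ r)
    (h2 : r ≤ 4) : 1 < deltaR lam a r := by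
  have e0 : r ^ 2 ≤ 4 ^ 2 := by gcongr
  have e1 : lam * r ^ 2 ≤ 1 / 1000 * 4 ^ 2 := by gcongr
  have e2 : (1 - 16 / 1000) * (r ^ 2 + a ^ 2) ≤ (1 - lam * r ^ 2) * (r ^ 2 + a ^ 2) :=
    mul_le_mul_of_nonneg_right (by linarith) (by positivity)
  have e3 : 5 / 2 * r ≤ r ^ 2 := by nlinarith
  have e4 := sq_nonneg a
  unfold deltaR
  linarith

theorem metric_killing_neg (hl1 : lam < 1 / 1000) (ha1 : a < 1 / 100) {p : Fin 5 → ℝ}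
    (hp : p ∈ S.spacetime) (h1 : 5 / 2 ≤ p 1) (h2 : p 1 ≤ 4) {rX : ℝ} (hX : 3 / 2 < rX) :
    S.metric p (S.killing rX p) (S.killing rX p) < 0 := by
  have h := S.rhoSq_mul_metric_killing hp rX
  have hρ := rhoSq_pos (a := a) (S.rm_pos.trans hp.1) (p 4)
  have hχ := S.chi_pos
  have hl := S.lam_pos
  have ha := S.a_pos
  have hz : p 4 ^ 2 ≤ 1 := by
    have := hp.2
    have := sq_nonneg (p 2)
    have := sq_nonneg (p 3)
    linarith
  have hz0 := sq_nonneg (p 4)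
  have hD := one_lt_deltaR (a := a) hl hl1 h1 h2
  have hT0 := S.deltaTheta_pos (p 4)
  have ha2 : a ^ 2 ≤ (1 / 100) ^ 2 := by gcongr
  have hT : deltaTheta lam a (p 4) ≤ 2 := by
    have e1 : a ^ 2 * lam ≤ (1 / 100) ^ 2 * (1 / 1000) := by gcongr
    have e2 : a ^ 2 * lam * p 4 ^ 2 ≤ 1 := mul_le_one₀ (by linarith) hz0 hz
    unfold deltaTheta
    linarith
  generalize hω : a / (rX ^ 2 + a ^ 2) = ω at *
  have hω0 : 0 < ω := by
    rw [← hω]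
    positivity
  have hω1 : ω ≤ a / 2 := by
    rw [← hω]
    have : (3 / 2 : ℝ) ^ 2 ≤ rX ^ 2 := by gcongr
    gcongr
    linarith [sq_nonneg a]
  have e1 : 1 / 2 ≤ (1 - a * ω * (1 - p 4 ^ 2)) ^ 2 := by
    have e2 : a * ω * (1 - p 4 ^ 2) ≤ a * (a / 2) * 1 := by gcongr; linarith
    have e3 : (9 / 10) ^ 2 ≤ (1 - a * ω * (1 - p 4 ^ 2)) ^ 2 :=
      pow_le_pow_left₀ (by norm_num) (by linarith) 2
    linarith
  have e2 : (a - (p 1 ^ 2 + a ^ 2) * ω) ^ 2 ≤ (1 / 10) ^ 2 := by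
    have e0 : p 1 ^ 2 ≤ 4 ^ 2 := by gcongr
    have e3 : (p 1 ^ 2 + a ^ 2) * ω ≤ 18 * (a / 2) := by
      gcongr
      linarith
    have e4 : 0 < (p 1 ^ 2 + a ^ 2) * ω := by positivity
    apply sq_le_sq'
    · linarith
    · linarith
  have e3 : deltaTheta lam a (p 4) * (1 - p 4 ^ 2) * (a - (p 1 ^ 2 + a ^ 2) * ω) ^ 2
      ≤ 2 * 1 * (1 / 10) ^ 2 :=
    mul_le_mul (mul_le_mul hT (by linarith) (by linarith) zero_le_two) e2 (sq_nonneg _)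
      (by norm_num)
  have e4 := mul_le_mul hD.le e1 (by norm_num) (by linarith)
  have e5 : rhoSq a (p 1) (p 4) * chi lam a ^ 2
      * S.metric p (S.killing rX p) (S.killing rX p) < 0 := by
    rw [h, neg_mul]
    linarith
  exact neg_of_mul_neg_right e5 (by positivity)

/-- For small parameters, both Killing fields are timelike for `5/2 ≤ r ≤ 4`. -/
theorem mem_timelikeRegion_of_small (hl1 : lam < 1 / 1000) (ha1 : a < 1 / 100) {p : Fin 5 → ℝ}
    (hp : p ∈ S.spacetime) (h1 : 5 / 2 ≤ p 1) (h2 : p 1 ≤ 4) : p ∈ S.timelikeRegion := by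
  obtain ⟨h3, h4, h5⟩ := S.bounds_of_small hl1 ha1
  exact ⟨hp, S.metric_killing_neg hl1 ha1 hp h1 h2 h3,
    S.metric_killing_neg hl1 ha1 hp h1 h2 (by linarith)⟩

variable {S} {γ : ℝ → Fin 5 → ℝ} {J : Set ℝ} {E L K : ℝ}

/-- At a zero of the radial potential, `E` and `K` can be eliminated from `R'`, up to a small error:
`f² = Δ_r K`, and `χ ρ² E = f - a B`, where `B = χ (a sin² θ E - L)` satisfies `B² ≤ K Δ_θ`. The
number `c` is the value of `cos² θ` at a point of the orbit. -/
theorem IsNullOrbit.abs_radialRDeriv_sub_le (h : S.IsNullOrbit γ J E L K) {r : ℝ} (hr0 : S.rp < r)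
    (hr1 : r < S.rc) (ha : a ^ 2 ≤ 2 * r) (hal : a ^ 2 * lam ≤ 1)
    (hP : 0 < radialP lam a E L r) (hR : radialR lam a E L K r = 0) :
    ∃ c, 0 ≤ c ∧ c ≤ 1 ∧ |(r ^ 2 + a ^ 2 * c) * deltaR lam a r * radialRDeriv lam a E L K r
      - radialP lam a E L r ^ 2 * (4 * r * deltaR lam a r
        - (r ^ 2 + a ^ 2 * c) * deltaRDeriv lam a r)| ≤ 6 * a * r ^ 2 * radialP lam a E L r ^ 2 := by
  obtain ⟨τ, hτ⟩ := h.nonempty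
  have hB := h.sq_le_carter hτ
  have hz := h.sq_cos_le_one hτ
  have hD := deltaR_pos hr0 hr1
  have hr : 0 < r := (S.rm_pos.trans S.rm_lt_rp).trans hr0
  have ha0 := S.a_pos
  have hl := S.lam_pos
  refine ⟨γ τ 4 ^ 2, sq_nonneg _, hz, ?_⟩
  have hT : deltaTheta lam a (γ τ 4) ≤ 2 := by
    have e2 : a ^ 2 * lam * γ τ 4 ^ 2 ≤ 1 := mul_le_one₀ hal (sq_nonneg _) hz
    unfold deltaTheta
    linarith
  have hDr : deltaR lam a r ≤ r ^ 2 := by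
    have : 0 ≤ lam * r ^ 2 * (r ^ 2 + a ^ 2) := by positivity
    unfold deltaR
    linarith
  unfold radialR at hR
  generalize hz' : γ τ 4 ^ 2 = z at *
  generalize deltaTheta lam a (γ τ 4) = Dt at *
  have hf : radialP lam a E L r - a * (chi lam a * (a * (1 - z) * E - L))
      = chi lam a * (r ^ 2 + a ^ 2 * z) * E := by
    unfold radialP
    ring
  unfold radialRDeriv
  rw [← mul_pow] at hB
  generalize radialP lam a E L r = f at *
  generalize chi lam a * (a * (1 - z) * E - L) = B at *
  generalize hDd : deltaR lam a r = D at *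
  generalize deltaRDeriv lam a r = D' at *
  have e1 : (r ^ 2 + a ^ 2 * z) * D * (4 * chi lam a * r * E * f - D' * K)
      - f ^ 2 * (4 * r * D - (r ^ 2 + a ^ 2 * z) * D') = -(4 * a * r * f * (D * B)) := by
    linear_combination (-4 * r * f * D) * hf + (r ^ 2 + a ^ 2 * z) * D' * hR
  have hK : 0 ≤ K := h.carter_nonneg
  have e2 : |D * B| ≤ 3 / 2 * r * f := by
    have e3 : (D * B) ^ 2 ≤ (3 / 2 * r * f) ^ 2 := by
      have e4 : D * B ^ 2 ≤ f ^ 2 * 2 := by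
        calc D * B ^ 2 ≤ D * (K * Dt) := by gcongr
          _ ≤ D * (K * 2) := by gcongr
          _ = f ^ 2 * 2 := by linear_combination (-2) * hR
      calc (D * B) ^ 2 = D * (D * B ^ 2) := by ring
        _ ≤ r ^ 2 * (f ^ 2 * 2) := by gcongr
        _ ≤ (3 / 2 * r * f) ^ 2 := by nlinarith [mul_pos (sq_pos_of_pos hr) (sq_pos_of_pos hP)]
    exact abs_le_of_sq_le_sq e3 (by positivity)
  rw [e1, abs_neg, abs_mul, abs_of_pos (by positivity : 0 < 4 * a * r * f)]
  calc 4 * a * r * f * |D * B| ≤ 4 * a * r * f * (3 / 2 * r * f) := by gcongr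
    _ = 6 * a * r ^ 2 * f ^ 2 := by ring

/-- For small parameters, the turning points with `r ≤ 5/2` in the block `I` face the event
horizon. -/
theorem IsNullOrbit.radialRDeriv_neg (h : S.IsNullOrbit γ J E L K) (hl1 : lam < 1 / 1000)
    (ha1 : a < 1 / 100) {r : ℝ} (hr0 : S.rp < r) (hr1 : r ≤ 5 / 2)
    (hP : 0 < radialP lam a E L r) (hR : radialR lam a E L K r = 0) :
    radialRDeriv lam a E L K r < 0 := by
  obtain ⟨h3, h4, h5⟩ := S.bounds_of_small hl1 ha1
  have hl := S.lam_pos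
  have ha := S.a_pos
  have ha2 : a ^ 2 < 1 / 10000 := by nlinarith
  have hla : a ^ 2 * lam ≤ 1 / 1000 := by nlinarith
  have hr : 3 / 2 < r := by linarith
  obtain ⟨c, hc0, hc1, hc⟩ := h.abs_radialRDeriv_sub_le hr0 (by linarith) (by linarith)
    (by linarith) hP hR
  have hD := deltaR_pos hr0 (show r < S.rc by linarith)
  have hD' : 0 ≤ deltaRDeriv lam a r := by
    have e1 : lam * r ^ 3 ≤ 1 / 1000 * (5 / 2) ^ 3 := by gcongr
    have e2 : a ^ 2 * lam * r ≤ 1 / 1000 * (5 / 2) := by gcongr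
    unfold deltaRDeriv
    linarith
  -- the factor `3 - r` reflects the photon sphere `r = 3` of the nonrotating black hole
  have e1 : 4 * r * deltaR lam a r - r ^ 2 * deltaRDeriv lam a r
      = -(r * (2 * r * (3 - r) - 4 * a ^ 2 + 2 * (a ^ 2 * lam) * r ^ 2)) := by
    unfold deltaR deltaRDeriv
    ring
  have e2 : 4 * r * deltaR lam a r - (r ^ 2 + a ^ 2 * c) * deltaRDeriv lam a r + 6 * a * r ^ 2
      < 0 := by
    have e3 : 0 ≤ a ^ 2 * c * deltaRDeriv lam a r := by positivity
    have e4 : 0 ≤ r * ((a ^ 2 * lam) * r ^ 2) := by positivity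
    have e5 : r * (4 * a ^ 2) ≤ r * (4 / 10000) := by gcongr; linarith
    have e6 : 6 * a * r ^ 2 ≤ 6 * (1 / 100) * r ^ 2 := by gcongr
    have e7 : r ^ 2 ≤ r * (2 * r * (3 - r)) := by nlinarith
    nlinarith
  have hf2 : 0 < radialP lam a E L r ^ 2 := by positivity
  have e3 := (abs_le.1 hc).2
  have e4 : (r ^ 2 + a ^ 2 * c) * deltaR lam a r * radialRDeriv lam a E L K r < 0 := by
    nlinarith
  exact neg_of_mul_neg_right e4 (by positivity)

/-- For small parameters, the turning points with `4 ≤ r` in the block `I` face the cosmological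
horizon. -/
theorem IsNullOrbit.radialRDeriv_pos (h : S.IsNullOrbit γ J E L K) (hl1 : lam < 1 / 1000)
    (ha1 : a < 1 / 100) {r : ℝ} (hr0 : 4 ≤ r) (hr1 : r < S.rc)
    (hP : 0 < radialP lam a E L r) (hR : radialR lam a E L K r = 0) :
    0 < radialRDeriv lam a E L K r := by
  obtain ⟨h3, h4, h5⟩ := S.bounds_of_small hl1 ha1
  have hl := S.lam_pos
  have ha := S.a_pos
  have ha2 : a ^ 2 < 1 / 10000 := by nlinarith
  have hla : a ^ 2 * lam ≤ 1 / 1000 := by nlinarith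
  have hr : 0 < r := by linarith
  obtain ⟨c, hc0, hc1, hc⟩ := h.abs_radialRDeriv_sub_le (by linarith) hr1 (by linarith)
    (by linarith) hP hR
  have hD := deltaR_pos (show S.rp < r by linarith) hr1
  -- large `r` are controlled by `Δ_r > 0`, which implies `lam r² < 1`
  have hlr : lam * r ^ 2 ≤ 1 := by
    by_contra hcon
    push Not at hcon
    have : 0 < (lam * r ^ 2 - 1) * (r ^ 2 + a ^ 2) := mul_pos (by linarith) (by positivity)
    unfold deltaR at hD
    linarith
  have e1 : 4 * r * deltaR lam a r - r ^ 2 * deltaRDeriv lam a r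
      = r * (2 * r * (r - 3) + 4 * a ^ 2 - 2 * a ^ 2 * (lam * r ^ 2)) := by
    unfold deltaR deltaRDeriv
    ring
  have e2 : 0 < 4 * r * deltaR lam a r - (r ^ 2 + a ^ 2 * c) * deltaRDeriv lam a r
      - 6 * a * r ^ 2 := by
    have e3 : a ^ 2 * c * deltaRDeriv lam a r ≤ r := by
      have e4 : deltaRDeriv lam a r ≤ 2 * r := by
        have : 0 ≤ lam * r ^ 3 := by positivity
        have : 0 ≤ lam * a ^ 2 * r := by positivity
        unfold deltaRDeriv
        linarith
      have e5 : a ^ 2 * c ≤ 1 / 2 := by nlinarith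
      have e6 : 0 ≤ a ^ 2 * c := by positivity
      nlinarith
    have e5 : a ^ 2 * (lam * r ^ 2) ≤ a ^ 2 := mul_le_of_le_one_right (by positivity) hlr
    have e6 : 6 * a * r ^ 2 ≤ 6 * (1 / 100) * r ^ 2 := by gcongr
    have e7 : 2 * r ^ 2 ≤ r * (2 * r * (r - 3)) := by nlinarith
    nlinarith
  have hf2 : 0 < radialP lam a E L r ^ 2 := by positivity
  have e3 := (abs_le.1 hc).1
  have e4 : 0 < (r ^ 2 + a ^ 2 * c) * deltaR lam a r * radialRDeriv lam a E L K r := by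
    nlinarith
  exact pos_of_mul_pos_right e4 (by positivity)

/-- For small parameters, an inextendible null orbit that avoids the region in which both Killing
fields are timelike converges toward the past to a long horizon. -/
theorem IsNullOrbit.pastApproaches_of_small (h : S.IsNullOrbit γ J E L K) (hg : S.IsGeodesic γ J)
    (hin : S.IsInextendible γ J) (hl1 : lam < 1 / 1000) (ha1 : a < 1 / 100)
    (hreg : ∀ τ ∈ J, γ τ ∉ S.timelikeRegion) :
    S.PastApproachesPlus γ J ∨ S.PastApproachesC γ J := by
  obtain ⟨h3, h4, h5⟩ := S.bounds_of_small hl1 ha1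
  have hX : S.IsHorizon S.rp 1 := Or.inl ⟨rfl, rfl⟩
  have hY : S.IsHorizon S.rc (-1) := Or.inr ⟨rfl, rfl⟩
  by_cases hp : ∀ τ ∈ J, γ τ 1 ≤ S.rp
  · exact h.pastApproaches_of_beyond hg hin hX fun τ hτ => by linarith [hp τ hτ]
  by_cases hc : ∀ τ ∈ J, S.rc ≤ γ τ 1
  · exact h.pastApproaches_of_beyond hg hin hY fun τ hτ => by linarith [hc τ hτ]
  push Not at hp hc
  obtain ⟨τp, hτp, hp⟩ := hp
  obtain ⟨τc, hτc, hc⟩ := hc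
  -- once the orbit has left the block `I`, it does not return
  have hpp : ∀ τ ∈ J, τ ≤ τp → S.rp < γ τ 1 := fun τ hτ hle => by
    by_contra hcon
    linarith [h.beyond_of_le hX hτ hτp hle (by linarith)]
  have hcc : ∀ τ ∈ J, τ ≤ τc → γ τ 1 < S.rc := fun τ hτ hle => by
    by_contra hcon
    linarith [h.beyond_of_le hY hτ hτc hle (by linarith)]
  have hsplit : (∀ τ ∈ J, γ τ 1 ≤ 5 / 2) ∨ ∀ τ ∈ J, 4 ≤ γ τ 1 := by
    by_contra hcon
    push Not at hcon
    obtain ⟨⟨s, hs, hs1⟩, t, ht, ht1⟩ := hcon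
    have hout (τ) (hτ : τ ∈ J) (e1 : 5 / 2 ≤ γ τ 1) (e2 : γ τ 1 ≤ 4) : False :=
      hreg τ hτ (S.mem_timelikeRegion_of_small hl1 ha1 (h.mem τ hτ) e1 e2)
    have hcont : ContinuousOn (fun τ => γ τ 1) J := fun τ hτ =>
      (h.hasDerivAt_r hτ).continuousAt.continuousWithinAt
    by_cases hs4 : γ s 1 ≤ 4
    · exact hout s hs hs1.le hs4
    by_cases ht3 : 5 / 2 ≤ γ t 1
    · exact hout t ht ht3 ht1.le
    obtain ⟨τ, hτ, he⟩ := h.ordConnected.isPreconnected.intermediate_value ht hs hcont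
      (show (3 : ℝ) ∈ Set.Icc (γ t 1) (γ s 1) by constructor <;> linarith)
    exact hout τ hτ (by linarith) (by linarith)
  rcases hsplit with hs | hs
  · refine h.pastApproaches_of_block hg hin hX (m := 5 / 2) (by linarith)
      ((eventually_pastEnd h.nonempty).2 ⟨τp, hτp, fun τ hτ hle => ?_⟩) fun r e1 e2 e3 e4 => ?_
    · have := hpp τ hτ hle
      have := hs τ hτ
      constructor <;> linarith
    · rw [one_mul]
      exact h.radialRDeriv_neg hl1 ha1 (by linarith) (by linarith) e3 e4
  · refine h.pastApproaches_of_block hg hin hY (m := 4) (by linarith)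
      ((eventually_pastEnd h.nonempty).2 ⟨τc, hτc, fun τ hτ hle => ?_⟩) fun r e1 e2 e3 e4 => ?_
    · have := hcc τ hτ hle
      have := hs τ hτ
      constructor <;> linarith
    · linarith [h.radialRDeriv_pos hl1 ha1 (by linarith) (by linarith) e3 e4]

end

end KerrDeSitter

end

theorem mainTheorem8 :
    ∃ lam0 : ℝ, 0 < lam0 ∧ ∃ a0 : ℝ, 0 < a0 ∧
      ∀ lam a : ℝ, 0 < lam → lam < lam0 → 0 < a → a < a0 →
        Nonempty (KerrDeSitter lam a) ∧
        ∀ (S : KerrDeSitter lam a) (γ : ℝ → Fin 5 → ℝ) (J : Set ℝ),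
          S.IsFutureNullGeodesic γ J → S.IsInextendible γ J →
          ¬ S.PastApproachesPlus γ J → ¬ S.PastApproachesC γ J →
            ∃ τ ∈ J, γ τ ∈ S.timelikeRegion := by
  refine ⟨1 / 1000, by norm_num, 1 / 100, by norm_num, fun lam a hl hl1 ha ha1 =>
    ⟨KerrDeSitter.nonempty_of_small hl hl1 ha ha1, fun S γ J hγ hin hplus hc => ?_⟩⟩
  by_contra hreg
  push Not at hreg
  obtain ⟨E, L, K, h⟩ := hγ.exists_isNullOrbit
  rcases h.pastApproaches_of_small hγ.1 hin hl1 ha1 hreg with h1 | h1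
  exacts [hplus h1, hc h1]
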